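/- **Conventions.** Let $A$ be a C*-algebra. Write $M_\infty(A)=\bigcup_{n\ge 1} M_n(A)$, where $M_n(A)$ embeds in $M_{n+1}(A)$ by $a\mapsto\operatorname{diag}(a,0)$, and let $\mathcal K\otimes A$ be the stabilization of $A$ (the completion of $M_\infty(A)$ in its C*-norm, where $\mathcal K$ is the algebra of compact operators on a separable infinite-dimensional Hilbert space). For $a,b\in M_\infty(A)_+$ write $a\precsim_A b$ if there is a sequence $(y_k)$ in $M_\infty(A)$ with $y_k b y_k^*\to a$ in norm, and $a\sim_A b$ if $a\precsim_A b$ and $b\precsim_A a$. The ordered semigroup $\mathrm W(A)=M_\infty(A)_+/\!\sim_A$ consists of the classes $\langle a\rangle_A$, with $\langle a\rangle_A+\langle b\rangle_A=\langle\operatorname{diag}(a,b)\rangle_A$ and $\langle a\rangle_A\le\langle b\rangle_A$ if and only if $a\precsim_A b$; and $\mathrm{Cu}(A)=\mathrm W(\mathcal K\otimes A)$. A homomorphism $\theta\colon A\to B$ induces maps $\mathrm W(\theta)\colon\mathrm W(A)\to\mathrm W(B)$ and $\mathrm{Cu}(\theta)\colon\mathrm{Cu}(A)\to\mathrm{Cu}(B)$.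 The soft part $A_{++}$ is the set of all $a\in A_+$ for which there is no projection $q\in M_\infty(A)$ with $\langle a\rangle_A=\langle q\rangle_A$. Let $\mathrm{Cu}_+(A)\subseteq\mathrm{Cu}(A)$ be the set of classes of elements of $(\mathcal K\otimes A)_{++}$, and let $\mathrm W_+(A)=\mathrm{Cu}_+(A)\cap\mathrm W(A)$, that is, the set of all $\langle a\rangle_A$ with $a\in M_\infty(A)_+$ such that the class of $a$ in $\mathrm{Cu}(A)$ lies in $\mathrm{Cu}_+(A)$. An action $\alpha\colon G\to\operatorname{Aut}(A)$ of a finite group $G$ on an infinite-dimensional simple unital C*-algebra $A$ is *weakly tracially strictly approximately inner* if for every finite set $F\subset A$, every $\varepsilon>0$, and every positive $x\in A$ with $\|x\|=1$, there are a positive element $c$ of the fixed point algebra $A^\alpha$ with $\|c\|\le 1$ and contractions $s_g\in\overline{cAc}$, for $g\in G$, such that: 1. $\|s_1-c\|<\varepsilon$ and $\|s_g^*-s_{g^{-1}}\|<\varepsilon$ for all $g\in G$; 2. $\|s_gs_h-cs_{gh}\|<\varepsilon$ for all $g,h\in G$; 3. $\|ca-ac\|<\varepsilon$ for all $a\in F\cup\{s_g\colon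 g\in G\}$; 4. $\|\alpha_g(cac)-s_gas_g^*\|<\varepsilon$ for all $a\in F$ and $g\in G$; 5. $(1-c-\varepsilon)_+\precsim_A x$; 6. $\|cxc\|>1-\varepsilon$. **Theorem.** Let $A$ be a stably finite simple unital C*-algebra which is not of type I, and let $\alpha\colon G\to\operatorname{Aut}(A)$ be a weakly tracially strictly approximately inner action of a finite group $G$. Let $\iota\colon A\to C^*(G,A,\alpha)$ be the inclusion of $A$ in the crossed product. Then $\mathrm W_+(A)\cup\{0\}$ and $\mathrm{Cu}_+(A)\cup\{0\}$ are subsemigroups of $\mathrm W(A)$ and $\mathrm{Cu}(A)$, and: (a) the map $\mathrm W(\iota)\colon\mathrm W(A)\to\mathrm W(C^*(G,A,\alpha))$ restricts to an isomorphism of ordered semigroups from $\mathrm W_+(A)\cup\{0\}$ onto its image in $\mathrm W(C^*(G,A,\alpha))$; (b) the map $\mathrm{Cu}(\iota)\colon\mathrm{Cu}(A)\to\mathrm{Cu}(C^*(G,A,\alpha))$ restricts to an isomorphism of ordered semigroups from $\mathrm{Cu}_+(A)\cup\{0\}$ onto its image in $\mathrm{Cu}(C^*(G,A,\alpha))$.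 -/

import Mathlib

noncomputable section

namespace CuntzSemigroup

open Filter Topology Matrix

universe u v

section Comparison

variable {A : Type u} [NonUnitalCStarAlgebra A]
variable {l m n p : Type*}

/-- Cuntz subequivalence of square matrices of possibly different sizes over `A`: `a` is the norm limit of
elements `y_k b y_k*`. In `M_∞(A)` the sequence `y_k` may be cut down to the corners that carry `a`
and `b`, so it consists of rectangular matrices; norm convergence of matrices of a fixed size is
entrywise norm convergence. -/
def Subeq [Fintype n] (a : Matrix m m A) (b : Matrix n n A) : Prop :=
  ∃ y : ℕ → Matrix m n A, Tendsto (fun k => y k * b * (y k)ᴴ) atTop (𝓝 a)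

theorem subeq_iff_mem_closure [Finite m] [Fintype n] (a : Matrix m m A) (b : Matrix n n A) :
    Subeq a b ↔ a ∈ closure (Set.range fun y : Matrix m n A => y * b * yᴴ) := by
  have : FirstCountableTopology (Matrix m m A) :=
    inferInstanceAs (FirstCountableTopology (m → m → A))
  rw [mem_closure_iff_seq_limit]
  constructor
  · rintro ⟨y, hy⟩
    exact ⟨_, fun k => ⟨y k, rfl⟩, hy⟩
  · rintro ⟨x, hx, hlim⟩
    choose y hy using hx
    refine ⟨y, ?_⟩
    have : (fun k => y k * b * (y k)ᴴ) = x := funext hy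
    rw [this]
    exact hlim

theorem Subeq.refl [Fintype m] (a : Matrix m m A) : Subeq a a := by
  classical
  let : PartialOrder A := CStarAlgebra.spectralOrder A
  have : StarOrderedRing A := CStarAlgebra.spectralOrderedRing A
  rw [subeq_iff_mem_closure]
  have hu := CStarAlgebra.increasingApproximateUnit A
  have := hu.neBot
  refine mem_closure_of_tendsto (f := fun e : A => (Matrix.diagonal fun _ : m => e) * a *
    (Matrix.diagonal fun _ : m => e)ᴴ) (b := CStarAlgebra.approximateUnit A) ?_
    (Eventually.of_forall fun e => ⟨_, rfl⟩)
  refine tendsto_pi_nhds.2 fun i => tendsto_pi_nhds.2 fun j => ?_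
  have h1 : Tendsto (fun e : A => e * a i j) (CStarAlgebra.approximateUnit A) (𝓝 (a i j)) :=
    hu.tendsto_mul_right (a i j)
  have h2 : Tendsto (fun e : A => e * a i j * star e) (CStarAlgebra.approximateUnit A)
      (𝓝 (a i j)) := by
    have h3 : Tendsto (fun e : A => a i j * e) (CStarAlgebra.approximateUnit A) (𝓝 (a i j)) :=
      hu.tendsto_mul_left (a i j)
    have h4 : Tendsto (fun e : A => (e * a i j - a i j) * star e + a i j * e)
        (CStarAlgebra.approximateUnit A) (𝓝 (0 + a i j)) := by
      refine Tendsto.add ?_ h3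
      rw [tendsto_zero_iff_norm_tendsto_zero]
      have h5 : Tendsto (fun e : A => ‖e * a i j - a i j‖) (CStarAlgebra.approximateUnit A)
          (𝓝 0) := by
        rw [← tendsto_zero_iff_norm_tendsto_zero]
        simpa using h1.sub_const (a i j)
      refine squeeze_zero' (Eventually.of_forall fun _ => norm_nonneg _) ?_ h5
      filter_upwards [hu.eventually_norm] with e he
      calc _ ≤ ‖e * a i j - a i j‖ * ‖star e‖ := norm_mul_le _ _
        _ ≤ ‖e * a i j - a i j‖ * 1 := by rw [norm_star]; gcongr
        _ = _ := mul_one _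
    rw [zero_add] at h4
    refine h4.congr' ?_
    filter_upwards [hu.eventually_star_eq] with e he
    rw [he, sub_mul, sub_add_cancel]
  refine h2.congr fun e => ?_
  simp [Matrix.diagonal_conjTranspose, Matrix.mul_diagonal, Matrix.diagonal_mul]

theorem Subeq.trans [Finite l] [Fintype m] [Fintype n]
    {a : Matrix l l A} {b : Matrix m m A} {c : Matrix n n A}
    (hab : Subeq a b) (hbc : Subeq b c) : Subeq a c := by
  rw [subeq_iff_mem_closure] at *
  rw [← closure_closure]
  refine closure_mono ?_ hab
  rintro _ ⟨y, rfl⟩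
  have hcont : Continuous fun x : Matrix m m A => y * x * yᴴ := by fun_prop
  refine map_mem_closure (f := fun x : Matrix m m A => y * x * yᴴ) hcont hbc ?_
  rintro _ ⟨z, rfl⟩
  exact ⟨y * z, by simp only [Matrix.conjTranspose_mul, Matrix.mul_assoc]⟩

theorem Subeq.submatrix [Fintype m] (a : Matrix m m A) (f : l → m) : Subeq (a.submatrix f f) a := by
  obtain ⟨y, hy⟩ := Subeq.refl a
  refine ⟨fun k => (y k).submatrix f id, ?_⟩
  have hcont : Continuous fun x : Matrix m m A => x.submatrix f f := by fun_prop
  refine ((hcont.tendsto a).comp hy).congr fun k => ?_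
  ext i j
  simp [Matrix.mul_apply]

theorem Subeq.of_submatrix_equiv [Fintype l] [Fintype m]
    (a : Matrix m m A) (e : l ≃ m) : Subeq a (a.submatrix e e) := by
  simpa using Subeq.submatrix (a.submatrix e e) e.symm

theorem Subeq.fromBlocks [Fintype n] [Fintype p]
    {a : Matrix l l A} {b : Matrix m m A} {c : Matrix n n A}
    {d : Matrix p p A} (hac : Subeq a c) (hbd : Subeq b d) :
    Subeq (Matrix.fromBlocks a 0 0 b) (Matrix.fromBlocks c 0 0 d) := by
  obtain ⟨y, hy⟩ := hac
  obtain ⟨z, hz⟩ := hbd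
  refine ⟨fun k => Matrix.fromBlocks (y k) 0 0 (z k), ?_⟩
  have hcont : Continuous fun x : Matrix l l A × Matrix m m A =>
      Matrix.fromBlocks x.1 0 0 x.2 := by fun_prop
  refine ((hcont.tendsto (a, b)).comp (hy.prodMk_nhds hz)).congr fun k => ?_
  simp [Matrix.fromBlocks_multiply, Matrix.fromBlocks_conjTranspose]

theorem Subeq.fromBlocks_zero [Fintype m]
    (a : Matrix m m A) :
    Subeq (Matrix.fromBlocks (0 : Matrix l l A) 0 0 a) a := by
  obtain ⟨y, hy⟩ := Subeq.refl a
  refine ⟨fun k => Matrix.fromRows 0 (y k), ?_⟩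
  have hcont : Continuous fun x : Matrix m m A =>
      Matrix.fromBlocks (0 : Matrix l l A) 0 0 x := by fun_prop
  refine ((hcont.tendsto a).comp hy).congr fun k => ?_
  ext i j
  rcases i with i | i <;> rcases j with j | j <;>
    simp [Matrix.mul_apply]

end Comparison

/-- A square matrix is positive if it is of the form `y* y`. -/
def IsPositive {A : Type u} [NonUnitalCStarAlgebra A] {n : Type*} [Fintype n]
    (a : Matrix n n A) : Prop :=
  ∃ y : Matrix n n A, a = yᴴ * y

/-- Elements of `M_∞(A)₊`: positive matrices over `A` of arbitrary size. -/
structure PosMat (A : Type u) [NonUnitalCStarAlgebra A] where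
  size : ℕ
  mat : Matrix (Fin size) (Fin size) A
  pos : IsPositive mat

section W

variable (A : Type u) [NonUnitalCStarAlgebra A]

/-- Cuntz subequivalence on `M_∞(A)₊`. -/
instance : Preorder (PosMat A) where
  le a b := Subeq a.mat b.mat
  le_refl a := Subeq.refl a.mat
  le_trans _ _ _ := Subeq.trans

variable {A}

theorem PosMat.le_def {a b : PosMat A} : a ≤ b ↔ Subeq a.mat b.mat := Iff.rfl

/-- The block diagonal matrix `diag(a, b)`. -/
def diagSum {m n : ℕ} (a : Matrix (Fin m) (Fin m) A) (b : Matrix (Fin n) (Fin n) A) :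
    Matrix (Fin (m + n)) (Fin (m + n)) A :=
  (Matrix.fromBlocks a 0 0 b).submatrix finSumFinEquiv.symm finSumFinEquiv.symm

theorem IsPositive.diagSum {m n : ℕ} {a : Matrix (Fin m) (Fin m) A} {b : Matrix (Fin n) (Fin n) A}
    (ha : IsPositive a) (hb : IsPositive b) : IsPositive (diagSum a b) := by
  obtain ⟨y, rfl⟩ := ha
  obtain ⟨z, rfl⟩ := hb
  refine ⟨CuntzSemigroup.diagSum y z, ?_⟩
  simp only [CuntzSemigroup.diagSum, Matrix.conjTranspose_submatrix, Matrix.submatrix_mul_equiv]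
  simp [Matrix.fromBlocks_multiply, Matrix.fromBlocks_conjTranspose]

instance : Add (PosMat A) where
  add a b := ⟨a.size + b.size, diagSum a.mat b.mat, a.pos.diagSum b.pos⟩

instance : Zero (PosMat A) where
  zero := ⟨0, 0, 0, by simp⟩

theorem PosMat.le_of_blocks {a b : PosMat A} {l m : Type*} [Fintype l] [Fintype m]
    (x : Matrix l l A) (y : Matrix m m A)
    (e : Fin a.size ≃ l) (hx : a.mat = x.submatrix e e) (f : Fin b.size ≃ m)
    (hy : b.mat = y.submatrix f f) (h : Subeq x y) : a ≤ b := by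
  rw [PosMat.le_def, hx, hy]
  exact (Subeq.submatrix x e).trans (h.trans (Subeq.of_submatrix_equiv y f))

theorem PosMat.add_le_add {a b c d : PosMat A} (h : a ≤ c) (h' : b ≤ d) : a + b ≤ c + d :=
  PosMat.le_of_blocks _ _ finSumFinEquiv.symm rfl finSumFinEquiv.symm rfl
    (Subeq.fromBlocks h h')

theorem PosMat.add_comm_le (a b : PosMat A) : a + b ≤ b + a := by
  refine PosMat.le_of_blocks _ _ finSumFinEquiv.symm rfl finSumFinEquiv.symm rfl ?_
  have := Subeq.submatrix (Matrix.fromBlocks b.mat 0 0 a.mat)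
    (Equiv.sumComm (Fin a.size) (Fin b.size))
  convert this using 1
  ext i j
  rcases i with i | i <;> rcases j with j | j <;> rfl

theorem diagSum_diagSum_left {k m n : ℕ} (a : Matrix (Fin k) (Fin k) A)
    (b : Matrix (Fin m) (Fin m) A) (c : Matrix (Fin n) (Fin n) A) :
    diagSum (diagSum a b) c =
      (Matrix.fromBlocks (Matrix.fromBlocks a 0 0 b) 0 0 c).submatrix
        (finSumFinEquiv.symm.trans (Equiv.sumCongr finSumFinEquiv.symm (Equiv.refl _)))
        (finSumFinEquiv.symm.trans (Equiv.sumCongr finSumFinEquiv.symm (Equiv.refl _))) := by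
  ext i j
  simp only [diagSum, Matrix.submatrix_apply, Equiv.trans_apply]
  rcases finSumFinEquiv.symm i with i | i <;> rcases finSumFinEquiv.symm j with j | j <;> simp

theorem diagSum_diagSum_right {k m n : ℕ} (a : Matrix (Fin k) (Fin k) A)
    (b : Matrix (Fin m) (Fin m) A) (c : Matrix (Fin n) (Fin n) A) :
    diagSum a (diagSum b c) =
      (Matrix.fromBlocks a 0 0 (Matrix.fromBlocks b 0 0 c)).submatrix
        (finSumFinEquiv.symm.trans (Equiv.sumCongr (Equiv.refl _) finSumFinEquiv.symm))
        (finSumFinEquiv.symm.trans (Equiv.sumCongr (Equiv.refl _) finSumFinEquiv.symm)) := by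
  ext i j
  simp only [diagSum, Matrix.submatrix_apply, Equiv.trans_apply]
  rcases finSumFinEquiv.symm i with i | i <;> rcases finSumFinEquiv.symm j with j | j <;> simp

theorem PosMat.add_assoc_le (a b c : PosMat A) : a + b + c ≤ a + (b + c) := by
  refine PosMat.le_of_blocks _ _ _ (diagSum_diagSum_left a.mat b.mat c.mat)
    _ (diagSum_diagSum_right a.mat b.mat c.mat) ?_
  have := Subeq.submatrix
    (Matrix.fromBlocks a.mat 0 0 (Matrix.fromBlocks b.mat 0 0 c.mat))
    (Equiv.sumAssoc (Fin a.size) (Fin b.size) (Fin c.size))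
  convert this using 1
  ext i j
  rcases i with (i | i) | i <;> rcases j with (j | j) | j <;> rfl

theorem PosMat.zero_add_le (a : PosMat A) : 0 + a ≤ a :=
  PosMat.le_of_blocks _ a.mat finSumFinEquiv.symm rfl (Equiv.refl _) rfl
    (Subeq.fromBlocks_zero a.mat)

theorem PosMat.le_zero_add (a : PosMat A) : a ≤ 0 + a := by
  refine PosMat.le_of_blocks a.mat _ (Equiv.refl _) rfl finSumFinEquiv.symm rfl ?_
  exact Subeq.submatrix
    (Matrix.fromBlocks (0 : PosMat A).mat 0 0 a.mat) (Sum.inr : Fin a.size → _)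

variable (A) in
/-- The semigroup `W(A)`: classes of elements of `M_∞(A)₊` up to Cuntz equivalence, with the order
induced by subequivalence and the addition induced by the block diagonal sum. -/
def W : Type u := Antisymmetrization (PosMat A) (· ≤ ·)

instance : PartialOrder (W A) :=
  inferInstanceAs (PartialOrder (Antisymmetrization (PosMat A) (· ≤ ·)))

/-- The class of an element of `M_∞(A)₊` in `W(A)`. -/
def W.mk (a : PosMat A) : W A := toAntisymmetrization (· ≤ ·) a

theorem W.mk_le_mk {a b : PosMat A} : W.mk a ≤ W.mk b ↔ a ≤ b := Iff.rfl

theorem W.mk_eq_mk {a b : PosMat A} : W.mk a = W.mk b ↔ a ≤ b ∧ b ≤ a := by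
  rw [le_antisymm_iff, W.mk_le_mk, W.mk_le_mk]

theorem W.ind {P : W A → Prop} (h : ∀ a, P (W.mk a)) (x : W A) : P x :=
  Quotient.inductionOn x h

instance : Add (W A) where
  add := Quotient.map₂ (· + ·) fun _ _ h _ _ h' =>
    ⟨PosMat.add_le_add h.1 h'.1, PosMat.add_le_add h.2 h'.2⟩

instance : Zero (W A) where
  zero := W.mk 0

theorem W.mk_add_mk (a b : PosMat A) : W.mk a + W.mk b = W.mk (a + b) := rfl

instance : AddCommMonoid (W A) where
  add_assoc x y z := by
    induction x using W.ind with | h a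
    induction y using W.ind with | h b
    induction z using W.ind with | h c
    simp only [W.mk_add_mk]
    refine le_antisymm (PosMat.add_assoc_le a b c) ?_
    change a + (b + c) ≤ a + b + c
    calc a + (b + c) ≤ b + c + a := PosMat.add_comm_le _ _
      _ ≤ b + (c + a) := PosMat.add_assoc_le _ _ _
      _ ≤ c + a + b := PosMat.add_comm_le _ _
      _ ≤ c + (a + b) := PosMat.add_assoc_le _ _ _
      _ ≤ a + b + c := PosMat.add_comm_le _ _
  add_comm x y := by
    induction x using W.ind with | h a
    induction y using W.ind with | h b
    exact le_antisymm (PosMat.add_comm_le a b) (PosMat.add_comm_le b a)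
  zero_add x := by
    induction x using W.ind with | h a
    exact le_antisymm (PosMat.zero_add_le a) (PosMat.le_zero_add a)
  add_zero x := by
    induction x using W.ind with | h a
    exact le_antisymm ((PosMat.add_comm_le a 0).trans (PosMat.zero_add_le a))
      ((PosMat.le_zero_add a).trans (PosMat.add_comm_le 0 a))
  nsmul := nsmulRec

end W

section Functoriality

variable {A : Type u} {B : Type v} [NonUnitalCStarAlgebra A] [NonUnitalCStarAlgebra B]
variable {m n : Type*}

theorem continuous_starHom (θ : A →⋆ₙₐ[ℂ] B) : Continuous θ :=
  AddMonoidHomClass.continuous_of_bound θ 1 fun x => by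
    simpa using NonUnitalStarAlgHom.norm_apply_le θ x

theorem Subeq.map [Fintype n] (θ : A →⋆ₙₐ[ℂ] B) {a : Matrix m m A} {b : Matrix n n A}
    (h : Subeq a b) : Subeq (a.map θ) (b.map θ) := by
  obtain ⟨y, hy⟩ := h
  refine ⟨fun k => (y k).map θ, ?_⟩
  have hcont : Continuous fun x : Matrix m m A => x.map θ :=
    continuous_id.matrix_map (continuous_starHom θ)
  refine ((hcont.tendsto a).comp hy).congr fun k => ?_
  ext i j
  simp [Matrix.mul_apply, map_star]

theorem IsPositive.map [Fintype n] (θ : A →⋆ₙₐ[ℂ] B) {a : Matrix n n A} (h : IsPositive a) :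
    IsPositive (a.map θ) := by
  obtain ⟨y, rfl⟩ := h
  refine ⟨y.map θ, ?_⟩
  ext i j
  simp [Matrix.mul_apply, map_star]

/-- Entrywise application of a star homomorphism. -/
def PosMat.map (θ : A →⋆ₙₐ[ℂ] B) (a : PosMat A) : PosMat B :=
  ⟨a.size, a.mat.map θ, a.pos.map θ⟩

/-- The map `W(θ) : W(A) → W(B)`, with `⟨a⟩ ↦ ⟨θ(a)⟩`. -/
def W.map (θ : A →⋆ₙₐ[ℂ] B) : W A →+ W B where
  toFun := Quotient.map (PosMat.map θ) fun _ _ h => ⟨Subeq.map θ h.1, Subeq.map θ h.2⟩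
  map_zero' := by
    change W.mk (PosMat.map θ 0) = W.mk 0
    rw [W.mk_eq_mk]
    have h : (PosMat.map θ 0).mat = (0 : PosMat B).mat := by
      ext i
      exact i.elim0
    constructor
    · exact (congrArg (fun z => Subeq z _) h).mpr (Subeq.refl _)
    · exact (congrArg (fun z => Subeq _ z) h).mpr (Subeq.refl _)
  map_add' x y := by
    induction x using W.ind with | h a
    induction y using W.ind with | h b
    change W.mk (PosMat.map θ (a + b)) = W.mk (PosMat.map θ a + PosMat.map θ b)
    have h : (PosMat.map θ (a + b)).mat = (PosMat.map θ a + PosMat.map θ b).mat := by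
      change (diagSum a.mat b.mat).map θ = diagSum (a.mat.map θ) (b.mat.map θ)
      rw [diagSum, diagSum, ← Matrix.submatrix_map, Matrix.fromBlocks_map,
        Matrix.map_zero _ (map_zero θ), Matrix.map_zero _ (map_zero θ)]
    rw [W.mk_eq_mk]
    constructor
    · exact (congrArg (fun z => Subeq z _) h).mpr (Subeq.refl _)
    · exact (congrArg (fun z => Subeq _ z) h).mpr (Subeq.refl _)

end Functoriality

/-- The completion of a normed algebra, with the extended operations; if the norm of `R` satisfies the
C⋆-identity, then it is a C⋆-algebra. -/
def CStarCompletion (R : Type u) [NonUnitalNormedRing R] : Type u := UniformSpace.Completion R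

namespace CStarCompletion

variable {R : Type u} [NonUnitalNormedRing R] [NormedSpace ℂ R]

instance : NormedAddCommGroup (CStarCompletion R) :=
  inferInstanceAs (NormedAddCommGroup (UniformSpace.Completion R))

instance : NormedSpace ℂ (CStarCompletion R) :=
  inferInstanceAs (NormedSpace ℂ (UniformSpace.Completion R))

instance : CompleteSpace (CStarCompletion R) :=
  inferInstanceAs (CompleteSpace (UniformSpace.Completion R))

/-- The isometric inclusion of `R` in its completion. -/
def of : R →ₗᵢ[ℂ] CStarCompletion R := UniformSpace.Completion.toComplₗᵢ

theorem denseRange_of : DenseRange (of : R → CStarCompletion R) :=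
  UniformSpace.Completion.denseRange_coe

theorem isDenseInducing_of : IsDenseInducing (of : R → CStarCompletion R) :=
  UniformSpace.Completion.isDenseInducing_coe

theorem continuous_of : Continuous (of : R → CStarCompletion R) := of.continuous

theorem of_smul (c : ℂ) (a : R) : (of (c • a) : CStarCompletion R) = c • of a :=
  of.toLinearMap.map_smul c a

theorem norm_of (a : R) : ‖of a‖ = ‖a‖ := of.norm_map a

theorem induction_on {p : CStarCompletion R → Prop} (x : CStarCompletion R)
    (hp : IsClosed {x | p x}) (h : ∀ a : R, p (of a)) : p x :=
  UniformSpace.Completion.induction_on x hp h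

theorem induction_on₂ {p : CStarCompletion R → CStarCompletion R → Prop}
    (x y : CStarCompletion R) (hp : IsClosed {z : CStarCompletion R × CStarCompletion R | p z.1 z.2})
    (h : ∀ a b : R, p (of a) (of b)) : p x y :=
  UniformSpace.Completion.induction_on₂ x y hp h

theorem induction_on₃ {p : CStarCompletion R → CStarCompletion R → CStarCompletion R → Prop}
    (x y z : CStarCompletion R)
    (hp : IsClosed {w : CStarCompletion R × CStarCompletion R × CStarCompletion R |
      p w.1 w.2.1 w.2.2})
    (h : ∀ a b c : R, p (of a) (of b) (of c)) : p x y z :=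
  UniformSpace.Completion.induction_on₃ x y z hp h

theorem uniformContinuous_extend {S : Type v} [NormedAddCommGroup S] [CompleteSpace S]
    {φ : R → S} (hφ : UniformContinuous φ) :
    Continuous (isDenseInducing_of.extend φ : CStarCompletion R → S) :=
  (uniformContinuous_uniformly_extend
    (UniformSpace.Completion.isUniformInducing_coe R) denseRange_of hφ).continuous

instance : Mul (CStarCompletion R) where
  mul := Function.curry <| (isDenseInducing_of.prodMap isDenseInducing_of).extend
    (of ∘ Function.uncurry (· * ·))

theorem of_mul (a b : R) : of (a * b) = of a * of b :=
  ((isDenseInducing_of.prodMap isDenseInducing_of).extend_eq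
    (continuous_of.comp continuous_mul) (a, b)).symm

instance : ContinuousMul (CStarCompletion R) where
  continuous_mul := by
    let o : R →+ CStarCompletion R := (of : R →ₗᵢ[ℂ] CStarCompletion R).toLinearMap.toAddMonoidHom
    let m : R →+ R →+ CStarCompletion R := (AddMonoidHom.mul : R →+ R →+ R).compr₂ o
    have : Continuous fun p : R × R => m p.1 p.2 := continuous_of.comp continuous_mul
    have di : IsDenseInducing (o : R → CStarCompletion R) := isDenseInducing_of
    exact di.extend_Z_bilin di this

instance : NonUnitalRing (CStarCompletion R) where
  __ : AddCommGroup (CStarCompletion R) := inferInstance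
  __ : Mul (CStarCompletion R) := inferInstance
  zero_mul x := by
    induction x using induction_on with
    | hp => exact isClosed_eq (by fun_prop) (by fun_prop)
    | h a => rw [← map_zero of, ← of_mul, zero_mul]
  mul_zero x := by
    induction x using induction_on with
    | hp => exact isClosed_eq (by fun_prop) (by fun_prop)
    | h a => rw [← map_zero of, ← of_mul, mul_zero]
  mul_assoc x y z := by
    induction x, y, z using induction_on₃ with
    | hp => exact isClosed_eq (by fun_prop) (by fun_prop)
    | h a b c => simp only [← of_mul, mul_assoc]
  left_distrib x y z := by
    induction x, y, z using induction_on₃ with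
    | hp => exact isClosed_eq (by fun_prop) (by fun_prop)
    | h a b c => simp only [← of_mul, ← map_add, mul_add]
  right_distrib x y z := by
    induction x, y, z using induction_on₃ with
    | hp => exact isClosed_eq (by fun_prop) (by fun_prop)
    | h a b c => simp only [← of_mul, ← map_add, add_mul]

instance : NonUnitalNormedRing (CStarCompletion R) where
  __ : NormedAddCommGroup (CStarCompletion R) := inferInstance
  __ : NonUnitalRing (CStarCompletion R) := inferInstance
  norm_mul_le x y := by
    induction x, y using induction_on₂ with
    | hp => exact isClosed_le (by fun_prop) (by fun_prop)
    | h a b => simpa only [← of_mul, norm_of] using norm_mul_le a b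

variable [StarRing R] [CStarRing R]

instance : Star (CStarCompletion R) where
  star := isDenseInducing_of.extend fun a => of (star a)

theorem uniformContinuous_of_star :
    UniformContinuous fun a : R => (of (star a) : CStarCompletion R) :=
  of.isometry.uniformContinuous.comp (starNormedAddGroupHom (E := R)).uniformContinuous

theorem of_star (a : R) : of (star a) = star (of a) :=
  (isDenseInducing_of.extend_eq (continuous_of.comp continuous_star) a).symm

instance : ContinuousStar (CStarCompletion R) where
  continuous_star := uniformContinuous_extend uniformContinuous_of_star

instance : StarRing (CStarCompletion R) where
  star_involutive x := by
    induction x using induction_on with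
    | hp => exact isClosed_eq (by fun_prop) (by fun_prop)
    | h a => simp only [← of_star, star_star]
  star_mul x y := by
    induction x, y using induction_on₂ with
    | hp => exact isClosed_eq (by fun_prop) (by fun_prop)
    | h a b => simp only [← of_star, ← of_mul, star_mul]
  star_add x y := by
    induction x, y using induction_on₂ with
    | hp => exact isClosed_eq (by fun_prop) (by fun_prop)
    | h a b => simp only [← of_star, ← map_add, star_add]

instance : CStarRing (CStarCompletion R) where
  norm_mul_self_le x := by
    induction x using induction_on with
    | hp => exact isClosed_le (by fun_prop) (by fun_prop)
    | h a => simpa only [← of_star, ← of_mul, norm_of] using CStarRing.norm_mul_self_le a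

/-- The inclusion of `R` in its completion as a star homomorphism. -/
def ofStarHom : R →⋆ₙₐ[ℂ] CStarCompletion R where
  toFun := of
  map_smul' c a := of_smul c a
  map_zero' := map_zero of
  map_add' := map_add of
  map_mul' := of_mul
  map_star' := of_star

variable {S : Type v} [NonUnitalCStarAlgebra S]

/-- The continuous extension of a contractive star homomorphism to the completion. -/
def lift (φ : R →⋆ₙₐ[ℂ] S) (hφ : ∀ a, ‖φ a‖ ≤ ‖a‖) : CStarCompletion R →⋆ₙₐ[ℂ] S :=
  have hu : UniformContinuous φ :=
    uniformContinuous_addMonoidHom_of_continuous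
      (AddMonoidHomClass.continuous_of_bound φ 1 fun x => by simpa using hφ x)
  have hψ : Continuous (isDenseInducing_of.extend φ : CStarCompletion R → S) :=
    uniformContinuous_extend hu
  have hof : ∀ a : R, (isDenseInducing_of.extend φ : CStarCompletion R → S) (of a) = φ a :=
    isDenseInducing_of.extend_eq hu.continuous
  { toFun := isDenseInducing_of.extend φ
    map_smul' := fun c x => by
      have h1 : Continuous fun x : CStarCompletion R => c • x := continuous_const_smul c
      have h2 : Continuous fun x : S => c • x := continuous_const_smul c
      induction x using induction_on with
      | hp => exact isClosed_eq (hψ.comp h1) (h2.comp hψ)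
      | h a => rw [← of_smul, hof, hof, map_smul]; rfl
    map_zero' := by rw [← map_zero of, hof, map_zero]
    map_add' := fun x y => by
      induction x, y using induction_on₂ with
      | hp => exact isClosed_eq (by fun_prop) (by fun_prop)
      | h a b => rw [← map_add, hof, hof, hof, map_add]
    map_mul' := fun x y => by
      induction x, y using induction_on₂ with
      | hp => exact isClosed_eq (by fun_prop) (by fun_prop)
      | h a b => rw [← of_mul, hof, hof, hof, map_mul]
    map_star' := fun x => by
      induction x using induction_on with
      | hp => exact isClosed_eq (by fun_prop) (by fun_prop)
      | h a => rw [← of_star, hof, hof, map_star] }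

theorem lift_of (φ : R →⋆ₙₐ[ℂ] S) (hφ : ∀ a, ‖φ a‖ ≤ ‖a‖) (a : R) :
    lift φ hφ (of a) = φ a :=
  isDenseInducing_of.extend_eq
    (AddMonoidHomClass.continuous_of_bound φ 1 fun x => by simpa using hφ x) a

variable [IsScalarTower ℂ R R] [SMulCommClass ℂ R R] [StarModule ℂ R]

instance : IsScalarTower ℂ (CStarCompletion R) (CStarCompletion R) where
  smul_assoc c x y := by
    have h1 : Continuous fun x : CStarCompletion R => c • x := continuous_const_smul c
    simp only [smul_eq_mul]
    induction x, y using induction_on₂ with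
    | hp =>
      exact isClosed_eq ((h1.comp continuous_fst).mul continuous_snd)
        (h1.comp (continuous_fst.mul continuous_snd))
    | h a b => rw [← of_smul, ← of_mul, ← of_mul, ← of_smul, smul_mul_assoc]

instance : SMulCommClass ℂ (CStarCompletion R) (CStarCompletion R) where
  smul_comm c x y := by
    have h1 : Continuous fun x : CStarCompletion R => c • x := continuous_const_smul c
    simp only [smul_eq_mul]
    induction x, y using induction_on₂ with
    | hp =>
      exact isClosed_eq (h1.comp (continuous_fst.mul continuous_snd))
        (continuous_fst.mul (h1.comp continuous_snd))
    | h a b => rw [← of_smul, ← of_mul, ← of_mul, ← of_smul, mul_smul_comm]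

instance : StarModule ℂ (CStarCompletion R) where
  star_smul c x := by
    have h1 (c : ℂ) : Continuous fun x : CStarCompletion R => c • x := continuous_const_smul c
    induction x using induction_on with
    | hp => exact isClosed_eq (h1 c).star ((h1 (star c)).comp continuous_star)
    | h a => rw [← of_smul, ← of_star, ← of_star, ← of_smul, star_smul]

instance : NonUnitalCStarAlgebra (CStarCompletion R) where

end CStarCompletion

section MInf

section Pad

variable {A : Type u} [NonUnitalCStarAlgebra A]

/-- Enlarge (or cut down) a matrix by zeros on the bottom and on the right. -/
def padFun {m : ℕ} (n : ℕ) (a : CStarMatrix (Fin m) (Fin m) A) : CStarMatrix (Fin n) (Fin n) A :=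
  CStarMatrix.ofMatrix fun i j =>
    if hij : i.1 < m ∧ j.1 < m then a ⟨i, hij.1⟩ ⟨j, hij.2⟩ else 0

theorem padFun_apply {m n : ℕ} (a : CStarMatrix (Fin m) (Fin m) A) (i j : Fin n) :
    padFun n a i j = if hij : i.1 < m ∧ j.1 < m then a ⟨i, hij.1⟩ ⟨j, hij.2⟩ else 0 := rfl

/-- The embedding `M_m(A) → M_n(A)`, `a ↦ diag(a, 0)`, for `m ≤ n`. -/
def pad {m n : ℕ} (h : m ≤ n) :
    CStarMatrix (Fin m) (Fin m) A →⋆ₙₐ[ℂ] CStarMatrix (Fin n) (Fin n) A where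
  toFun := padFun n
  map_smul' c a := by
    ext i j
    by_cases hij : i.1 < m ∧ j.1 < m <;> simp [padFun_apply, hij]
  map_zero' := by
    ext i j
    simp [padFun_apply, CStarMatrix.zero_apply]
  map_add' a b := by
    ext i j
    by_cases hij : i.1 < m ∧ j.1 < m <;> simp [padFun_apply, hij]
  map_mul' a b := by
    ext i j
    simp only [CStarMatrix.mul_apply, padFun_apply]
    by_cases hi : i.1 < m
    · by_cases hj : j.1 < m
      · simp only [hi, hj, true_and, and_true, and_self, dite_true]
        refine Finset.sum_of_injOn (Fin.castLE h) (Fin.castLE_injective h).injOn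
          (fun _ _ => Finset.mem_coe.2 (Finset.mem_univ _)) ?_ ?_
        · intro k _ hk
          have hk' : ¬ k.1 < m := fun hlt => hk ⟨⟨k, hlt⟩, by simp, rfl⟩
          simp [hk']
        · intro k _
          simp
      · simp [hj]
    · simp [hi]
  map_star' a := by
    ext i j
    by_cases hi : i.1 < m <;> by_cases hj : j.1 < m <;>
      simp [CStarMatrix.star_apply, padFun_apply, hi, hj]

theorem pad_apply {m n : ℕ} (h : m ≤ n) (a : CStarMatrix (Fin m) (Fin m) A) (i j : Fin n) :
    pad h a i j = if hij : i.1 < m ∧ j.1 < m then a ⟨i, hij.1⟩ ⟨j, hij.2⟩ else 0 := rfl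

theorem pad_injective {m n : ℕ} (h : m ≤ n) :
    Function.Injective (pad h : CStarMatrix (Fin m) (Fin m) A → CStarMatrix (Fin n) (Fin n) A) := by
  intro a b hab
  ext i j
  have := congrArg
    (fun c : CStarMatrix (Fin n) (Fin n) A => c (Fin.castLE h i) (Fin.castLE h j)) hab
  simpa [pad_apply] using this

instance : DirectedSystem (fun n : ℕ => CStarMatrix (Fin n) (Fin n) A)
    (fun _ _ h => (pad h : CStarMatrix _ _ A →⋆ₙₐ[ℂ] CStarMatrix _ _ A)) where
  map_self n a := by
    ext i j
    simp [pad_apply]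
  map_map k j i hij hjk a := by
    ext p q
    simp only [pad_apply]
    by_cases hp : p.1 < i <;> by_cases hq : q.1 < i <;> (simp [hp, hq]; try grind)

theorem norm_pad [PartialOrder A] [StarOrderedRing A] {m n : ℕ} (h : m ≤ n)
    (a : CStarMatrix (Fin m) (Fin m) A) : ‖pad h a‖ = ‖a‖ :=
  NonUnitalStarAlgHom.norm_map (pad h) (pad_injective h) a

end Pad

variable (A : Type u) [NonUnitalCStarAlgebra A]

/-- The algebraic direct limit of the algebras `M_n(A)` along the embeddings `pad`. -/
abbrev MInfAux : Type u :=
  DirectLimit (fun n : ℕ => CStarMatrix (Fin n) (Fin n) A)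
    (fun _ _ h => (pad h : CStarMatrix _ _ A →⋆ₙₐ[ℂ] CStarMatrix _ _ A))

/-- `M_∞(A)`, the union of the algebras `M_n(A)` along the embeddings `a ↦ diag(a, 0)`. -/
def MInf : Type u := MInfAux A

namespace MInf

instance : NonUnitalRing (MInf A) := inferInstanceAs (NonUnitalRing (MInfAux A))

instance : StarRing (MInf A) := inferInstanceAs (StarRing (MInfAux A))

instance : Module ℂ (MInf A) := inferInstanceAs (Module ℂ (MInfAux A))

instance : StarModule ℂ (MInf A) := inferInstanceAs (StarModule ℂ (MInfAux A))

variable {A}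

/-- The inclusion of `M_n(A)` in `M_∞(A)`. -/
def of (n : ℕ) : CStarMatrix (Fin n) (Fin n) A →⋆ₙₐ[ℂ] MInf A where
  toFun a := (⟦⟨n, a⟩⟧ : MInfAux A)
  map_smul' _ _ := rfl
  map_zero' := (DirectLimit.zero_def n).symm
  map_add' a b := (DirectLimit.add_def (G := fun n : ℕ => CStarMatrix (Fin n) (Fin n) A)
    (f := fun _ _ h => (pad h : CStarMatrix _ _ A →⋆ₙₐ[ℂ] CStarMatrix _ _ A)) n a b).symm
  map_mul' a b := (DirectLimit.mul_def (G := fun n : ℕ => CStarMatrix (Fin n) (Fin n) A)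
    (f := fun _ _ h => (pad h : CStarMatrix _ _ A →⋆ₙₐ[ℂ] CStarMatrix _ _ A)) n a b).symm
  map_star' _ := rfl

theorem of_pad {m n : ℕ} (h : m ≤ n) (a : CStarMatrix (Fin m) (Fin m) A) :
    of n (pad h a) = of m a :=
  DirectLimit.mk_apply (F := fun n : ℕ => CStarMatrix (Fin n) (Fin n) A)
    (f := fun _ _ h => (pad h : CStarMatrix _ _ A →⋆ₙₐ[ℂ] CStarMatrix _ _ A)) m n a h

theorem ind {P : MInf A → Prop} (h : ∀ n (a : CStarMatrix (Fin n) (Fin n) A), P (of n a))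
    (x : MInf A) : P x := DirectLimit.induction
  (F := fun n : ℕ => CStarMatrix (Fin n) (Fin n) A) (f := fun _ _ h => pad h) h x

theorem ind₂ {P : MInf A → MInf A → Prop}
    (h : ∀ n (a b : CStarMatrix (Fin n) (Fin n) A), P (of n a) (of n b)) (x y : MInf A) : P x y :=
  DirectLimit.induction₂
  (F := fun n : ℕ => CStarMatrix (Fin n) (Fin n) A) (f := fun _ _ h => pad h) h x y

variable [PartialOrder A] [StarOrderedRing A]

instance : IsScalarTower ℂ (MInf A) (MInf A) where
  smul_assoc c x y := by
    induction x, y using ind₂ with | h n a b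
    simp only [smul_eq_mul, ← map_smul, ← map_mul, smul_mul_assoc]

instance : SMulCommClass ℂ (MInf A) (MInf A) where
  smul_comm c x y := by
    induction x, y using ind₂ with | h n a b
    simp only [smul_eq_mul, ← map_smul, ← map_mul, mul_smul_comm]

/-- The C⋆-norm of `M_∞(A)`, which extends the C⋆-norm of each `M_n(A)`. -/
instance : Norm (MInf A) where
  norm := DirectLimit.lift (fun _ _ h => pad h) (fun _ a => ‖a‖) fun _ _ h a => (norm_pad h a).symm

theorem norm_of (n : ℕ) (a : CStarMatrix (Fin n) (Fin n) A) : ‖of n a‖ = ‖a‖ := rfl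

theorem of_injective (n : ℕ) : Function.Injective (of n : _ → MInf A) :=
  (injective_iff_map_eq_zero (of n)).2 fun a ha => by
    have h : ‖of n a‖ = ‖of n (0 : CStarMatrix (Fin n) (Fin n) A)‖ := by rw [ha, map_zero]
    rwa [norm_of, norm_of, norm_zero, norm_eq_zero] at h

theorem normedSpaceCore : NormedSpace.Core ℂ (MInf A) where
  norm_nonneg x := by
    induction x using ind with | h n a
    exact norm_nonneg a
  norm_smul c x := by
    induction x using ind with | h n a
    rw [← map_smul, norm_of, norm_of, norm_smul]
  norm_triangle x y := by
    induction x, y using ind₂ with | h n a b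
    rw [← map_add, norm_of, norm_of, norm_of]
    exact norm_add_le a b
  norm_eq_zero_iff x := by
    induction x using ind with | h n a
    rw [norm_of, norm_eq_zero, map_eq_zero_iff _ (of_injective n)]

instance : NormedAddCommGroup (MInf A) := NormedAddCommGroup.ofCore normedSpaceCore

instance : NormedSpace ℂ (MInf A) := NormedSpace.ofCore normedSpaceCore

instance : NonUnitalNormedRing (MInf A) where
  __ : NormedAddCommGroup (MInf A) := inferInstance
  __ : NonUnitalRing (MInf A) := inferInstance
  norm_mul_le x y := by
    induction x, y using ind₂ with | h n a b
    rw [← map_mul, norm_of, norm_of, norm_of]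
    exact norm_mul_le a b

instance : CStarRing (MInf A) where
  norm_mul_self_le x := by
    induction x using ind with | h n a
    rw [← map_star, ← map_mul, norm_of, norm_of]
    exact CStarRing.norm_mul_self_le a

variable {B : Type v} [NonUnitalCStarAlgebra B] [PartialOrder B] [StarOrderedRing B]

/-- The entrywise map `M_∞(A) → M_∞(B)`. -/
def map (θ : A →⋆ₙₐ[ℂ] B) : MInf A →⋆ₙₐ[ℂ] MInf B where
  toFun := DirectLimit.lift (fun _ _ h => pad h) (fun n a => of n (CStarMatrix.mapₙₐ θ a))
    fun m n h a => by
      rw [← of_pad h]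
      congr 1
      ext i j
      by_cases hij : i.1 < m ∧ j.1 < m <;> simp [pad_apply, hij]
  map_smul' c x := by
    induction x using ind with | h n a
    rw [← map_smul]
    change of n (CStarMatrix.mapₙₐ θ (c • a)) = c • of n (CStarMatrix.mapₙₐ θ a)
    rw [map_smul, map_smul]
  map_zero' := by
    rw [← map_zero (of 0)]
    change of 0 (CStarMatrix.mapₙₐ θ 0) = 0
    rw [map_zero, map_zero]
  map_add' x y := by
    induction x, y using ind₂ with | h n a b
    rw [← map_add]
    change of n (CStarMatrix.mapₙₐ θ (a + b)) = _
    rw [map_add, map_add]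
    rfl
  map_mul' x y := by
    induction x, y using ind₂ with | h n a b
    rw [← map_mul]
    change of n (CStarMatrix.mapₙₐ θ (a * b)) = _
    rw [map_mul, map_mul]
    rfl
  map_star' x := by
    induction x using ind with | h n a
    rw [← map_star]
    change of n (CStarMatrix.mapₙₐ θ (star a)) = _
    rw [map_star, map_star]
    rfl

theorem map_of (θ : A →⋆ₙₐ[ℂ] B) (n : ℕ) (a : CStarMatrix (Fin n) (Fin n) A) :
    map θ (of n a) = of n (CStarMatrix.mapₙₐ θ a) := rfl

theorem norm_map_le (θ : A →⋆ₙₐ[ℂ] B) (x : MInf A) : ‖map θ x‖ ≤ ‖x‖ := by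
  induction x using ind with | h n a
  rw [map_of, norm_of, norm_of]
  exact NonUnitalStarAlgHom.norm_apply_le _ a

end MInf

end MInf

section Stabilization

variable (A : Type u) [NonUnitalCStarAlgebra A] [PartialOrder A] [StarOrderedRing A]
variable {B : Type v} [NonUnitalCStarAlgebra B] [PartialOrder B] [StarOrderedRing B]

/-- The stabilization `K ⊗ A`, as the completion of `M_∞(A)`. -/
abbrev Stab : Type u := CStarCompletion (MInf A)

variable {A}

/-- The inclusion of `M_n(A)` in `K ⊗ A`. -/
def Stab.of (n : ℕ) : CStarMatrix (Fin n) (Fin n) A →⋆ₙₐ[ℂ] Stab A :=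
  CStarCompletion.ofStarHom.comp (MInf.of n)

theorem norm_of_map_le (θ : A →⋆ₙₐ[ℂ] B) (x : MInf A) :
    ‖(CStarCompletion.ofStarHom.comp (MInf.map θ) : MInf A →⋆ₙₐ[ℂ] Stab B) x‖ ≤ ‖x‖ :=
  le_trans (le_of_eq (CStarCompletion.norm_of (MInf.map θ x))) (MInf.norm_map_le θ x)

/-- The map `id_K ⊗ θ : K ⊗ A → K ⊗ B`. -/
def Stab.map (θ : A →⋆ₙₐ[ℂ] B) : Stab A →⋆ₙₐ[ℂ] Stab B :=
  CStarCompletion.lift (S := Stab B) (CStarCompletion.ofStarHom.comp (MInf.map θ))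
    (norm_of_map_le θ)

end Stabilization

section CrossedProduct

variable {A : Type u} {G : Type v} [CStarAlgebra A] [Group G]

/-- The crossed product `C*(G, A, α)` by a finite group: the function `f : G → A` stands for the element
`∑ g, f(g) u_g`, with multiplication and involution determined by `u_g a = α_g(a) u_g` and the `u_g`
being unitary. For finite `G` these functions form a C⋆-algebra in the norm below. -/
def CrossedProduct (_ : G →* (A ≃⋆ₐ[ℂ] A)) : Type (max u v) := G → A

namespace CrossedProduct

variable {α : G →* (A ≃⋆ₐ[ℂ] A)}

/-- The element `∑ g, f(g) u_g`. -/
def ofFun (f : G → A) : CrossedProduct α := f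

/-- The coefficient at `u_g`. -/
def coeff (x : CrossedProduct α) (g : G) : A := (show G → A from x) g

@[simp]
theorem coeff_ofFun (f : G → A) (g : G) : (ofFun f : CrossedProduct α).coeff g = f g := rfl

@[ext]
theorem ext {x y : CrossedProduct α} (w : ∀ g, x.coeff g = y.coeff g) : x = y := funext w

instance : AddCommGroup (CrossedProduct α) := inferInstanceAs (AddCommGroup (G → A))

instance : Module ℂ (CrossedProduct α) := inferInstanceAs (Module ℂ (G → A))

instance : Star (CrossedProduct α) where
  star x := ofFun fun g => α g (star (x.coeff g⁻¹))

instance [Fintype G] : Mul (CrossedProduct α) where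
  mul x y := ofFun fun g => ∑ k : G, x.coeff k * α k (y.coeff (k⁻¹ * g))

@[simp]
theorem coeff_zero (g : G) : (0 : CrossedProduct α).coeff g = 0 := rfl

@[simp]
theorem coeff_add (x y : CrossedProduct α) (g : G) : (x + y).coeff g = x.coeff g + y.coeff g := rfl

@[simp]
theorem coeff_smul (c : ℂ) (x : CrossedProduct α) (g : G) : (c • x).coeff g = c • x.coeff g := rfl

theorem coeff_star (x : CrossedProduct α) (g : G) :
    (star x).coeff g = α g (star (x.coeff g⁻¹)) := rfl

theorem coeff_mul [Fintype G] (x y : CrossedProduct α) (g : G) :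
    (x * y).coeff g = ∑ k : G, x.coeff k * α k (y.coeff (k⁻¹ * g)) := rfl

theorem act_act (g h : G) (a : A) : α g (α h a) = α (g * h) a := by
  rw [map_mul]; rfl

theorem act_one (a : A) : α 1 a = a := by
  rw [map_one]; rfl

/-- The regular representation of the crossed product on `ℓ²(G, A)`, by matrices over `A` indexed by `G`. -/
def regRep (f : CrossedProduct α) : CStarMatrix G G A :=
  CStarMatrix.ofMatrix fun h k => α h⁻¹ (f.coeff (h * k⁻¹))

theorem regRep_apply (f : CrossedProduct α) (h k : G) :
    regRep f h k = α h⁻¹ (f.coeff (h * k⁻¹)) := rfl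

theorem coeff_eq_regRep (f : CrossedProduct α) (g : G) : f.coeff g = regRep f 1 g⁻¹ := by
  rw [regRep_apply, inv_one, act_one, one_mul, inv_inv]

theorem regRep_injective : Function.Injective (regRep : CrossedProduct α → CStarMatrix G G A) := by
  intro f h hfh
  ext g
  rw [coeff_eq_regRep, hfh, ← coeff_eq_regRep]

theorem regRep_zero : regRep (0 : CrossedProduct α) = 0 := by
  ext h k
  rw [regRep_apply, coeff_zero, map_zero, CStarMatrix.zero_apply]

theorem regRep_add (f f' : CrossedProduct α) : regRep (f + f') = regRep f + regRep f' := by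
  ext h k
  simp only [regRep_apply, coeff_add, map_add, CStarMatrix.add_apply]

theorem regRep_smul (c : ℂ) (f : CrossedProduct α) : regRep (c • f) = c • regRep f := by
  ext h k
  simp only [regRep_apply, coeff_smul, map_smul, CStarMatrix.smul_apply]

theorem regRep_star (f : CrossedProduct α) : regRep (star f) = star (regRep f) := by
  ext h k
  simp only [regRep_apply, coeff_star, CStarMatrix.star_apply, act_act, ← map_star, _root_.mul_inv_rev,
    inv_inv]
  congr 2
  group

variable [Fintype G]

theorem regRep_mul (f f' : CrossedProduct α) : regRep (f * f') = regRep f * regRep f' := by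
  ext h k
  simp only [regRep_apply, coeff_mul, CStarMatrix.mul_apply, map_sum, map_mul, act_act]
  refine Fintype.sum_equiv ((Equiv.inv G).trans (Equiv.mulRight h)) _ _ fun g => ?_
  simp [mul_assoc]

instance : NonUnitalRing (CrossedProduct α) where
  left_distrib a b c := regRep_injective (by simp only [regRep_mul, regRep_add, mul_add])
  right_distrib a b c := regRep_injective (by simp only [regRep_mul, regRep_add, add_mul])
  zero_mul a := regRep_injective (by simp only [regRep_mul, regRep_zero, zero_mul])
  mul_zero a := regRep_injective (by simp only [regRep_mul, regRep_zero, mul_zero])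
  mul_assoc a b c := regRep_injective (by simp only [regRep_mul, mul_assoc])

instance : StarRing (CrossedProduct α) where
  star_involutive a := regRep_injective (by simp only [regRep_star, star_star])
  star_mul a b := regRep_injective (by simp only [regRep_star, regRep_mul, star_mul])
  star_add a b := regRep_injective (by simp only [regRep_star, regRep_add, star_add])

instance : IsScalarTower ℂ (CrossedProduct α) (CrossedProduct α) where
  smul_assoc c a b := regRep_injective (by
    simp only [smul_eq_mul, regRep_smul, regRep_mul, CStarMatrix.smul_mul])

instance : SMulCommClass ℂ (CrossedProduct α) (CrossedProduct α) where
  smul_comm c a b := regRep_injective (by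
    simp only [smul_eq_mul, regRep_smul, regRep_mul, CStarMatrix.mul_smul])

instance : StarModule ℂ (CrossedProduct α) where
  star_smul c a := regRep_injective (by simp only [regRep_star, regRep_smul, star_smul])

/-- The regular representation as a star homomorphism. -/
def regRepHom : CrossedProduct α →⋆ₙₐ[ℂ] CStarMatrix G G A where
  toFun := regRep
  map_smul' := regRep_smul
  map_zero' := regRep_zero
  map_add' := regRep_add
  map_mul' := regRep_mul
  map_star' := regRep_star

variable (α) in
/-- The inclusion `A → C*(G, A, α)`, `a ↦ a u_1`. -/
def incl [DecidableEq G] : A →⋆ₙₐ[ℂ] CrossedProduct α where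
  toFun a := ofFun fun g => if g = 1 then a else 0
  map_smul' c a := by
    ext g
    by_cases hg : g = 1 <;> simp [hg]
  map_zero' := by
    ext g
    simp
  map_add' a b := by
    ext g
    by_cases hg : g = 1 <;> simp [hg]
  map_mul' a b := by
    ext g
    by_cases hg : g = 1 <;> simp [coeff_mul, hg, inv_mul_eq_one, eq_comm]
  map_star' a := by
    ext g
    by_cases hg : g = 1 <;> simp [coeff_star, hg]

variable [PartialOrder A] [StarOrderedRing A]

/-- The C⋆-norm of the crossed product, obtained from the regular representation. -/
instance : Norm (CrossedProduct α) where
  norm f := ‖regRep f‖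

theorem norm_def (f : CrossedProduct α) : ‖f‖ = ‖regRep f‖ := rfl

theorem normedSpaceCore : NormedSpace.Core ℂ (CrossedProduct α) where
  norm_nonneg x := norm_nonneg (regRep x)
  norm_smul c x := by rw [norm_def, norm_def, regRep_smul, norm_smul]
  norm_triangle x y := by
    rw [norm_def, norm_def, norm_def, regRep_add]
    exact norm_add_le _ _
  norm_eq_zero_iff x := by
    rw [norm_def, norm_eq_zero, ← regRep_zero (α := α), regRep_injective.eq_iff]

instance : NormedAddCommGroup (CrossedProduct α) := NormedAddCommGroup.ofCore normedSpaceCore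

instance : NormedSpace ℂ (CrossedProduct α) := NormedSpace.ofCore normedSpaceCore

instance : NonUnitalNormedRing (CrossedProduct α) where
  __ : NormedAddCommGroup (CrossedProduct α) := inferInstance
  __ : NonUnitalRing (CrossedProduct α) := inferInstance
  norm_mul_le x y := by
    rw [norm_def, norm_def, norm_def, regRep_mul]
    exact norm_mul_le _ _

instance : CStarRing (CrossedProduct α) where
  norm_mul_self_le x := by
    rw [norm_def, norm_def, regRep_mul, regRep_star]
    exact CStarRing.norm_mul_self_le _

theorem isometry_regRep : Isometry (regRep : CrossedProduct α → CStarMatrix G G A) :=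
  AddMonoidHomClass.isometry_of_norm (regRepHom (α := α)) fun _ => rfl

theorem isClosed_range_regRep :
    IsClosed (Set.range (regRep : CrossedProduct α → CStarMatrix G G A)) := by
  have h : Set.range (regRep : CrossedProduct α → CStarMatrix G G A) =
      {M | ∀ h k : G, M h k = α h⁻¹ (M 1 (k * h⁻¹))} := by
    ext M
    constructor
    · rintro ⟨f, rfl⟩ h k
      simp only [regRep_apply, act_act]
      simp
    · intro hM
      refine ⟨ofFun fun g => M 1 g⁻¹, ?_⟩
      ext h k
      rw [hM h k, regRep_apply]
      simp
  rw [h]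
  simp only [Set.ofPred_forall]
  have hentry (h k : G) : Continuous fun M : CStarMatrix G G A => M h k :=
    (continuous_apply k).comp (continuous_apply h)
  have hα (g : G) : Continuous (α g) := (StarAlgEquiv.isometry (α g)).continuous
  exact isClosed_iInter fun h => isClosed_iInter fun k =>
    isClosed_eq (hentry h k) ((hα h⁻¹).comp (hentry 1 (k * h⁻¹)))

instance : CompleteSpace (CrossedProduct α) :=
  (completeSpace_iff_isComplete_range isometry_regRep.isUniformInducing).2
    isClosed_range_regRep.isComplete

instance : NonUnitalCStarAlgebra (CrossedProduct α) where

instance : PartialOrder (CrossedProduct α) := CStarAlgebra.spectralOrder _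

instance : StarOrderedRing (CrossedProduct α) := CStarAlgebra.spectralOrderedRing _

end CrossedProduct
end CrossedProduct

section Soft

/-- `b` is a positive element. -/
def IsPosElem {B : Type u} [NonUnitalCStarAlgebra B] (b : B) : Prop := ∃ y : B, b = star y * y

theorem IsPosElem.isPositive {B : Type u} [NonUnitalCStarAlgebra B] {b : B} (h : IsPosElem b) :
    IsPositive !![b] := by
  obtain ⟨y, rfl⟩ := h
  refine ⟨!![y], ?_⟩
  ext i j
  fin_cases i
  fin_cases j
  simp [Matrix.mul_apply]

/-- A positive element `b` of a C⋆-algebra, as a positive `1 × 1` matrix. -/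
def PosMat.single {B : Type u} [NonUnitalCStarAlgebra B] (b : B) (h : IsPosElem b) : PosMat B :=
  ⟨1, !![b], h.isPositive⟩

/-- The set `B₊₊` of positive elements `b` of `B` for which there is no projection
`q ∈ M_∞(B)` with `⟨b⟩ = ⟨q⟩`. -/
def softPart (B : Type u) [NonUnitalCStarAlgebra B] : Set B :=
  {b | ∃ h : IsPosElem b, ¬ ∃ q : PosMat B, q.mat * q.mat = q.mat ∧ q.matᴴ = q.mat ∧
    W.mk (PosMat.single b h) = W.mk q}

variable (A : Type u) [NonUnitalCStarAlgebra A] [PartialOrder A] [StarOrderedRing A]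
variable {B : Type v} [NonUnitalCStarAlgebra B] [PartialOrder B] [StarOrderedRing B]

/-- The Cuntz semigroup `Cu(A) = W(K ⊗ A)`. -/
abbrev Cu : Type u := W (Stab A)

/-- `Cu₊(A)`, the set of classes of elements of `(K ⊗ A)₊₊`. -/
def softCu : Set (Cu A) :=
  {x | ∃ (b : Stab A) (h : IsPosElem b), b ∈ softPart (Stab A) ∧ x = W.mk (PosMat.single b h)}

variable {A}

/-- The map `Cu(θ) : Cu(A) → Cu(B)`. -/
def Cu.map (θ : A →⋆ₙₐ[ℂ] B) : Cu A →+ Cu B := W.map (Stab.map θ)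

theorem PosMat.isPosElem_of (a : PosMat A) :
    IsPosElem (Stab.of a.size (CStarMatrix.ofMatrix a.mat)) := by
  obtain ⟨y, hy⟩ := a.pos
  refine ⟨Stab.of a.size (CStarMatrix.ofMatrix y), ?_⟩
  rw [← map_star, ← map_mul, hy]
  rfl

/-- The class in `Cu(A)` of `a ∈ M_∞(A)₊ ⊆ (K ⊗ A)₊`. -/
def PosMat.cuClass (a : PosMat A) : Cu A :=
  W.mk (PosMat.single (Stab.of a.size (CStarMatrix.ofMatrix a.mat)) a.isPosElem_of)

variable (A) in
/-- `W₊(A) = Cu₊(A) ∩ W(A)`: the classes of those `a ∈ M_∞(A)₊` whose class in `Cu(A)` lies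
in `Cu₊(A)`. -/
def softW : Set (W A) := {x | ∃ a : PosMat A, x = W.mk a ∧ a.cuClass ∈ softCu A}

end Soft

section Hypotheses

/-- A unital C⋆-algebra is stably finite if every isometry in every matrix algebra over it is a
unitary. -/
def IsStablyFinite (A : Type u) [CStarAlgebra A] : Prop :=
  ∀ (n : ℕ) (v : Matrix (Fin n) (Fin n) A), vᴴ * v = 1 → v * vᴴ = 1

/-- A C⋆-algebra is simple if it is nonzero and has no closed two-sided ideals besides `0` and
itself. -/
structure IsSimple (A : Type u) [CStarAlgebra A] : Prop where
  nontrivial : Nontrivial A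
  eq_bot_or_eq_top : ∀ I : TwoSidedIdeal A, IsClosed (I : Set A) → I = ⊥ ∨ I = ⊤

/-- A C⋆-algebra is of type I if each of its nonzero quotients contains a nonzero positive element
`x` that is abelian, i.e. generates a commutative hereditary subalgebra `closure (x B x)`. -/
def IsTypeI (A : Type u) [NonUnitalCStarAlgebra A] : Prop :=
  ∀ (B : Type u) [NonUnitalCStarAlgebra B] (π : A →⋆ₙₐ[ℂ] B), Function.Surjective π →
    Nontrivial B → ∃ x : B, x ≠ 0 ∧ IsPosElem x ∧ ∀ y z : B, Commute (x * y * x) (x * z * x)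

variable {A : Type u} [CStarAlgebra A]

/-- `(a - ε)₊` for a self-adjoint element `a`. -/
def cutDown (a : A) (ε : ℝ) : A := cfc (fun t : ℝ => max 0 (t - ε)) a

variable [PartialOrder A] [StarOrderedRing A] {G : Type v} [Group G]

/-- Weakly tracially strictly approximately inner actions. -/
def IsWeaklyTraciallyStrictlyApproxInner (α : G →* (A ≃⋆ₐ[ℂ] A)) : Prop :=
  ∀ (F : Finset A) (ε : ℝ), 0 < ε → ∀ x : A, 0 ≤ x → ‖x‖ = 1 →
    ∃ (c : A) (s : G → A),
      (0 ≤ c ∧ (∀ g, α g c = c) ∧ ‖c‖ ≤ 1) ∧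
      (∀ g, s g ∈ closure (Set.range fun a : A => c * a * c) ∧ ‖s g‖ ≤ 1) ∧
      (‖s 1 - c‖ < ε ∧ ∀ g, ‖star (s g) - s g⁻¹‖ < ε) ∧
      (∀ g h, ‖s g * s h - c * s (g * h)‖ < ε) ∧
      (∀ a ∈ (F : Set A) ∪ Set.range s, ‖c * a - a * c‖ < ε) ∧
      (∀ a ∈ F, ∀ g, ‖α g (c * a * c) - s g * a * star (s g)‖ < ε) ∧
      Subeq !![cutDown (1 - c) ε] !![x] ∧
      1 - ε < ‖c * x * c‖

end Hypotheses

/-- The set `S` is a subsemigroup (containing `0`) of `M`, and the additive map `φ : M → N`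
restricts to an isomorphism of ordered semigroups from `S` onto its image `φ(S)`, where `S` and
`φ(S)` carry the addition and the order of `M` and of `N`. -/
def InducesOrderedSemigroupIso {M : Type u} {N : Type v} [AddCommMonoid M] [PartialOrder M]
    [AddCommMonoid N] [PartialOrder N] (φ : M →+ N) (S : Set M) : Prop :=
  ∃ T : AddSubmonoid M, (T : Set M) = S ∧
    ∃ e : T ≃+o T.map φ, ∀ x : T, (e x : N) = φ x

end CuntzSemigroup

end

/-!
The substance of the theorem is that `Cu(ι)` reflects the order on soft classes: if `a`, `b` are
positive in `K ⊗ A`, `b` is soft and `ι(a) ≼ ι(b)`, then `a ≼ b`. The statement about `W(A)`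
follows, since `W(A) → Cu(A)` is an order embedding.

*Reflection* (`IsWeaklyTraciallyStrictlyApproxInner.subeqElem_of_map_incl`). Cutting down to
corners, suppose that `a = V V⋆` and `b` are matrices over `A` and that `y = ∑ g, Y g u_g` over
the crossed product satisfies `y b y⋆ ≈ V V⋆`. Comparing coefficients at `u_k`, the element `∑ h,
Y (k h) α_{k h}(b) α_k((Y h)⋆)` is close to `V V⋆` for `k = 1` and to `0` otherwise. Let `c` and
`s_g` be as in the definition of the action, for large finite sets and small tolerances, so that
up to small errors `c² ∑ g, Y g s_g` multiplies like `y`, up to powers of the almost central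
element `c`. Passing to bounded sequences modulo null sequences makes the relations exact, and the
identity `sum_conj_eq` shows that for `Z = c² ∑ g, Y g s_g` the matrix `Z b Z⋆` is `V c⁶ V⋆` up to
`∑ k, N_k c⁵ s_k`, where `N_k` is the error of the coefficient at `u_k`. The missing part `V (1 -
c⁶) V⋆` is a compression of `diag(d, …, d)` with `d = (1 - c - ε)₊`, up to a small error, and `d`
lies below any prescribed nonzero positive `t` in `A`. This is
`IsWeaklyTraciallyStrictlyApproxInner.exists_conj_add_conj`. Here softness enters: functional
calculus on `b`, whose spectrum accumulates at `0` (otherwise `b` would have the class of a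
projection), provides an element close to `b` that leaves room for a nonzero positive `x` below
`b` (`exists_mk_add_mk_le_of_mem_softPart`), and since `A` is simple and not of type I, `x`
dominates arbitrarily many orthogonal copies of some nonzero `t` in `A`
(`IsSimple.exists_subeqElem_ofMat_diagonal`). So the defect fits below `x`, and `a ≼ b`.

*Subsemigroups* (`add_mem_softCu`). The sum of a soft class and any other class is soft: if it
were the class of a projection `q`, then `q` would be an exact compression of `diag(d, b)` for an
approximant `d` of `a` as above, since projections are stable under perturbation. Hence `q`
absorbs the class of a nonzero `x`, and by simplicity a multiple `n` of the class of the unit of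
`A` dominates `n + 1` copies of it, against stable finiteness
(`not_mk_add_mk_single_le_of_isProjection`).
-/

namespace CuntzSemigroup

open Filter Topology Matrix

universe u v w

/-! ### Cuntz subequivalence of elements -/

section Subeq

variable {A : Type u} [NonUnitalCStarAlgebra A] {l m n p : Type*}

theorem Subeq.of_eq [Fintype n] {a : Matrix m m A} {b : Matrix n n A} (y : Matrix m n A)
    (h : y * b * yᴴ = a) : Subeq a b :=
  ⟨fun _ => y, by simp only [h, tendsto_const_nhds]⟩

theorem isClosed_setOf_subeq [Finite m] [Fintype n] (b : Matrix n n A) :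
    IsClosed {a : Matrix m m A | Subeq a b} := by
  simp only [subeq_iff_mem_closure]
  exact isClosed_closure

/-- Cuntz subequivalence of two elements, viewed as `1 × 1` matrices. -/
abbrev SubeqElem (a b : A) : Prop := Subeq !![a] !![b]

theorem subeqElem_iff_exists_seq {a b : A} :
    SubeqElem a b ↔ ∃ y : ℕ → A, Tendsto (fun k => y k * b * star (y k)) atTop (𝓝 a) := by
  constructor
  · rintro ⟨y, hy⟩
    refine ⟨fun k => y k 0 0, ?_⟩
    have := tendsto_pi_nhds.1 (tendsto_pi_nhds.1 hy 0) 0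
    simpa [Matrix.mul_apply] using this
  · rintro ⟨y, hy⟩
    refine ⟨fun k => !![y k], tendsto_pi_nhds.2 fun i => tendsto_pi_nhds.2 fun j => ?_⟩
    fin_cases i
    fin_cases j
    simpa [Matrix.mul_apply] using hy

theorem SubeqElem.of_eq {a b : A} (y : A) (h : y * b * star y = a) : SubeqElem a b :=
  subeqElem_iff_exists_seq.2 ⟨fun _ => y, by simp only [h, tendsto_const_nhds]⟩

theorem isClosed_setOf_subeqElem (b : A) : IsClosed {a : A | SubeqElem a b} :=
  (isClosed_setOf_subeq !![b]).preimage (f := fun a : A => !![a])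
    (continuous_pi fun i => continuous_pi fun j => by
      fin_cases i
      fin_cases j
      exact continuous_id)

/-- Compressions of `c` by two elements `p`, `q` that are orthogonal with respect to `c` fit below
`c` side by side. -/
theorem subeq_fromBlocks_of_mul_eq_zero {c p q : A} (h : p * c * star q = 0)
    (h' : q * c * star p = 0) :
    Subeq (fromBlocks !![p * c * star p] 0 0 !![q * c * star q]) !![c] := by
  refine Subeq.of_eq (fromRows !![p] !![q]) ?_
  ext i j
  rcases i with i | i <;> rcases j with j | j <;> fin_cases i <;> fin_cases j <;>
    simp [Matrix.mul_apply, h, h']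

theorem subeq_add_fromBlocks (a b p q : A) :
    Subeq !![p * a * star p + q * b * star q] (fromBlocks !![a] 0 0 !![b]) := by
  refine Subeq.of_eq (fromCols !![p] !![q]) ?_
  ext i j
  fin_cases i
  fin_cases j
  simp [Matrix.mul_apply]

theorem Subeq.real_smul [Fintype n] {a : Matrix m m A} {b : Matrix n n A} (h : Subeq a b)
    {r : ℝ} (hr : 0 ≤ r) : Subeq ((r : ℂ) • a) b := by
  obtain ⟨y, hy⟩ := h
  refine ⟨fun k => ((√r : ℝ) : ℂ) • y k, ?_⟩
  refine (hy.const_smul (r : ℂ)).congr fun k => ?_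
  rw [conjTranspose_smul, Matrix.smul_mul, Matrix.smul_mul, Matrix.mul_smul, smul_smul]
  congr 1
  simp [← Complex.ofReal_mul, Real.mul_self_sqrt hr]

end Subeq

/-! ### Order and addition in `W(A)` -/

section W

variable {A : Type u} [NonUnitalCStarAlgebra A]

instance : IsOrderedAddMonoid (W A) where
  add_le_add_left x y h z := by
    induction x using W.ind with | h a
    induction y using W.ind with | h b
    induction z using W.ind with | h c
    exact PosMat.add_le_add h le_rfl

theorem W.zero_le (x : W A) : 0 ≤ x := by
  induction x using W.ind with | h a
  refine Subeq.of_eq (0 : Matrix (Fin 0) (Fin a.size) A) ?_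
  ext i
  exact i.elim0

theorem W.mk_single_zero (h : IsPosElem (0 : A)) : W.mk (PosMat.single 0 h) = 0 := by
  refine le_antisymm ?_ (W.zero_le _)
  refine Subeq.of_eq (0 : Matrix (Fin 1) (Fin 0) A) ?_
  change (0 : Matrix (Fin 1) (Fin 0) A) * (0 : Matrix (Fin 0) (Fin 0) A) *
    (0 : Matrix (Fin 1) (Fin 0) A)ᴴ = (!![0] : Matrix (Fin 1) (Fin 1) A)
  rw [Matrix.zero_mul, Matrix.zero_mul]
  ext i j
  fin_cases i
  fin_cases j
  rfl

theorem W.mk_le_add_iff {a b c : PosMat A} :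
    W.mk c ≤ W.mk a + W.mk b ↔ Subeq c.mat (fromBlocks a.mat 0 0 b.mat) :=
  ⟨fun h => Subeq.trans h (Subeq.submatrix _ _), fun h => h.trans (Subeq.of_submatrix_equiv _ _)⟩

theorem W.add_le_mk_iff {a b c : PosMat A} :
    W.mk a + W.mk b ≤ W.mk c ↔ Subeq (fromBlocks a.mat 0 0 b.mat) c.mat :=
  ⟨fun h => (Subeq.of_submatrix_equiv _ finSumFinEquiv.symm).trans h,
    fun h => (Subeq.submatrix _ _).trans h⟩

end W

/-! ### Projections as limits of compressions -/

section Projection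

/-- A projection `q` within `1/2` of a self-adjoint element `S` is an exact compression of `S`: in
the corner of `q`, the compression `q S q = q - R` is invertible, and its inverse square root is
`1 + g(R)` with `g(t) = (1 - t)^(-1/2) - 1`, a function that needs no unit. -/
theorem exists_conj_eq_of_norm_sub_lt {D : Type u} [NonUnitalCStarAlgebra D] {q S : D}
    (hq : IsStarProjection q) (hS : IsSelfAdjoint S) (h : ‖S - q‖ < 1 / 2) :
    ∃ z, z * S * star z = q := by
  have hqq : q * q = q := hq.isIdempotentElem
  have hqs : star q = q := hq.isSelfAdjoint
  have hq1 : ‖q‖ ≤ 1 := hq.norm_le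
  obtain ⟨R, hR⟩ : ∃ R, R = q - q * S * q := ⟨_, rfl⟩
  have hRn : ‖R‖ ≤ 1 / 2 := by
    have : R = q * (q - S) * q := by
      rw [hR, mul_sub, sub_mul, hqq, hqq]
    rw [this]
    calc ‖q * (q - S) * q‖ ≤ ‖q‖ * ‖q - S‖ * ‖q‖ := norm_mul₃_le
      _ ≤ 1 * (1 / 2) * 1 := by
        rw [norm_sub_rev] at h
        gcongr
      _ = 1 / 2 := by norm_num
  have hRs : IsSelfAdjoint R := by
    rw [isSelfAdjoint_iff, hR]
    simp [hqs, hS.star_eq, mul_assoc]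
  have hqR : q * R = R := by
    rw [hR, mul_sub, ← mul_assoc, ← mul_assoc, hqq]
  have hRq : R * q = R := by
    rw [hR, sub_mul, mul_assoc, hqq]
  -- `g(t) = (1 - t)^(-1/2) - 1`, so that `(1 + g)(1 - t)(1 + g) = 1`
  let g : ℝ → ℝ := fun t => (√(1 - t))⁻¹ - 1
  have hspec : ∀ t ∈ quasispectrum ℝ R, 0 < 1 - t := fun t ht => by
    have :=
      (NonUnitalIsometricContinuousFunctionalCalculus.norm_quasispectrum_le R ht hRs).trans hRn
    rw [Real.norm_eq_abs, abs_le] at this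
    linarith
  have hg : ContinuousOn g (quasispectrum ℝ R) := by
    refine ContinuousOn.sub (ContinuousOn.inv₀ (by fun_prop) fun t ht => ?_) continuousOn_const
    exact (Real.sqrt_pos.2 (hspec t ht)).ne'
  have hg0 : g 0 = 0 := by simp [g]
  obtain ⟨Γ, hΓ⟩ : ∃ Γ, Γ = cfcₙ g R := ⟨_, rfl⟩
  have hΓs : star Γ = Γ := by rw [hΓ]; exact cfcₙ_predicate g R
  have hqΓ : Γ * q = q * Γ := by
    rw [hΓ]
    exact (Commute.cfcₙ_real (show Commute R q by rw [Commute, SemiconjBy, hqR, hRq]) g)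
  have hRΓ : Γ * R = R * Γ := by
    rw [hΓ]
    exact (Commute.cfcₙ_real (Commute.refl R) g)
  have key : Γ + Γ + Γ * Γ = R + R * Γ + R * Γ + R * (Γ * Γ) := by
    have hid : cfcₙ (fun t : ℝ => t) R = R := cfcₙ_id' ℝ R
    have h1 : Γ * Γ = cfcₙ (fun t => g t * g t) R := by
      rw [hΓ, ← cfcₙ_mul g g R hg hg0 hg hg0]
    have h2 : R * Γ = cfcₙ (fun t => t * g t) R := by
      rw [cfcₙ_mul (fun t => t) g R (by fun_prop) rfl hg hg0, hid, hΓ]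
    have h3 : R * (Γ * Γ) = cfcₙ (fun t => t * (g t * g t)) R := by
      rw [cfcₙ_mul (fun t => t) (fun t => g t * g t) R (by fun_prop) rfl (hg.mul hg)
        (by simp [hg0]), hid, h1]
    have e1 : Γ + Γ + Γ * Γ = cfcₙ (fun t => g t + g t + g t * g t) R := by
      rw [cfcₙ_add (fun t => g t + g t) (fun t => g t * g t) R (hg.add hg) (by simp [hg0])
        (hg.mul hg) (by simp [hg0]), cfcₙ_add g g R hg hg0 hg hg0, h1, hΓ]
    have e2 : R + R * Γ + R * Γ + R * (Γ * Γ)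
        = cfcₙ (fun t => t + t * g t + t * g t + t * (g t * g t)) R := by
      have hm : ContinuousOn (fun t => t * g t) (quasispectrum ℝ R) := continuousOn_id.mul hg
      rw [cfcₙ_add (fun t => t + t * g t + t * g t) (fun t => t * (g t * g t)) R
          ((continuousOn_id.add hm).add hm) (by simp) (continuousOn_id.mul (hg.mul hg)) (by simp),
        cfcₙ_add (fun t => t + t * g t) (fun t => t * g t) R (continuousOn_id.add hm) (by simp)
          hm (by simp),
        cfcₙ_add (fun t => t) (fun t => t * g t) R continuousOn_id rfl hm (by simp), hid, ← h2,
        ← h3]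
    rw [e1, e2]
    refine cfcₙ_congr fun t ht => ?_
    have h1 := hspec t ht
    have h2 : √(1 - t) ≠ 0 := (Real.sqrt_pos.2 h1).ne'
    have h3 : √(1 - t) ^ 2 = 1 - t := Real.sq_sqrt h1.le
    have h4 : t = 1 - √(1 - t) ^ 2 := by linarith
    simp only [g]
    generalize √(1 - t) = w at *
    subst h4
    field_simp
    ring
  refine ⟨q + Γ * q, ?_⟩
  have hX : q * S * q = q - R := by rw [hR]; abel
  have : (q + Γ * q) * S * star (q + Γ * q) = q * S * q + Γ * (q * S * q) + q * S * q * Γ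
      + Γ * (q * S * q) * Γ := by
    rw [star_add, star_mul, hqs, hΓs]
    noncomm_ring
  rw [this, hX]
  have e3 : q - R + Γ * (q - R) + (q - R) * Γ + Γ * (q - R) * Γ =
      q - R + q * (Γ + Γ + Γ * Γ) - (R * Γ + R * Γ + R * (Γ * Γ)) := by
    simp only [mul_sub, sub_mul, hqΓ, hRΓ, mul_add]
    simp only [← mul_assoc]
    abel
  rw [e3, key]
  have e4 : q * (R + R * Γ + R * Γ + R * (Γ * Γ)) = R + R * Γ + R * Γ + R * (Γ * Γ) := by
    simp only [mul_add, ← mul_assoc, hqR]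
  rw [e4]
  abel

/-- A projection that is a limit of compressions of self-adjoint matrices is an exact compression
of one of them. -/
theorem exists_conj_eq_of_tendsto {D : Type u} [NonUnitalCStarAlgebra D] {m n : Type*} [Fintype m]
    [Fintype n] {q : Matrix m m D} {b : ℕ → Matrix n n D} {y : ℕ → Matrix m n D}
    (hy : Tendsto (fun k => y k * b k * (y k)ᴴ) atTop (𝓝 q)) (hqq : q * q = q)
    (hqs : qᴴ = q) (hb : ∀ k, (b k)ᴴ = b k) : ∃ (k : ℕ) (z : Matrix m n D), z * b k * zᴴ = q := by
  let : PartialOrder D := CStarAlgebra.spectralOrder D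
  have : StarOrderedRing D := CStarAlgebra.spectralOrderedRing D
  have hnorm : Tendsto (fun k => ‖CStarMatrix.ofMatrix (y k * b k * (y k)ᴴ - q)‖) atTop (𝓝 0) := by
    have h1 : Tendsto (fun k => CStarMatrix.ofMatrix (y k * b k * (y k)ᴴ - q)) atTop
        (𝓝 (0 : CStarMatrix m m D)) := by
      have := hy.sub_const q
      rw [sub_self] at this
      exact this
    exact tendsto_zero_iff_norm_tendsto_zero.1 h1
  obtain ⟨k, hk⟩ := (hnorm.eventually_lt_const (show (0 : ℝ) < 1 / 2 by norm_num)).exists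
  obtain ⟨z, hz⟩ := exists_conj_eq_of_norm_sub_lt (D := CStarMatrix m m D)
    (q := CStarMatrix.ofMatrix q) (S := CStarMatrix.ofMatrix (y k * b k * (y k)ᴴ)) ⟨hqq, hqs⟩
    (by
      change (y k * b k * (y k)ᴴ)ᴴ = _
      rw [conjTranspose_mul, conjTranspose_mul, conjTranspose_conjTranspose, hb,
        ← Matrix.mul_assoc]
      rfl) hk
  refine ⟨k, CStarMatrix.ofMatrix.symm z * y k, ?_⟩
  have hz' : CStarMatrix.ofMatrix.symm z * (y k * b k * (y k)ᴴ) * (CStarMatrix.ofMatrix.symm z)ᴴ =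
    q := hz
  rw [conjTranspose_mul]
  simpa only [Matrix.mul_assoc] using hz'

/-- A projection over an algebra with a self-adjoint approximate unit `e` is a compression of a
diagonal matrix with entries `e k`. -/
theorem exists_conj_diagonal_eq_of_tendsto {D : Type u} [NonUnitalCStarAlgebra D] {m : Type*}
    [Fintype m] [DecidableEq m] {q : Matrix m m D} {e : ℕ → D}
    (he : ∀ x, Tendsto (fun k => x * e k) atTop (𝓝 x)) (hqq : q * q = q) (hqs : qᴴ = q)
    (hes : ∀ k, star (e k) = e k) :
    ∃ (k : ℕ) (z : Matrix m m D), z * (diagonal fun _ => e k) * zᴴ = q := by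
  refine exists_conj_eq_of_tendsto (y := fun _ => q) ?_ hqq hqs fun k => ?_
  · have h1 : Tendsto (fun n => q * diagonal fun _ => e n) atTop (𝓝 q) := by
      refine tendsto_pi_nhds.2 fun i => tendsto_pi_nhds.2 fun j => ?_
      simp only [mul_diagonal]
      exact he (q i j)
    have hcont : Continuous fun x : Matrix m m D => x * qᴴ := by fun_prop
    have := (hcont.tendsto q).comp h1
    have h2 : q * qᴴ = q := by rw [hqs, hqq]
    simp only [Function.comp_def, h2] at this
    exact this
  · rw [diagonal_conjTranspose]
    congr 1
    funext i
    exact hes k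

end Projection

/-! ### Matrices in the stabilization -/

section Stab

variable {A : Type u} [NonUnitalCStarAlgebra A] [PartialOrder A] [StarOrderedRing A]

namespace Stab

/-- The inclusion of `M_n(A)` in `K ⊗ A`, on plain matrices. -/
noncomputable def ofMat (n : ℕ) (a : Matrix (Fin n) (Fin n) A) : Stab A :=
  Stab.of n (CStarMatrix.ofMatrix a)

variable {n m l : ℕ}

theorem ofMat_mul (a b : Matrix (Fin n) (Fin n) A) : ofMat n (a * b) = ofMat n a * ofMat n b :=
  map_mul (Stab.of n) (CStarMatrix.ofMatrix a) (CStarMatrix.ofMatrix b)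

theorem ofMat_add (a b : Matrix (Fin n) (Fin n) A) : ofMat n (a + b) = ofMat n a + ofMat n b :=
  map_add (Stab.of n) (CStarMatrix.ofMatrix a) (CStarMatrix.ofMatrix b)

theorem ofMat_sub (a b : Matrix (Fin n) (Fin n) A) : ofMat n (a - b) = ofMat n a - ofMat n b :=
  map_sub (Stab.of n) (CStarMatrix.ofMatrix a) (CStarMatrix.ofMatrix b)

theorem ofMat_zero : ofMat n (0 : Matrix (Fin n) (Fin n) A) = 0 :=
  map_zero (Stab.of n)

theorem ofMat_conjTranspose (a : Matrix (Fin n) (Fin n) A) : ofMat n aᴴ = star (ofMat n a) :=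
  map_star (Stab.of n) (CStarMatrix.ofMatrix a)

theorem ofMat_sum {ι : Type*} (s : Finset ι) (f : ι → Matrix (Fin n) (Fin n) A) :
    ofMat n (∑ i ∈ s, f i) = ∑ i ∈ s, ofMat n (f i) := by
  classical
  induction s using Finset.induction_on with
  | empty => simp only [Finset.sum_empty, ofMat_zero]
  | insert i s hi ih => rw [Finset.sum_insert hi, Finset.sum_insert hi, ofMat_add, ih]

theorem norm_ofMat (a : Matrix (Fin n) (Fin n) A) : ‖ofMat n a‖ = ‖CStarMatrix.ofMatrix a‖ :=
  CStarCompletion.norm_of (MInf.of n (CStarMatrix.ofMatrix a))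

theorem norm_entry_le_norm_ofMat (a : Matrix (Fin n) (Fin n) A) (i j : Fin n) :
    ‖a i j‖ ≤ ‖ofMat n a‖ := by
  rw [norm_ofMat]
  exact CStarMatrix.norm_entry_le_norm (M := CStarMatrix.ofMatrix a)

theorem isometry_of : Isometry (Stab.of n : CStarMatrix (Fin n) (Fin n) A → Stab A) :=
  AddMonoidHomClass.isometry_of_norm (Stab.of n) fun a => norm_ofMat a

theorem ofMat_injective : Function.Injective (ofMat n : _ → Stab A) := isometry_of.injective

theorem continuous_ofMat : Continuous (ofMat n : _ → Stab A) := isometry_of.continuous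

theorem isClosed_range_ofMat : IsClosed (Set.range (ofMat n : _ → Stab A)) :=
  isometry_of.isClosedEmbedding.isClosed_range

/-- The square matrix of size `n` with the matrix `a` in its upper left corner and zeros
elsewhere. -/
def padMat (n : ℕ) (a : Matrix (Fin m) (Fin l) A) : Matrix (Fin n) (Fin n) A :=
  fun i j => if hij : i.1 < m ∧ j.1 < l then a ⟨i, hij.1⟩ ⟨j, hij.2⟩ else 0

omit [PartialOrder A] [StarOrderedRing A] in
theorem padMat_conjTranspose (a : Matrix (Fin m) (Fin l) A) :
    (padMat n a)ᴴ = padMat n aᴴ := by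
  ext i j
  by_cases hi : i.1 < l <;> by_cases hj : j.1 < m <;> simp [padMat, hi, hj]

theorem sum_eq_sum_castLE {M : Type*} [AddCommMonoid M] (h : m ≤ n) (f : Fin n → M)
    (hf : ∀ p : Fin n, ¬ p.1 < m → f p = 0) :
    ∑ p : Fin n, f p = ∑ p : Fin m, f (Fin.castLE h p) := by
  symm
  refine Finset.sum_of_injOn (Fin.castLE h) (Fin.castLE_injective h).injOn
    (fun _ _ => Finset.mem_coe.2 (Finset.mem_univ _)) (fun p _ hp => hf p fun hlt => ?_)
    fun _ _ => rfl
  exact hp ⟨⟨p, hlt⟩, by simp, rfl⟩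

omit [PartialOrder A] [StarOrderedRing A] in
theorem padMat_mul (h : m ≤ n) {k : ℕ} (a : Matrix (Fin l) (Fin m) A)
    (b : Matrix (Fin m) (Fin k) A) : padMat n a * padMat n b = padMat n (a * b) := by
  ext i j
  rw [Matrix.mul_apply, sum_eq_sum_castLE h _ fun p hp => by simp [padMat, hp]]
  by_cases hi : i.1 < l <;> by_cases hj : j.1 < k <;> simp [padMat, hi, hj, Matrix.mul_apply]

theorem ofMat_padMat (h : m ≤ n) (a : Matrix (Fin m) (Fin m) A) :
    ofMat n (padMat n a) = ofMat m a :=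
  congrArg CStarCompletion.ofStarHom (MInf.of_pad h (CStarMatrix.ofMatrix a))

theorem exists_norm_sub_ofMat_lt (x : Stab A) (K : ℕ) {ε : ℝ} (hε : 0 < ε) :
    ∃ n ≥ K, ∃ a : Matrix (Fin n) (Fin n) A, ‖x - ofMat n a‖ < ε := by
  obtain ⟨y, hy⟩ := CStarCompletion.denseRange_of.exists_dist_lt x hε
  induction y using MInf.ind with | h n a
  refine ⟨max n K, le_max_right _ _, padMat _ (CStarMatrix.ofMatrix.symm a), ?_⟩
  rw [ofMat_padMat (le_max_left _ _), ← dist_eq_norm]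
  exact hy

/-- The element `e_ij ⊗ x` of `K ⊗ A`. -/
noncomputable def single (i j : ℕ) (x : A) : Stab A :=
  ofMat (max i j + 1) (Matrix.single ⟨i, by grind⟩ ⟨j, by grind⟩ x)

theorem ofMat_single (i j : Fin n) (x : A) :
    ofMat n (Matrix.single i j x) = single i j x := by
  have h : max i.1 j.1 + 1 ≤ n := by grind
  rw [single, ← ofMat_padMat h]
  congr 1
  ext k l
  simp only [padMat, Matrix.single_apply, Fin.ext_iff]
  by_cases hk : i.1 = k.1 <;> by_cases hl : j.1 = l.1 <;> grind

theorem ofMat_eq_sum (a : Matrix (Fin n) (Fin n) A) :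
    ofMat n a = ∑ i : Fin n, ∑ j : Fin n, single i j (a i j) := by
  conv_lhs => rw [Matrix.matrix_eq_sum_single a]
  simp only [ofMat_sum, ofMat_single]

theorem single_mul_single_same (i j k : ℕ) (x y : A) :
    (single i j x * single j k y : Stab A) = single i k (x * y) := by
  let l := i + j + k + 1
  have hi : i < l := by grind
  have hj : j < l := by grind
  have hk : k < l := by grind
  rw [← ofMat_single ⟨i, hi⟩ ⟨j, hj⟩, ← ofMat_single ⟨j, hj⟩ ⟨k, hk⟩,
    ← ofMat_single ⟨i, hi⟩ ⟨k, hk⟩, ← ofMat_mul, Matrix.single_mul_single_same]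

theorem single_mul_single_of_ne (i k : ℕ) {j j' : ℕ} (h : j ≠ j') (x y : A) :
    (single i j x * single j' k y : Stab A) = 0 := by
  let l := i + j + j' + k + 1
  have hi : i < l := by grind
  have hj : j < l := by grind
  have hj' : j' < l := by grind
  have hk : k < l := by grind
  rw [← ofMat_single ⟨i, hi⟩ ⟨j, hj⟩, ← ofMat_single ⟨j', hj'⟩ ⟨k, hk⟩, ← ofMat_mul,
    Matrix.single_mul_single_of_ne _ _ _ _ (by simpa using h), ofMat_zero]

theorem single_mul_single (i j j' k : ℕ) (x y : A) :
    (single i j x * single j' k y : Stab A) = if j = j' then single i k (x * y) else 0 := by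
  split_ifs with h
  · rw [h, single_mul_single_same]
  · exact single_mul_single_of_ne _ _ h _ _

theorem star_single (i j : ℕ) (x : A) : star (single i j x : Stab A) = single j i (star x) := by
  let l := i + j + 1
  have hi : i < l := by grind
  have hj : j < l := by grind
  rw [← ofMat_single ⟨i, hi⟩ ⟨j, hj⟩, ← ofMat_single ⟨j, hj⟩ ⟨i, hi⟩, ← ofMat_conjTranspose,
    Matrix.conjTranspose_single]

theorem ofMat_mul_mul_conjTranspose {k : ℕ} (hm : m ≤ k) (hn : n ≤ k)
    (y : Matrix (Fin m) (Fin n) A) (b : Matrix (Fin n) (Fin n) A) :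
    ofMat k (padMat k y) * ofMat n b * star (ofMat k (padMat k y)) = ofMat m (y * b * yᴴ) := by
  rw [← ofMat_padMat hn, ← ofMat_padMat hm, ← ofMat_conjTranspose, ← ofMat_mul, ← ofMat_mul,
    padMat_conjTranspose, padMat_mul hn, padMat_mul hn]

theorem subeqElem_ofMat_of_subeq {a : Matrix (Fin m) (Fin m) A} {b : Matrix (Fin n) (Fin n) A}
    (h : Subeq a b) : SubeqElem (ofMat m a) (ofMat n b) := by
  obtain ⟨y, hy⟩ := h
  refine subeqElem_iff_exists_seq.2 ⟨fun k => ofMat (max m n) (padMat _ (y k)), ?_⟩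
  simp only [ofMat_mul_mul_conjTranspose (le_max_left m n) (le_max_right m n)]
  exact (continuous_ofMat.tendsto a).comp hy

variable {B : Type v} [NonUnitalCStarAlgebra B] [PartialOrder B] [StarOrderedRing B]

theorem map_ofMat (θ : A →⋆ₙₐ[ℂ] B) (a : Matrix (Fin n) (Fin n) A) :
    Stab.map θ (ofMat n a) = ofMat n (a.map θ) :=
  CStarCompletion.lift_of (S := Stab B) _ (norm_of_map_le θ) (MInf.of n (CStarMatrix.ofMatrix a))

/-- If a compression of `b` by an element of `K ⊗ A` is close to `a`, then so is one by a
matrix. -/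
theorem exists_matrix_of_norm_sub_lt {a b : Matrix (Fin n) (Fin n) A} (y : Stab A) {ε : ℝ}
    (h : ‖y * ofMat n b * star y - ofMat n a‖ < ε) :
    ∃ z : Matrix (Fin n) (Fin n) A, ∀ i j, ‖(z * b * zᴴ) i j - a i j‖ < ε := by
  have hopen : IsOpen {y : Stab A | ‖y * ofMat n b * star y - ofMat n a‖ < ε} :=
    isOpen_lt (by fun_prop) continuous_const
  obtain ⟨δ, hδ, hball⟩ := Metric.isOpen_iff.1 hopen y h
  obtain ⟨k, hk, w, hw⟩ := exists_norm_sub_ofMat_lt y n hδ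
  have hw' : ‖ofMat k w * ofMat n b * star (ofMat k w) - ofMat n a‖ < ε :=
    hball (by rwa [Metric.mem_ball, dist_comm, dist_eq_norm])
  rw [← ofMat_padMat hk a, ← ofMat_padMat hk b, ← ofMat_conjTranspose, ← ofMat_mul, ← ofMat_mul,
    ← ofMat_sub] at hw'
  refine ⟨w.submatrix (Fin.castLE hk) (Fin.castLE hk), fun i j => ?_⟩
  refine lt_of_eq_of_lt ?_
    ((norm_entry_le_norm_ofMat _ (Fin.castLE hk i) (Fin.castLE hk j)).trans_lt hw')
  have h1 : padMat k a (Fin.castLE hk i) (Fin.castLE hk j) = a i j := by simp [padMat]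
  have h2 : (w * padMat k b * wᴴ) (Fin.castLE hk i) (Fin.castLE hk j) =
      (w.submatrix (Fin.castLE hk) (Fin.castLE hk) * b *
        (w.submatrix (Fin.castLE hk) (Fin.castLE hk))ᴴ) i j := by
    simp only [Matrix.mul_apply]
    rw [sum_eq_sum_castLE hk]
    · refine Finset.sum_congr rfl fun p _ => ?_
      rw [sum_eq_sum_castLE hk]
      · simp [padMat]
      · intro q hq
        simp [padMat, hq]
    · intro p hp
      have : ∀ q, padMat k b q p = 0 := fun q => by simp [padMat, hp]
      simp [this]
  rw [Matrix.sub_apply, h1, h2]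

end Stab

end Stab

/-! ### The approximate unit of the stabilization of a unital algebra -/

section Unital

variable {A : Type u} [CStarAlgebra A] [PartialOrder A] [StarOrderedRing A]

namespace Stab

/-- The unit of `M_n(A)`, as an element of `K ⊗ A`. -/
noncomputable def unit (A : Type u) [CStarAlgebra A] [PartialOrder A] [StarOrderedRing A]
    (n : ℕ) : Stab A :=
  ofMat n 1

variable {n m : ℕ}

theorem unit_mul_unit : unit A n * unit A n = unit A n := by
  rw [unit, ← ofMat_mul, mul_one]

theorem star_unit : star (unit A n) = unit A n := by
  rw [unit, ← ofMat_conjTranspose, conjTranspose_one]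

theorem isStarProjection_unit : IsStarProjection (unit A n) := ⟨unit_mul_unit, star_unit⟩

theorem unit_eq_sum : unit A n = ∑ i ∈ Finset.range n, single i i 1 := by
  rw [unit, ofMat_eq_sum, ← Fin.sum_univ_eq_sum_range (fun i => (single i i 1 : Stab A))]
  refine Finset.sum_congr rfl fun i _ => ?_
  rw [Finset.sum_eq_single i, Matrix.one_apply_eq]
  · intro j _ hj
    rw [Matrix.one_apply_ne' hj, ← ofMat_single, Matrix.single_zero, ofMat_zero]
  · simp

theorem ofMat_mul_unit (h : m ≤ n) (a : Matrix (Fin m) (Fin m) A) :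
    ofMat m a * unit A n = ofMat m a := by
  rw [← ofMat_padMat h, unit, ← ofMat_mul, mul_one]

theorem unit_mul_ofMat (h : m ≤ n) (a : Matrix (Fin m) (Fin m) A) :
    unit A n * ofMat m a = ofMat m a := by
  rw [← ofMat_padMat h, unit, ← ofMat_mul, one_mul]

theorem tendsto_mul_unit (x : Stab A) : Tendsto (fun n => x * unit A n) atTop (𝓝 x) := by
  rw [Metric.tendsto_atTop]
  intro ε hε
  obtain ⟨k, -, a, ha⟩ := exists_norm_sub_ofMat_lt x 0 (show 0 < ε / 2 by positivity)
  refine ⟨k, fun n hn => ?_⟩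
  have : x * unit A n - x = (x - ofMat k a) * unit A n - (x - ofMat k a) := by
    rw [sub_mul, ofMat_mul_unit hn]
    abel
  rw [dist_eq_norm, this]
  calc _ ≤ ‖(x - ofMat k a) * unit A n‖ + ‖x - ofMat k a‖ := norm_sub_le _ _
    _ ≤ ‖x - ofMat k a‖ * ‖unit A n‖ + ‖x - ofMat k a‖ := by gcongr; exact norm_mul_le _ _
    _ ≤ ‖x - ofMat k a‖ * 1 + ‖x - ofMat k a‖ := by gcongr; exact isStarProjection_unit.norm_le
    _ < ε := by linarith

theorem tendsto_unit_mul (x : Stab A) : Tendsto (fun n => unit A n * x) atTop (𝓝 x) := by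
  have := (tendsto_mul_unit (star x)).star
  simpa [star_unit] using this

theorem tendsto_unit_mul_mul_unit (x : Stab A) :
    Tendsto (fun n => unit A n * x * unit A n) atTop (𝓝 x) := by
  have h : Tendsto (fun n => unit A n * (x * unit A n - x) + unit A n * x) atTop (𝓝 (0 + x)) := by
    refine Tendsto.add ?_ (tendsto_unit_mul x)
    refine squeeze_zero_norm (a := fun n => ‖x * unit A n - x‖) (fun n => ?_) ?_
    · calc _ ≤ ‖unit A n‖ * ‖x * unit A n - x‖ := norm_mul_le _ _
        _ ≤ 1 * ‖x * unit A n - x‖ := by gcongr; exact isStarProjection_unit.norm_le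
        _ = _ := one_mul _
    · rw [← tendsto_iff_norm_sub_tendsto_zero]
      exact tendsto_mul_unit x
  rw [zero_add] at h
  refine h.congr fun n => ?_
  rw [mul_sub, sub_add_cancel, mul_assoc]

/-- The corner of `K ⊗ A` cut out by `unit A n` is `M_n(A)`. -/
theorem exists_unit_mul_mul_unit_eq (x : Stab A) (n : ℕ) :
    ∃ a : Matrix (Fin n) (Fin n) A, unit A n * x * unit A n = ofMat n a := by
  have hcl : IsClosed {x : Stab A | unit A n * x * unit A n ∈ Set.range (ofMat n)} :=
    isClosed_range_ofMat.preimage (by fun_prop)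
  suffices h : unit A n * x * unit A n ∈ Set.range (ofMat n) by
    obtain ⟨a, ha⟩ := h
    exact ⟨a, ha.symm⟩
  refine hcl.closure_subset (Metric.mem_closure_iff.2 fun ε hε => ?_ : x ∈ _)
  obtain ⟨k, hk, a, ha⟩ := exists_norm_sub_ofMat_lt x n hε
  refine ⟨ofMat k a, ?_, by rwa [dist_eq_norm]⟩
  refine ⟨a.submatrix (Fin.castLE hk) (Fin.castLE hk), ?_⟩
  rw [unit, ← ofMat_padMat hk, ← ofMat_padMat hk, ← ofMat_mul, ← ofMat_mul]
  congr 1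
  have h1 : padMat k (1 : Matrix (Fin n) (Fin n) A) =
      diagonal fun i : Fin k => if i.1 < n then 1 else 0 := by
    ext i j
    simp only [padMat, Matrix.one_apply, Matrix.diagonal_apply, Fin.ext_iff]
    grind
  ext i j
  rw [h1, Matrix.mul_diagonal, Matrix.diagonal_mul]
  simp only [padMat, Matrix.submatrix_apply]
  by_cases hi : i.1 < n <;> by_cases hj : j.1 < n <;> simp [hi, hj]

end Stab

end Unital

/-! ### Positive elements -/

section PosElem

variable {B : Type u} [NonUnitalCStarAlgebra B]

theorem isPosElem_iff_nonneg [PartialOrder B] [StarOrderedRing B] {b : B} :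
    IsPosElem b ↔ 0 ≤ b :=
  CStarAlgebra.nonneg_iff_eq_star_mul_self.symm

theorem isClosed_setOf_isPosElem : IsClosed {b : B | IsPosElem b} := by
  let : PartialOrder B := CStarAlgebra.spectralOrder B
  have : StarOrderedRing B := CStarAlgebra.spectralOrderedRing B
  simp only [isPosElem_iff_nonneg]
  exact CStarAlgebra.isClosed_nonneg

theorem IsPosElem.add {a b : B} (ha : IsPosElem a) (hb : IsPosElem b) : IsPosElem (a + b) := by
  let : PartialOrder B := CStarAlgebra.spectralOrder B
  have : StarOrderedRing B := CStarAlgebra.spectralOrderedRing B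
  rw [isPosElem_iff_nonneg] at *
  exact add_nonneg ha hb

theorem IsPosElem.conj {a : B} (ha : IsPosElem a) (y : B) : IsPosElem (y * a * star y) := by
  obtain ⟨z, rfl⟩ := ha
  exact ⟨z * star y, by simp [mul_assoc]⟩

/-- An injective star homomorphism reflects positivity. -/
theorem IsPosElem.of_map {C : Type v} [NonUnitalCStarAlgebra C] (φ : B →⋆ₙₐ[ℂ] C)
    (hφ : Function.Injective φ) {b : B} (h : IsPosElem (φ b)) : IsPosElem b := by
  let : PartialOrder B := CStarAlgebra.spectralOrder B
  have : StarOrderedRing B := CStarAlgebra.spectralOrderedRing B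
  let : PartialOrder C := CStarAlgebra.spectralOrder C
  have : StarOrderedRing C := CStarAlgebra.spectralOrderedRing C
  have hsa : IsSelfAdjoint b := by
    obtain ⟨y, hy⟩ := h
    exact hφ (by rw [map_star, hy, star_mul, star_star])
  rw [isPosElem_iff_nonneg] at *
  have hn : 0 ≤ b⁻ := CFC.negPart_nonneg b
  have hns : star b⁻ = b⁻ := hn.isSelfAdjoint.star_eq
  have h1 : b⁻ * b * b⁻ = -(b⁻ * b⁻ * b⁻) := by
    nth_rw 2 [← CFC.posPart_sub_negPart b hsa]
    rw [mul_sub, CFC.negPart_mul_posPart]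
    simp
  have h2 : 0 ≤ b⁻ * b⁻ * b⁻ := by
    have := star_right_conjugate_nonneg hn b⁻
    rwa [hns] at this
  have h3 : 0 ≤ φ (b⁻ * b * b⁻) := by
    have := star_right_conjugate_nonneg h (φ b⁻)
    rwa [← map_star, hns, ← map_mul, ← map_mul] at this
  have h4 : 0 ≤ φ (b⁻ * b⁻ * b⁻) := map_nonneg φ h2
  rw [h1, map_neg] at h3
  have h5 : b⁻ * b⁻ * b⁻ = 0 :=
    (injective_iff_map_eq_zero φ).1 hφ _ (le_antisymm (neg_nonneg.1 h3) h4)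
  have h6 : b⁻ * b⁻ = 0 := by
    rw [← norm_eq_zero, ← mul_self_eq_zero, ← CStarRing.norm_star_mul_self]
    rw [star_mul, hns, ← mul_assoc, h5, zero_mul, norm_zero]
  have h7 : b⁻ = 0 := by
    rw [← norm_eq_zero, ← mul_self_eq_zero, ← CStarRing.norm_star_mul_self, hns, h6, norm_zero]
  rw [← CFC.posPart_sub_negPart b hsa, h7, sub_zero]
  exact CFC.posPart_nonneg b

end PosElem

/-! ### Comparison of `W(A)` with `Cu(A)`, and sums of classes in `Cu(A)` -/

section Cu

variable {A : Type u} [CStarAlgebra A] [PartialOrder A] [StarOrderedRing A]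

namespace Stab

variable {m n : ℕ}

/-- Subequivalence in `K ⊗ A` of two matrices implies subequivalence in `M_∞(A)`. -/
theorem subeq_of_subeqElem_ofMat {a : Matrix (Fin m) (Fin m) A} {b : Matrix (Fin n) (Fin n) A}
    (h : SubeqElem (ofMat m a) (ofMat n b)) : Subeq a b := by
  set k := max m n with hk
  have hm : m ≤ k := le_max_left _ _
  have hn : n ≤ k := le_max_right _ _
  have h1 : Subeq (padMat k a) (padMat k b) := by
    obtain ⟨y, hy⟩ := subeqElem_iff_exists_seq.1 h
    rw [Metric.tendsto_atTop] at hy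
    have (j : ℕ) : ∃ z : Matrix (Fin k) (Fin k) A, ∀ p q,
        ‖(z * padMat k b * zᴴ) p q - padMat k a p q‖ < 1 / ((j : ℝ) + 1) := by
      obtain ⟨N, hN⟩ := hy (1 / ((j : ℝ) + 1)) (by positivity)
      refine exists_matrix_of_norm_sub_lt (y N) ?_
      rw [ofMat_padMat hm, ofMat_padMat hn, ← dist_eq_norm]
      exact hN N le_rfl
    choose z hz using this
    refine ⟨z, tendsto_pi_nhds.2 fun p => tendsto_pi_nhds.2 fun q => ?_⟩
    rw [tendsto_iff_norm_sub_tendsto_zero]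
    exact squeeze_zero (fun _ => norm_nonneg _) (fun j => (hz j p q).le)
      tendsto_one_div_add_atTop_nhds_zero_nat
  have h2 : Subeq a (padMat k a) := by
    have := Subeq.submatrix (padMat k a) (Fin.castLE hm)
    convert this using 1
    ext i j
    simp [padMat]
  have h3 : Subeq (padMat k b) b := by
    refine Subeq.of_eq (Matrix.of fun i j => if i.1 = j.1 then 1 else 0) ?_
    ext i j
    simp only [Matrix.mul_apply, Matrix.of_apply, conjTranspose_apply, apply_ite star, star_one,
      star_zero, mul_ite, mul_one, mul_zero, ite_mul, one_mul, zero_mul, padMat]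
    by_cases hi : i.1 < n <;> by_cases hj : j.1 < n
    · rw [Finset.sum_eq_single ⟨j, hj⟩ (by grind) (by simp),
        Finset.sum_eq_single ⟨i, hi⟩ (by grind) (by simp)]
      simp [hi, hj]
    · rw [dif_neg (by grind)]
      exact Finset.sum_eq_zero fun p _ => if_neg (by grind)
    · rw [dif_neg (by grind)]
      refine Finset.sum_eq_zero fun p _ => ?_
      split_ifs
      · exact Finset.sum_eq_zero fun p _ => if_neg (by grind)
      · rfl
    · rw [dif_neg (by grind)]
      exact Finset.sum_eq_zero fun p _ => if_neg (by grind)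
  exact h2.trans (h1.trans h3)

/-- The partial isometry of `K ⊗ A` that moves the first `n` basis vectors along `σ`. -/
noncomputable def shift (A : Type u) [CStarAlgebra A] [PartialOrder A] [StarOrderedRing A]
    (σ : ℕ → ℕ) (n : ℕ) : Stab A :=
  ∑ i ∈ Finset.range n, single (σ i) i 1

variable {σ τ : ℕ → ℕ}

theorem star_shift : star (shift A σ n) = ∑ i ∈ Finset.range n, single i (σ i) 1 := by
  simp only [shift, star_sum, star_single, star_one]

theorem star_shift_mul_shift (hσ : Function.Injective σ) :
    star (shift A σ n) * shift A σ n = unit A n := by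
  rw [star_shift, shift, Finset.sum_mul_sum, unit_eq_sum]
  refine Finset.sum_congr rfl fun i hi => ?_
  simp only [single_mul_single, hσ.eq_iff, mul_one, Finset.sum_ite_eq, hi, if_true]

theorem star_shift_mul_shift_of_disjoint (h : ∀ i j, σ i ≠ τ j) :
    star (shift A σ m) * shift A τ n = 0 := by
  rw [star_shift, shift, Finset.sum_mul_sum]
  exact Finset.sum_eq_zero fun i _ => Finset.sum_eq_zero fun j _ =>
    single_mul_single_of_ne _ _ (h i j) _ _

theorem shift_mul_unit (h : m ≤ n) : shift A σ n * unit A m = shift A σ m := by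
  rw [shift, shift, unit_eq_sum, Finset.sum_mul_sum]
  simp only [single_mul_single, mul_one, Finset.sum_ite_eq]
  rw [← Finset.sum_filter]
  refine Finset.sum_congr ?_ fun _ _ => rfl
  ext i
  simp only [Finset.mem_filter, Finset.mem_range]
  omega

theorem norm_shift_le (hσ : Function.Injective σ) : ‖shift A σ n‖ ≤ 1 := by
  have h : ‖shift A σ n‖ * ‖shift A σ n‖ ≤ 1 := by
    rw [← CStarRing.norm_star_mul_self, star_shift_mul_shift hσ]
    exact isStarProjection_unit.norm_le
  nlinarith [norm_nonneg (shift A σ n)]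

/-- The compressions by the partial isometries `shift A σ n` converge pointwise. -/
theorem exists_tendsto_shift_conj (hσ : Function.Injective σ) (a : Stab A) :
    ∃ c, Tendsto (fun n => shift A σ n * a * star (shift A σ n)) atTop (𝓝 c) := by
  refine cauchySeq_tendsto_of_complete (Metric.cauchySeq_iff'.2 fun ε hε => ?_)
  obtain ⟨N, hN⟩ := Metric.tendsto_atTop.1 (tendsto_unit_mul_mul_unit a) ε hε
  refine ⟨N, fun n hn => ?_⟩
  have h : shift A σ N = shift A σ n * unit A N := (shift_mul_unit hn).symm
  have h' : shift A σ n * a * star (shift A σ n) - shift A σ N * a * star (shift A σ N) =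
      shift A σ n * (a - unit A N * a * unit A N) * star (shift A σ n) := by
    rw [h, star_mul, star_unit]
    noncomm_ring
  rw [dist_eq_norm, h']
  calc _ ≤ ‖shift A σ n‖ * ‖a - unit A N * a * unit A N‖ * ‖star (shift A σ n)‖ := norm_mul₃_le
    _ ≤ 1 * ‖a - unit A N * a * unit A N‖ * 1 := by
      rw [norm_star]
      gcongr <;> exact norm_shift_le hσ
    _ < ε := by
      rw [one_mul, mul_one, norm_sub_rev, ← dist_eq_norm]
      exact hN N le_rfl

/-- As `K ⊗ A` is stable, the sum of two classes in `Cu(A)` is the class of a positive element. -/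
theorem exists_mk_single_eq_add {a b : Stab A} (ha : IsPosElem a) (hb : IsPosElem b) :
    ∃ (c : Stab A) (hc : IsPosElem c), W.mk (PosMat.single c hc) =
      W.mk (PosMat.single a ha) + W.mk (PosMat.single b hb) := by
  -- the even basis vectors carry `a`, the odd ones carry `b`
  let σ : ℕ → ℕ := fun i => 2 * i
  let τ : ℕ → ℕ := fun i => 2 * i + 1
  have hσ : Function.Injective σ := fun i j h => by simp only [σ] at h; omega
  have hτ : Function.Injective τ := fun i j h => by simp only [τ] at h; omega
  have hστ (i j : ℕ) : σ i ≠ τ j := by simp only [σ, τ]; omega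
  obtain ⟨c, hc⟩ := exists_tendsto_shift_conj hσ a
  obtain ⟨d, hd⟩ := exists_tendsto_shift_conj hτ b
  have hcpos : IsPosElem c :=
    isClosed_setOf_isPosElem.mem_of_tendsto hc (Eventually.of_forall fun n => ha.conj _)
  have hdpos : IsPosElem d :=
    isClosed_setOf_isPosElem.mem_of_tendsto hd (Eventually.of_forall fun n => hb.conj _)
  refine ⟨c + d, hcpos.add hdpos, le_antisymm ?_ ?_⟩
  · rw [W.mk_le_add_iff]
    exact (isClosed_setOf_subeq _).preimage (f := fun x : Stab A => !![x])
      (continuous_pi fun i => continuous_pi fun j => by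
        fin_cases i
        fin_cases j
        exact continuous_id) |>.mem_of_tendsto (hc.add hd)
      (Eventually.of_forall fun n => subeq_add_fromBlocks _ _ _ _)
  · rw [W.add_le_mk_iff]
    have hlim (p q : Stab A) : Tendsto (fun l => p * (shift A σ l * a * star (shift A σ l) +
        shift A τ l * b * star (shift A τ l)) * q) atTop (𝓝 (p * (c + d) * q)) :=
      ((hc.add hd).const_mul p).mul_const q
    have hext {σ : ℕ → ℕ} (hσ : Function.Injective σ) {k l : ℕ} (h : k ≤ l) :
        star (shift A σ k) * shift A σ l = unit A k ∧
        star (shift A σ l) * shift A σ k = unit A k := by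
      have h1 : star (shift A σ l) * shift A σ k = unit A k := by
        rw [← shift_mul_unit h, ← mul_assoc, star_shift_mul_shift hσ]
        exact unit_mul_ofMat h 1
      refine ⟨?_, h1⟩
      rw [← star_inj, star_mul, star_star, star_unit, h1]
    have hτσ (k l : ℕ) : star (shift A τ k) * shift A σ l = 0 :=
      star_shift_mul_shift_of_disjoint fun i j => (hστ j i).symm
    have hστ' (k l : ℕ) : star (shift A σ k) * shift A τ l = 0 :=
      star_shift_mul_shift_of_disjoint hστ
    have e1 (k : ℕ) : star (shift A σ k) * (c + d) * shift A σ k = unit A k * a * unit A k := by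
      refine tendsto_nhds_unique (hlim _ _) (tendsto_const_nhds.congr' ?_)
      filter_upwards [eventually_ge_atTop k] with l hl
      have : star (shift A σ k) * (shift A σ l * a * star (shift A σ l) +
          shift A τ l * b * star (shift A τ l)) * shift A σ k =
          (star (shift A σ k) * shift A σ l) * a * (star (shift A σ l) * shift A σ k) +
          (star (shift A σ k) * shift A τ l) * b * (star (shift A τ l) * shift A σ k) := by
        noncomm_ring
      rw [this, (hext hσ hl).1, (hext hσ hl).2, hστ', zero_mul, zero_mul, add_zero]
    have e2 (k : ℕ) : star (shift A τ k) * (c + d) * shift A τ k = unit A k * b * unit A k := by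
      refine tendsto_nhds_unique (hlim _ _) (tendsto_const_nhds.congr' ?_)
      filter_upwards [eventually_ge_atTop k] with l hl
      have : star (shift A τ k) * (shift A σ l * a * star (shift A σ l) +
          shift A τ l * b * star (shift A τ l)) * shift A τ k =
          (star (shift A τ k) * shift A σ l) * a * (star (shift A σ l) * shift A τ k) +
          (star (shift A τ k) * shift A τ l) * b * (star (shift A τ l) * shift A τ k) := by
        noncomm_ring
      rw [this, (hext hτ hl).1, (hext hτ hl).2, hτσ, zero_mul, zero_mul, zero_add]
    have e3 (k : ℕ) : star (shift A σ k) * (c + d) * shift A τ k = 0 := by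
      refine tendsto_nhds_unique (hlim _ _) (tendsto_const_nhds.congr fun l => ?_)
      have : star (shift A σ k) * (shift A σ l * a * star (shift A σ l) +
          shift A τ l * b * star (shift A τ l)) * shift A τ k =
          (star (shift A σ k) * shift A σ l) * a * (star (shift A σ l) * shift A τ k) +
          (star (shift A σ k) * shift A τ l) * b * (star (shift A τ l) * shift A τ k) := by
        noncomm_ring
      rw [this, hστ', hστ', mul_zero, zero_mul, zero_mul, add_zero]
    have e4 (k : ℕ) : star (shift A τ k) * (c + d) * shift A σ k = 0 := by
      refine tendsto_nhds_unique (hlim _ _) (tendsto_const_nhds.congr fun l => ?_)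
      have : star (shift A τ k) * (shift A σ l * a * star (shift A σ l) +
          shift A τ l * b * star (shift A τ l)) * shift A σ k =
          (star (shift A τ k) * shift A σ l) * a * (star (shift A σ l) * shift A σ k) +
          (star (shift A τ k) * shift A τ l) * b * (star (shift A τ l) * shift A σ k) := by
        noncomm_ring
      rw [this, hτσ, hτσ, mul_zero, zero_mul, zero_mul, add_zero]
    have hcont : Continuous fun x : Stab A × Stab A =>
        fromBlocks !![x.1] 0 0 !![x.2] := by
      refine Continuous.matrix_fromBlocks ?_ continuous_const continuous_const ?_ <;>
      · refine continuous_pi fun i => continuous_pi fun j => ?_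
        fin_cases i
        fin_cases j
        first | exact continuous_fst | exact continuous_snd
    refine ((isClosed_setOf_subeq !![c + d]).preimage hcont).mem_of_tendsto
      ((tendsto_unit_mul_mul_unit a).prodMk_nhds (tendsto_unit_mul_mul_unit b))
      (Eventually.of_forall fun k => ?_)
    have := subeq_fromBlocks_of_mul_eq_zero (c := c + d) (p := star (shift A σ k))
      (q := star (shift A τ k)) (by rw [star_star, e3]) (by rw [star_star, e4])
    rwa [star_star, star_star, e1, e2] at this

end Stab

theorem PosMat.cuClass_le_iff {a b : PosMat A} : a.cuClass ≤ b.cuClass ↔ W.mk a ≤ W.mk b :=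
  ⟨Stab.subeq_of_subeqElem_ofMat, Stab.subeqElem_ofMat_of_subeq⟩

/-- The block sum in `K ⊗ A`: the second block is moved beyond the first one by a shift. -/
theorem Stab.ofMat_diagSum {m n : ℕ} (a : Matrix (Fin m) (Fin m) A)
    (b : Matrix (Fin n) (Fin n) A) :
    ofMat (m + n) (diagSum a b) =
      ofMat m a + shift A (m + ·) n * ofMat n b * star (shift A (m + ·) n) := by
  have h0 (i j : ℕ) : (single i j 0 : Stab A) = 0 := by
    rw [single, Matrix.single_zero, ofMat_zero]
  have h1 : shift A (m + ·) n * ofMat n b * star (shift A (m + ·) n) =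
      ∑ i : Fin n, ∑ j : Fin n, single (m + i) (m + j) (b i j) := by
    rw [star_shift, shift, ofMat_eq_sum, ← Fin.sum_univ_eq_sum_range
      (fun i => (single (m + i) i 1 : Stab A)), ← Fin.sum_univ_eq_sum_range
      (fun i => (single i (m + i) 1 : Stab A))]
    simp only [Finset.sum_mul, Finset.mul_sum, single_mul_single, ite_mul, zero_mul, one_mul,
      mul_one, Fin.val_inj]
    rw [Finset.sum_comm]
    refine Finset.sum_congr rfl fun i _ => ?_
    simp
  rw [h1, ofMat_eq_sum, Fin.sum_univ_add]
  simp only [Fin.sum_univ_add, diagSum, Matrix.submatrix_apply, finSumFinEquiv_symm_apply_castAdd,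
    finSumFinEquiv_symm_apply_natAdd, fromBlocks_apply₁₁, fromBlocks_apply₁₂, fromBlocks_apply₂₁,
    fromBlocks_apply₂₂, Matrix.zero_apply, h0, Finset.sum_const_zero, add_zero, zero_add,
    Fin.val_castAdd, Fin.val_natAdd, ofMat_eq_sum]

theorem PosMat.cuClass_add (a b : PosMat A) : (a + b).cuClass = a.cuClass + b.cuClass := by
  obtain ⟨m, a, ha⟩ := a
  obtain ⟨n, b, hb⟩ := b
  let r : Stab A := Stab.shift A (m + ·) n
  have hr : star r * r = Stab.unit A n := Stab.star_shift_mul_shift (add_right_injective m)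
  have ha1 : Stab.unit A m * Stab.ofMat m a = Stab.ofMat m a := Stab.unit_mul_ofMat le_rfl a
  have ha2 : Stab.ofMat m a * Stab.unit A m = Stab.ofMat m a := Stab.ofMat_mul_unit le_rfl a
  have hb1 : Stab.unit A n * Stab.ofMat n b = Stab.ofMat n b := Stab.unit_mul_ofMat le_rfl b
  have hb2 : Stab.ofMat n b * Stab.unit A n = Stab.ofMat n b := Stab.ofMat_mul_unit le_rfl b
  have hur : Stab.unit A m * r = 0 := by
    rw [Stab.unit_eq_sum]
    simp only [r, Stab.shift, Finset.sum_mul_sum]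
    refine Finset.sum_eq_zero fun i hi => Finset.sum_eq_zero fun j _ =>
      Stab.single_mul_single_of_ne _ _ ?_ _ _
    simp only [Finset.mem_range] at hi
    omega
  have hru : star r * Stab.unit A m = 0 := by
    rw [← star_inj, star_mul, star_star, Stab.star_unit, hur, star_zero]
  have hc : Stab.ofMat (m + n) (diagSum a b) = Stab.ofMat m a + r * Stab.ofMat n b * star r :=
    Stab.ofMat_diagSum a b
  refine le_antisymm ?_ ?_
  · refine W.mk_le_add_iff.2 ?_
    have := subeq_add_fromBlocks (Stab.ofMat m a) (Stab.ofMat n b) (Stab.unit A m) r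
    rw [Stab.star_unit, ha1, ha2, ← hc] at this
    exact this
  · refine W.add_le_mk_iff.2 ?_
    have h1 : Stab.unit A m * Stab.ofMat (m + n) (diagSum a b) * star (Stab.unit A m) =
        Stab.ofMat m a := by
      rw [hc, Stab.star_unit, mul_add, add_mul, ha1, ha2, ← mul_assoc, ← mul_assoc, hur]
      simp
    have har : Stab.ofMat m a * r = 0 := by rw [← ha2, mul_assoc, hur, mul_zero]
    have hra : star r * Stab.ofMat m a = 0 := by rw [← ha1, ← mul_assoc, hru, zero_mul]
    have h2 : star r * Stab.ofMat (m + n) (diagSum a b) * star (star r) = Stab.ofMat n b := by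
      have : star r * (Stab.ofMat m a + r * Stab.ofMat n b * star r) * r =
          star r * (Stab.ofMat m a * r) + star r * r * Stab.ofMat n b * (star r * r) := by
        noncomm_ring
      rw [hc, star_star, this, har, hr, hb1, hb2, mul_zero, zero_add]
    have h3 : Stab.unit A m * Stab.ofMat (m + n) (diagSum a b) * star (star r) = 0 := by
      have : Stab.unit A m * (Stab.ofMat m a + r * Stab.ofMat n b * star r) * r =
          Stab.unit A m * (Stab.ofMat m a * r) +
            Stab.unit A m * r * Stab.ofMat n b * (star r * r) := by
        noncomm_ring
      rw [hc, star_star, this, har, hur]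
      simp
    have h4 : star r * Stab.ofMat (m + n) (diagSum a b) * star (Stab.unit A m) = 0 := by
      have : star r * (Stab.ofMat m a + r * Stab.ofMat n b * star r) * Stab.unit A m =
          star r * Stab.ofMat m a * Stab.unit A m +
            star r * r * Stab.ofMat n b * (star r * Stab.unit A m) := by
        noncomm_ring
      rw [hc, Stab.star_unit, this, hra, hru]
      simp
    have := subeq_fromBlocks_of_mul_eq_zero h3 h4
    rw [h1, h2] at this
    exact this

/-- A nonzero positive element of `K ⊗ A` dominates a nonzero positive element of `A`, one of its
diagonal entries. -/
theorem Stab.exists_subeqElem_ofMat_one {x : Stab A} (hx : IsPosElem x) (hx0 : x ≠ 0) :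
    ∃ t : A, IsPosElem t ∧ t ≠ 0 ∧ SubeqElem (ofMat 1 !![t]) x := by
  obtain ⟨y, rfl⟩ := hx
  have hy : ∃ i, y * single i 0 1 ≠ 0 := by
    by_contra! hcon
    have h1 (n : ℕ) : y * unit A n = 0 := by
      rw [unit_eq_sum, Finset.mul_sum]
      refine Finset.sum_eq_zero fun i _ => ?_
      have h2 : (single i i 1 : Stab A) = single i 0 1 * single 0 i 1 := by
        rw [single_mul_single_same, one_mul]
      rw [h2, ← mul_assoc, hcon, zero_mul]
    have h3 : y = 0 := tendsto_nhds_unique (tendsto_mul_unit y)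
      (tendsto_const_nhds.congr fun n => (h1 n).symm)
    exact hx0 (by simp [h3])
  obtain ⟨i, hi⟩ := hy
  have hu : (single i 0 1 : Stab A) * unit A 1 = single i 0 1 := by
    rw [unit_eq_sum, Finset.sum_range_one, single_mul_single_same, one_mul]
  obtain ⟨t, ht⟩ := exists_unit_mul_mul_unit_eq (star (y * single i 0 1) * (y * single i 0 1)) 1
  have ht' : star (y * single i 0 1) * (y * single i 0 1) = ofMat 1 t := by
    have h : y * single i 0 1 * unit A 1 = y * single i 0 1 := by rw [mul_assoc, hu]
    generalize y * single i 0 1 = w at h ht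
    have h' : unit A 1 * star w = star w := by rw [← star_unit, ← star_mul, h]
    rw [← ht, ← mul_assoc, h', mul_assoc, h]
  have htt : t = !![t 0 0] := by
    ext p q
    fin_cases p
    fin_cases q
    rfl
  let φ : A →⋆ₙₐ[ℂ] Stab A :=
    (Stab.of 1).comp (StarAlgEquiv.toNonUnitalStarAlgHom (CStarMatrix.toOneByOne (Fin 1) ℂ A))
  have hφ (a : A) : φ a = ofMat 1 !![a] := by
    refine congrArg (Stab.of 1) ?_
    ext p q
    fin_cases p
    fin_cases q
    rfl
  refine ⟨t 0 0, ?_, ?_, ?_⟩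
  · refine IsPosElem.of_map φ (fun a b hab => ?_) ?_
    · rw [hφ, hφ] at hab
      simpa using congrFun (congrFun (ofMat_injective hab) 0) 0
    · rw [hφ, ← htt, ← ht']
      exact ⟨_, rfl⟩
  · intro h0
    rw [htt, h0] at ht'
    have h1 : (!![0] : Matrix (Fin 1) (Fin 1) A) = 0 := by
      ext p q
      fin_cases p
      fin_cases q
      rfl
    rw [h1, ofMat_zero] at ht'
    exact hi (CStarRing.star_mul_self_eq_zero_iff _ |>.1 ht')
  · rw [← htt, ← ht']
    refine SubeqElem.of_eq (star (single i 0 1)) ?_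
    rw [star_star, star_mul]
    noncomm_ring

end Cu

/-! ### Multiples of a class -/

section Diagonal

variable {A : Type u} [NonUnitalCStarAlgebra A]

theorem IsPosElem.isPositive_diagonal {b : A} (h : IsPosElem b) (n : ℕ) :
    IsPositive (diagonal fun _ : Fin n => b) := by
  obtain ⟨y, rfl⟩ := h
  refine ⟨diagonal fun _ => y, ?_⟩
  rw [diagonal_conjTranspose, diagonal_mul_diagonal]
  rfl

theorem W.nsmul_mk_single {b : A} (h : IsPosElem b) (n : ℕ) :
    n • W.mk (PosMat.single b h) = W.mk ⟨n, diagonal fun _ => b, h.isPositive_diagonal n⟩ := by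
  induction n with
  | zero =>
    rw [zero_nsmul]
    refine le_antisymm (W.zero_le _) ?_
    refine Subeq.of_eq (0 : Matrix (Fin 0) (Fin 0) A) ?_
    ext i
    exact i.elim0
  | succ n ih =>
    rw [succ_nsmul, ih, W.mk_add_mk]
    have hmat : diagSum (diagonal fun _ : Fin n => b) !![b] =
        (diagonal fun _ : Fin (n + 1) => b) := by
      ext i j
      refine Fin.lastCases ?_ (fun i => ?_) i <;> refine Fin.lastCases ?_ (fun j => ?_) j
      · simp [diagSum]
      · have h : (Fin.last n) ≠ Fin.castSucc j := (Fin.castSucc_lt_last j).ne'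
        rw [diagonal_apply_ne _ h]
        simp [diagSum]
      · have h : Fin.castSucc i ≠ Fin.last n := (Fin.castSucc_lt_last i).ne
        rw [diagonal_apply_ne _ h]
        simp [diagSum]
      · simp [diagSum, diagonal_apply]
    congr 1
    change PosMat.mk (n + 1) (diagSum (diagonal fun _ : Fin n => b) !![b]) _ = _
    congr 1

theorem W.mk_le_nsmul_mk_single {q : PosMat A} {b : A} (h : IsPosElem b)
    {z : Matrix (Fin q.size) (Fin q.size) A} (hz : z * (diagonal fun _ => b) * zᴴ = q.mat) :
    W.mk q ≤ q.size • W.mk (PosMat.single b h) := by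
  rw [W.nsmul_mk_single]
  exact Subeq.of_eq z hz

theorem Subeq.diagonal {a b : A} (h : SubeqElem a b) (n : ℕ) :
    Subeq (diagonal fun _ : Fin n => a) (diagonal fun _ : Fin n => b) := by
  obtain ⟨y, hy⟩ := subeqElem_iff_exists_seq.1 h
  refine ⟨fun k => Matrix.diagonal fun _ => y k, ?_⟩
  simp only [diagonal_conjTranspose, diagonal_mul_diagonal]
  refine tendsto_pi_nhds.2 fun i => tendsto_pi_nhds.2 fun j => ?_
  by_cases hij : i = j
  · subst hij
    simpa using hy
  · simp [diagonal_apply_ne _ hij]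

end Diagonal

/-! ### Divisibility in simple algebras that are not of type I -/

section Simple

variable {A : Type u} [CStarAlgebra A]

/-- A simple C⋆-algebra is prime. -/
theorem IsSimple.exists_mul_mul_ne_zero (hA : IsSimple A) {e f : A} (he : e ≠ 0) (hf : f ≠ 0) :
    ∃ r, e * r * f ≠ 0 := by
  by_contra! h
  let I : TwoSidedIdeal A := TwoSidedIdeal.mk' {r | ∀ a, e * a * r = 0}
    (fun a => mul_zero _) (fun hx hy a => by rw [mul_add, hx, hy, add_zero])
    (fun hx a => by rw [mul_neg, hx, neg_zero])
    (fun {x y} hy a => by rw [← mul_assoc, mul_assoc e, hy])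
    (fun {x y} hx a => by rw [← mul_assoc, hx, zero_mul])
  have hI (r : A) : r ∈ I ↔ ∀ a, e * a * r = 0 := TwoSidedIdeal.mem_mk' _ _ _ _ _ _ _
  have hcl : IsClosed (I : Set A) := by
    have : (I : Set A) = ⋂ a, {r | e * a * r = 0} := by
      ext r
      simp [hI]
    rw [this]
    exact isClosed_iInter fun a => isClosed_eq (by fun_prop) continuous_const
  rcases hA.eq_bot_or_eq_top I hcl with h0 | h1
  · have : f ∈ I := (hI f).2 h
    rw [h0, TwoSidedIdeal.mem_bot] at this
    exact hf this
  · have : (1 : A) ∈ I := by rw [h1]; trivial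
    exact he (by simpa using (hI 1).1 this 1)

/-- In a simple C⋆-algebra that is not of type I, no nonzero positive element is abelian. -/
theorem IsSimple.exists_not_commute (hA : IsSimple A) (htypeI : ¬ IsTypeI A) {x : A} (hx : x ≠ 0)
    (hpos : IsPosElem x) : ∃ y z : A, ¬ Commute (x * y * x) (x * z * x) := by
  by_contra! h
  refine htypeI fun B _ π hπ hB => ⟨π x, ?_, ?_, fun y z => ?_⟩
  · intro h0
    let I : TwoSidedIdeal A := TwoSidedIdeal.mk' {r | π r = 0}
      (map_zero π) (fun {x y} hx hy => by
        change π (x + y) = 0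
        rw [map_add, show π x = 0 from hx, show π y = 0 from hy, add_zero])
      (fun {x} hx => by
        change π (-x) = 0
        rw [map_neg, show π x = 0 from hx, neg_zero])
      (fun {x y} hy => by
        change π (x * y) = 0
        rw [map_mul, show π y = 0 from hy, mul_zero])
      (fun {x y} hx => by
        change π (x * y) = 0
        rw [map_mul, show π x = 0 from hx, zero_mul])
    have hI (r : A) : r ∈ I ↔ π r = 0 := TwoSidedIdeal.mem_mk' _ _ _ _ _ _ _
    have hcl : IsClosed (I : Set A) := by
      have : (I : Set A) = {r | π r = 0} := by
        ext r
        simp [hI]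
      rw [this]
      exact isClosed_eq (continuous_starHom π) continuous_const
    rcases hA.eq_bot_or_eq_top I hcl with h1 | h1
    · have : x ∈ I := (hI x).2 h0
      rw [h1, TwoSidedIdeal.mem_bot] at this
      exact hx this
    · obtain ⟨b, hb⟩ := exists_ne (0 : B)
      obtain ⟨a, rfl⟩ := hπ b
      refine hb ((hI a).1 ?_)
      rw [h1]
      trivial
  · obtain ⟨y, rfl⟩ := hpos
    exact ⟨π y, by rw [map_mul, map_star]⟩
  · obtain ⟨y, rfl⟩ := hπ y
    obtain ⟨z, rfl⟩ := hπ z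
    simpa only [map_mul] using (h y z).map π

variable [PartialOrder A] [StarOrderedRing A]

/-- Two self-adjoint elements `h` and `k ≥ 0`, `k ≠ 0`, for which each `h - s k` is positive or
negative, are proportional. -/
theorem exists_eq_smul_of_forall_le_or_le {h k : A} (hk : 0 ≤ k) (hk0 : k ≠ 0)
    (H : ∀ s : ℝ, h ≤ s • k ∨ s • k ≤ h) : ∃ s : ℝ, h = s • k := by
  have hlim (x y : A) (hxy : ∀ n : ℕ, x ≤ ((1 : ℝ) / (n + 1)) • y) : x ≤ 0 := by
    have h1 : Tendsto (fun n : ℕ => ((1 : ℝ) / (n + 1)) • y) atTop (𝓝 ((0 : ℝ) • y)) :=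
      tendsto_one_div_add_atTop_nhds_zero_nat.smul_const y
    rw [zero_smul] at h1
    exact ge_of_tendsto' h1 hxy
  have hmul (n : ℕ) (y : A) : ((1 : ℝ) / (n + 1)) • (((n : ℝ) + 1) • y) = y := by
    rw [smul_smul, one_div_mul_cancel (by positivity), one_smul]
  have hpos (n : ℕ) : (0 : ℝ) ≤ 1 / (n + 1) := by positivity
  let S : Set ℝ := {s | s • k ≤ h}
  have hne : S.Nonempty := by
    by_contra hS
    have h1 (s : ℝ) : h ≤ s • k := (H s).resolve_right fun hs => hS ⟨s, hs⟩
    refine hk0 (le_antisymm (hlim k (-h) fun n => ?_) hk)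
    have h2 := h1 (-(n + 1))
    rw [neg_smul, le_neg] at h2
    calc k = ((1 : ℝ) / (n + 1)) • (((n : ℝ) + 1) • k) := (hmul n k).symm
      _ ≤ _ := smul_le_smul_of_nonneg_left h2 (hpos n)
  have hbdd : BddAbove S := by
    by_contra hS
    refine hk0 (le_antisymm (hlim k h fun n => ?_) hk)
    obtain ⟨s, hs, hns⟩ := not_bddAbove_iff.1 hS ((n : ℝ) + 1)
    have h2 : ((n : ℝ) + 1) • k ≤ h := (smul_le_smul_of_nonneg_right hns.le hk).trans hs
    calc k = ((1 : ℝ) / (n + 1)) • (((n : ℝ) + 1) • k) := (hmul n k).symm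
      _ ≤ _ := smul_le_smul_of_nonneg_left h2 (hpos n)
  have hcl : IsClosed S := isClosed_le (by fun_prop) continuous_const
  refine ⟨sSup S, le_antisymm ?_ (hcl.csSup_mem hne hbdd)⟩
  rw [← sub_nonpos]
  refine hlim _ k fun n => ?_
  have h3 : h ≤ (sSup S + 1 / (n + 1)) • k := by
    refine (H _).resolve_right fun hs => ?_
    have := le_csSup hbdd hs
    have h4 : (0 : ℝ) < 1 / (n + 1) := by positivity
    linarith
  rw [add_smul] at h3
  exact sub_le_iff_le_add'.2 h3

omit [PartialOrder A] [StarOrderedRing A] in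
theorem mul_self_ne_zero_of_isSelfAdjoint {e : A} (he : IsSelfAdjoint e) (h : e ≠ 0) :
    e * e ≠ 0 := fun h0 => h <| by
  rwa [← CStarRing.star_mul_self_eq_zero_iff, he.star_eq]

/-- If `T` is positive and not abelian then `T A T` contains two nonzero orthogonal
self-adjoint elements. -/
theorem exists_orthogonal_of_not_commute {T y z : A} (hT : 0 ≤ T)
    (h : ¬ Commute (T * y * T) (T * z * T)) :
    ∃ p q : A, IsSelfAdjoint (T * p * T) ∧ IsSelfAdjoint (T * q * T) ∧ T * p * T ≠ 0 ∧
      T * q * T ≠ 0 ∧ (T * p * T) * (T * q * T) = 0 := by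
  have hTs : star T = T := hT.isSelfAdjoint.star_eq
  by_contra! hcon
  have hT0 : T * T ≠ 0 :=
    mul_self_ne_zero_of_isSelfAdjoint hT.isSelfAdjoint fun h0 => h (by simp [h0])
  have hTT : 0 ≤ T * T := by
    simpa [hTs] using star_mul_self_nonneg T
  have hprop (y : A) (hy : IsSelfAdjoint y) : ∃ s : ℝ, T * y * T = s • (T * T) := by
    have hsa (y : A) (hy : IsSelfAdjoint y) : IsSelfAdjoint (T * y * T) := by
      rw [isSelfAdjoint_iff, star_mul, star_mul, hTs, hy.star_eq, mul_assoc]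
    -- otherwise `k = T y T - s T²` has nonzero positive and negative parts for some `s`
    refine exists_eq_smul_of_forall_le_or_le hTT hT0 fun s => ?_
    -- the fourth powers of the positive and of the negative part of `k` lie in `T A T`
    obtain ⟨k, hk⟩ : ∃ k, k = T * (y - s • 1) * T := ⟨_, rfl⟩
    have hks : IsSelfAdjoint k := by
      rw [hk]
      exact hsa _ (hy.sub ((IsSelfAdjoint.all s).smul (.one A)))
    have hkeq : k = T * y * T - s • (T * T) := by
      rw [hk, mul_sub, sub_mul, mul_smul_comm, mul_one, smul_mul_assoc]
    have hdec : k⁺ - k⁻ = k := CFC.posPart_sub_negPart k hks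
    have hpn : k⁺ * k⁻ = 0 := CFC.posPart_mul_negPart k
    have hnp : k⁻ * k⁺ = 0 := CFC.negPart_mul_posPart k
    have hps : IsSelfAdjoint k⁺ := (CFC.posPart_nonneg k).isSelfAdjoint
    have hns : IsSelfAdjoint k⁻ := (CFC.negPart_nonneg k).isSelfAdjoint
    have e1 : k * (k⁺ * k⁺) * k = (k⁺ * k⁺) * (k⁺ * k⁺) := by
      have h1 : k * k⁺ = k⁺ * k⁺ := by nth_rw 1 [← hdec]; rw [sub_mul, hnp, sub_zero]
      have h2 : k⁺ * k = k⁺ * k⁺ := by nth_rw 2 [← hdec]; rw [mul_sub, hpn, sub_zero]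
      rw [← mul_assoc, h1, mul_assoc, h2]
    have e2 : k * (k⁻ * k⁻) * k = (k⁻ * k⁻) * (k⁻ * k⁻) := by
      have h1 : k * k⁻ = -(k⁻ * k⁻) := by nth_rw 1 [← hdec]; rw [sub_mul, hpn, zero_sub]
      have h2 : k⁻ * k = -(k⁻ * k⁻) := by nth_rw 2 [← hdec]; rw [mul_sub, hnp, zero_sub]
      rw [← mul_assoc, h1, mul_assoc, h2, neg_mul_neg]
    have h4 (x : A) : T * ((y - s • 1) * T * (x * x) * T * (y - s • 1)) * T = k * (x * x) * k := by
      rw [hk]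
      noncomm_ring
    have hsa2 {x : A} (hx : IsSelfAdjoint x) : IsSelfAdjoint (x * x) := by
      rw [isSelfAdjoint_iff, star_mul, hx.star_eq]
    by_contra! hcon2
    have hp0 : k⁺ ≠ 0 := fun h0 => hcon2.1 <| by
      rw [← sub_nonpos, ← hkeq, ← hdec, h0, zero_sub, neg_nonpos]
      exact CFC.negPart_nonneg k
    have hn0 : k⁻ ≠ 0 := fun h0 => hcon2.2 <| by
      rw [← sub_nonneg, ← hkeq, ← hdec, h0, sub_zero]
      exact CFC.posPart_nonneg k
    refine hcon ((y - s • 1) * T * (k⁺ * k⁺) * T * (y - s • 1))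
      ((y - s • 1) * T * (k⁻ * k⁻) * T * (y - s • 1)) ?_ ?_ ?_ ?_ ?_
    all_goals simp only [h4, e1, e2]
    · exact hsa2 (hsa2 hps)
    · exact hsa2 (hsa2 hns)
    · exact mul_self_ne_zero_of_isSelfAdjoint (hsa2 hps) (mul_self_ne_zero_of_isSelfAdjoint hps hp0)
    · exact mul_self_ne_zero_of_isSelfAdjoint (hsa2 hns) (mul_self_ne_zero_of_isSelfAdjoint hns hn0)
    · have : k⁺ * k⁺ * (k⁺ * k⁺) * (k⁻ * k⁻ * (k⁻ * k⁻)) =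
          k⁺ * k⁺ * k⁺ * (k⁺ * k⁻) * (k⁻ * k⁻ * k⁻) := by noncomm_ring
      rw [this, hpn, mul_zero, zero_mul]
  have hprop' (y : A) : ∃ s : ℂ, T * y * T = s • (T * T) := by
    obtain ⟨a, ha⟩ := hprop (realPart y) (realPart y).2
    obtain ⟨b, hb⟩ := hprop (imaginaryPart y) (imaginaryPart y).2
    refine ⟨a + Complex.I * b, ?_⟩
    conv_lhs => rw [← realPart_add_I_smul_imaginaryPart y]
    rw [mul_add, add_mul, mul_smul_comm, smul_mul_assoc, ha, hb, add_smul, mul_smul]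
    simp only [Complex.coe_smul]
  obtain ⟨a, ha⟩ := hprop' y
  obtain ⟨b, hb⟩ := hprop' z
  exact h (by rw [ha, hb]; exact ((Commute.refl (T * T)).smul_left a).smul_right b)

/-- A simple C⋆-algebra that is not of type I allows halving: below each nonzero positive element
there are two orthogonal copies of a nonzero positive element. -/
theorem IsSimple.exists_add_self_le (hA : IsSimple A) (htypeI : ¬ IsTypeI A) {t : A}
    (ht : IsPosElem t) (ht0 : t ≠ 0) : ∃ (x : A) (hx : IsPosElem x), x ≠ 0 ∧
      W.mk (PosMat.single x hx) + W.mk (PosMat.single x hx) ≤ W.mk (PosMat.single t ht) := by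
  have htn : 0 ≤ t := isPosElem_iff_nonneg.1 ht
  obtain ⟨T, hTn, hTt⟩ : ∃ T : A, 0 ≤ T ∧ T * T = t :=
    ⟨CFC.sqrt t, CFC.sqrt_nonneg t, CFC.sqrt_mul_sqrt_self t⟩
  have hTs : star T = T := hTn.isSelfAdjoint.star_eq
  have hT0 : T ≠ 0 := fun h => ht0 (by rw [← hTt, h, mul_zero])
  obtain ⟨y, z, hyz⟩ := hA.exists_not_commute htypeI hT0 (isPosElem_iff_nonneg.2 hTn)
  obtain ⟨p, q, hE, hF, hE0, hF0, hEF⟩ := exists_orthogonal_of_not_commute hTn hyz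
  obtain ⟨r, hr⟩ := hA.exists_mul_mul_ne_zero hE0 hF0
  obtain ⟨E, hEdef⟩ : ∃ E, E = T * p * T := ⟨_, rfl⟩
  obtain ⟨F, hFdef⟩ : ∃ F, F = T * q * T := ⟨_, rfl⟩
  rw [← hEdef] at hE hE0 hEF hr
  rw [← hFdef] at hF hF0 hEF hr
  obtain ⟨w, hw⟩ : ∃ w, w = E * r * F := ⟨_, rfl⟩
  rw [← hw] at hr
  obtain ⟨g, hg⟩ : ∃ g, g = star w * w := ⟨_, rfl⟩
  have hgn : 0 ≤ g := hg ▸ star_mul_self_nonneg w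
  have hgs : IsSelfAdjoint g := hgn.isSelfAdjoint
  have hg0 : g ≠ 0 := fun h => hr (by rwa [hg, CStarRing.star_mul_self_eq_zero_iff] at h)
  obtain ⟨s, hsn, hss⟩ : ∃ s : A, 0 ≤ s ∧ s * s = g :=
    ⟨CFC.sqrt g, CFC.sqrt_nonneg g, CFC.sqrt_mul_sqrt_self g⟩
  have hssa : star s = s := hsn.isSelfAdjoint.star_eq
  have hws : star w = F * star r * E := by
    rw [hw, star_mul, star_mul, hE.star_eq, hF.star_eq, mul_assoc]
  -- `a T = g w⋆` and `b T = g^(3/2)` lie in `A E` and `A F`, so they are orthogonal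
  obtain ⟨a, ha⟩ : ∃ a, a = g * (F * star r) * (T * p) := ⟨_, rfl⟩
  obtain ⟨b, hb⟩ : ∃ b, b = s * (F * star r * E * (E * r)) * (T * q) := ⟨_, rfl⟩
  have haT : a * T = g * star w := by
    rw [ha, hws, hEdef]
    noncomm_ring
  have haT' : a * T = g * (F * star r) * E := by rw [haT, hws]; noncomm_ring
  have hbT : b * T = s * g := by
    have h1 : b * T = s * (F * star r * E * (E * r)) * (T * q * T) := by
      rw [hb]
      noncomm_ring
    rw [h1, ← hFdef, hg, hws, hw]
    noncomm_ring
  have hbT' : b * T = s * (F * star r * E * (E * r)) * F := by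
    rw [hb, hFdef]
    noncomm_ring
  have hmul (x y : A) : x * t * star y = (x * T) * star (y * T) := by
    rw [star_mul, hTs, ← hTt]
    noncomm_ring
  have hFE : F * E = 0 := by
    rw [← star_inj, star_mul, hE.star_eq, hF.star_eq, hEF, star_zero]
  have hab : a * t * star b = 0 := by
    rw [hmul, haT', hbT', star_mul, hF.star_eq, mul_assoc, ← mul_assoc E, hEF, zero_mul, mul_zero]
  have hba : b * t * star a = 0 := by
    rw [hmul, haT', hbT', star_mul, hE.star_eq, mul_assoc, ← mul_assoc F, hFE, zero_mul, mul_zero]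
  have haa : a * t * star a = g * g * g := by
    rw [hmul, haT, star_mul, star_star, hgs.star_eq]
    have h1 : g * star w * (w * g) = g * (star w * w) * g := by noncomm_ring
    rw [h1, ← hg]
  have hbb : b * t * star b = g * g * g := by
    have hsg : s * g = g * s := by rw [← hss, mul_assoc]
    rw [hmul, hbT, star_mul, hgs.star_eq, hssa, ← mul_assoc, hsg, mul_assoc, mul_assoc,
      ← mul_assoc s, hsg, mul_assoc, hss, mul_assoc]
  refine ⟨g * g * g, haa ▸ ht.conj a, ?_, ?_⟩
  · intro h0
    refine mul_self_ne_zero_of_isSelfAdjoint (e := g * g) ?_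
      (mul_self_ne_zero_of_isSelfAdjoint hgs hg0) (by rw [← mul_assoc, h0, zero_mul])
    rw [isSelfAdjoint_iff, star_mul, hgs.star_eq]
  · rw [W.add_le_mk_iff]
    have := subeq_fromBlocks_of_mul_eq_zero hab hba
    rwa [haa, hbb] at this

/-- Iterated halving: below each nonzero positive element there are `n` orthogonal copies of a
nonzero positive element. -/
theorem IsSimple.exists_nsmul_le (hA : IsSimple A) (htypeI : ¬ IsTypeI A) {t : A}
    (ht : IsPosElem t) (ht0 : t ≠ 0) (n : ℕ) : ∃ (x : A) (hx : IsPosElem x), x ≠ 0 ∧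
      n • W.mk (PosMat.single x hx) ≤ W.mk (PosMat.single t ht) := by
  -- `n + 1` in place of `n` lets the induction start with a single copy
  suffices h : ∃ (x : A) (hx : IsPosElem x), x ≠ 0 ∧
      (n + 1) • W.mk (PosMat.single x hx) ≤ W.mk (PosMat.single t ht) by
    obtain ⟨x, hx, hx0, h⟩ := h
    exact ⟨x, hx, hx0, (nsmul_le_nsmul_left (W.zero_le _) n.le_succ).trans h⟩
  induction n generalizing t with
  | zero => exact ⟨t, ht, ht0, by rw [zero_add, one_nsmul]⟩
  | succ n ih =>
    obtain ⟨s, hs, hs0, hst⟩ := hA.exists_add_self_le htypeI ht ht0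
    obtain ⟨x, hx, hx0, hxs⟩ := ih hs hs0
    refine ⟨x, hx, hx0, ?_⟩
    rw [succ_nsmul]
    refine (add_le_add hxs (le_trans ?_ hxs)).trans hst
    calc W.mk (PosMat.single x hx) = 1 • W.mk (PosMat.single x hx) := (one_nsmul _).symm
      _ ≤ _ := nsmul_le_nsmul_left (W.zero_le _) (by omega)

end Simple

/-! ### Classes of the unit in simple and in stably finite algebras -/

section Finite

open scoped Pointwise

variable {A : Type u} [CStarAlgebra A] [PartialOrder A] [StarOrderedRing A]

omit [PartialOrder A] [StarOrderedRing A] in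
theorem isPosElem_one : IsPosElem (1 : A) := ⟨1, by simp⟩

omit [PartialOrder A] [StarOrderedRing A] in
theorem IsPosElem.list_sum {t : A} (ht : IsPosElem t) (l : List A) :
    IsPosElem (l.map fun y => y * t * star y).sum := by
  induction l with
  | nil => exact ⟨0, by simp⟩
  | cons y l ih =>
    rw [List.map_cons, List.sum_cons]
    exact (ht.conj y).add ih

omit [PartialOrder A] [StarOrderedRing A] in
theorem W.mk_single_list_sum_le {t : A} (ht : IsPosElem t) (l : List A) :
    W.mk (PosMat.single _ (ht.list_sum l)) ≤ l.length • W.mk (PosMat.single t ht) := by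
  induction l with
  | nil =>
    rw [List.length_nil, zero_nsmul]
    exact (W.mk_single_zero _).le
  | cons y l ih =>
    rw [List.length_cons, succ_nsmul']
    refine le_trans ?_ (add_le_add_right ih _)
    rw [W.mk_le_add_iff]
    have := subeq_add_fromBlocks t (l.map fun y => y * t * star y).sum y 1
    rw [one_mul, star_one, mul_one] at this
    exact this

/-- In a simple unital C⋆-algebra the unit lies below a multiple of each nonzero positive
element. -/
theorem IsSimple.exists_mk_one_le_nsmul (hA : IsSimple A) {t : A} (ht : IsPosElem t)
    (ht0 : t ≠ 0) : ∃ n : ℕ,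
      W.mk (PosMat.single 1 isPosElem_one) ≤ n • W.mk (PosMat.single t ht) := by
  have htn : 0 ≤ t := isPosElem_iff_nonneg.1 ht
  -- the ideal generated by `t` is dense, so it contains an invertible element
  have h1 : (1 : A) ∈ TwoSidedIdeal.span {t} := by
    let J := TwoSidedIdeal.span {t}
    let I : TwoSidedIdeal A := TwoSidedIdeal.mk' (closure (J : Set A))
      (subset_closure J.zero_mem)
      (fun hx hy => map_mem_closure₂ continuous_add hx hy fun _ hx _ hy => J.add_mem hx hy)
      (fun hx => map_mem_closure continuous_neg hx fun _ hx => J.neg_mem hx)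
      (fun {x y} hy => map_mem_closure (continuous_const_mul x) hy
        fun _ hy => J.mul_mem_left _ _ hy)
      (fun {x y} hx => map_mem_closure (f := fun x => x * y)
        (continuous_mul_const y) hx fun _ hx => J.mul_mem_right _ _ hx)
    have hI (r : A) : r ∈ I ↔ r ∈ closure (J : Set A) := TwoSidedIdeal.mem_mk' _ _ _ _ _ _ _
    have hcl : IsClosed (I : Set A) := by
      have : (I : Set A) = closure (J : Set A) := by
        ext r
        simp [hI]
      rw [this]
      exact isClosed_closure
    have htJ : t ∈ J := TwoSidedIdeal.subset_span rfl
    rcases hA.eq_bot_or_eq_top I hcl with h0 | h1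
    · have : t ∈ I := (hI t).2 (subset_closure htJ)
      rw [h0, TwoSidedIdeal.mem_bot] at this
      exact absurd this ht0
    · have : (1 : A) ∈ closure (J : Set A) := (hI 1).1 (by rw [h1]; trivial)
      obtain ⟨s, hs, hs1⟩ := Metric.mem_closure_iff.1 this 1 one_pos
      rw [dist_eq_norm] at hs1
      obtain ⟨v, hv⟩ : IsUnit s := by
        have := isUnit_one_sub_of_norm_lt_one hs1
        rwa [sub_sub_cancel] at this
      have h2 := J.mul_mem_right s (↑v⁻¹ : A) hs
      rwa [← hv, v.mul_inv] at h2
  rw [TwoSidedIdeal.mem_span_iff_mem_addSubgroup_closure] at h1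
  -- polarization: `a t b + (a t b)⋆ ≤ (a + b⋆) t (a + b⋆)⋆`
  have hP (z : A) (hz : z ∈ AddSubgroup.closure (Set.univ * {t} * Set.univ : Set A)) :
      (∃ l : List A, z + star z ≤ (l.map fun y => y * t * star y).sum) ∧
      ∃ l : List A, -z + star (-z) ≤ (l.map fun y => y * t * star y).sum := by
    have hgen (a b : A) : a * t * b + star (a * t * b) ≤
        ([a + star b].map fun y => y * t * star y).sum := by
      have h2 : (a + star b) * t * star (a + star b) - (a * t * b + star (a * t * b)) =
          a * t * star a + star b * t * star (star b) := by
        rw [star_mul, star_mul, htn.isSelfAdjoint.star_eq, star_add, star_star]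
        noncomm_ring
      rw [List.map_singleton, List.sum_singleton, ← sub_nonneg, h2]
      exact add_nonneg (star_right_conjugate_nonneg htn a)
        (star_right_conjugate_nonneg htn (star b))
    induction hz using AddSubgroup.closure_induction with
    | mem z hz =>
      obtain ⟨_, ⟨a, -, _, ht', rfl⟩, b, -, rfl⟩ := hz
      rw [Set.mem_singleton_iff] at ht'
      subst ht'
      refine ⟨⟨_, hgen a b⟩, [-a + star b], ?_⟩
      have := hgen (-a) b
      simpa only [neg_mul] using this
    | zero => exact ⟨⟨[], by simp⟩, [], by simp⟩
    | add x y _ _ hx hy =>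
      obtain ⟨⟨l1, h1⟩, l2, h2⟩ := hx
      obtain ⟨⟨l3, h3⟩, l4, h4⟩ := hy
      refine ⟨⟨l1 ++ l3, ?_⟩, l2 ++ l4, ?_⟩
      · rw [List.map_append, List.sum_append, star_add]
        calc _ = x + star x + (y + star y) := by abel
          _ ≤ _ := add_le_add h1 h3
      · rw [List.map_append, List.sum_append, neg_add, star_add]
        calc _ = -x + star (-x) + (-y + star (-y)) := by abel
          _ ≤ _ := add_le_add h2 h4
    | neg x _ hx => exact ⟨hx.2, by rw [neg_neg]; exact hx.1⟩
  obtain ⟨⟨l, hl⟩, -⟩ := hP 1 h1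
  refine ⟨l.length, le_trans ?_ (W.mk_single_list_sum_le ht l)⟩
  suffices h : ∀ S : A, 1 + star 1 ≤ S → SubeqElem 1 S from h _ hl
  intro S hl
  have h1S : 1 ≤ S := by
    refine le_trans ?_ hl
    rw [star_one]
    exact le_add_of_nonneg_left zero_le_one
  have hSn : 0 ≤ S := zero_le_one.trans h1S
  have hSu : IsUnit S := CStarAlgebra.isUnit_of_le 1 h1S
  have hr : IsUnit (CFC.sqrt S) := by
    have h2 := CFC.sqrt_mul_sqrt_self S
    rw [← h2, (Commute.refl _).isUnit_mul_iff] at hSu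
    exact hSu.1
  obtain ⟨u, hu⟩ := hr
  have hus : star (u : A) = u := by
    rw [hu]
    exact (CFC.sqrt_nonneg S).isSelfAdjoint.star_eq
  have hus' : star (↑u⁻¹ : A) = ↑u⁻¹ := by
    rw [← Units.coe_star_inv, inv_inj.2 (Units.ext hus : star u = u)]
  refine SubeqElem.of_eq (↑u⁻¹ : A) ?_
  rw [hus', ← CFC.sqrt_mul_sqrt_self S, ← hu, ← mul_assoc, u.inv_mul, one_mul, u.mul_inv]

omit [PartialOrder A] [StarOrderedRing A] in
/-- In a stably finite C⋆-algebra, `n + 1` copies of the unit do not fit into `n` copies. -/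
theorem IsStablyFinite.not_succ_nsmul_le (hA : IsStablyFinite A) [Nontrivial A] (n : ℕ) :
    ¬ (n + 1) • W.mk (PosMat.single (1 : A) isPosElem_one) ≤
      n • W.mk (PosMat.single (1 : A) isPosElem_one) := by
  intro h
  rw [W.nsmul_mk_single, W.nsmul_mk_single] at h
  have hone (n : ℕ) : (diagonal fun _ : Fin n => (1 : A)) = 1 := diagonal_one
  have h' : Subeq (diagonal fun _ : Fin (n + 1) => (1 : A)) (diagonal fun _ : Fin n => (1 : A)) := h
  rw [hone, hone] at h'
  obtain ⟨y, hy⟩ := h'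
  obtain ⟨-, z, hz⟩ := exists_conj_eq_of_tendsto (b := fun _ => 1) hy (mul_one 1)
    conjTranspose_one fun _ => conjTranspose_one
  rw [Matrix.mul_one] at hz
  have h1 : (1 : Matrix (Fin (n + 1)) (Fin (n + 1)) A) =
      Stab.padMat (n + 1) (1 : Matrix (Fin (n + 1)) (Fin (n + 1)) A) := by
    ext i j
    rw [Stab.padMat, dif_pos ⟨i.2, j.2⟩]
  have h2 := hA (n + 1) (Stab.padMat (n + 1) z)ᴴ (by
    rw [conjTranspose_conjTranspose, Stab.padMat_conjTranspose, Stab.padMat_mul n.le_succ, hz,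
      ← h1])
  rw [conjTranspose_conjTranspose, Stab.padMat_conjTranspose, Stab.padMat_mul le_rfl] at h2
  have h3 := congrFun (congrFun h2 (Fin.last n)) (Fin.last n)
  simp [Stab.padMat] at h3

/-- The map `W(A) → Cu(A)` induced by the inclusion of `M_∞(A)` in `K ⊗ A`. -/
noncomputable def W.toCu : W A →+ Cu A where
  toFun := Quotient.lift PosMat.cuClass fun a b h =>
    le_antisymm (PosMat.cuClass_le_iff.2 h.1) (PosMat.cuClass_le_iff.2 h.2)
  map_zero' := by
    have h0 : Stab.of 0 (CStarMatrix.ofMatrix (0 : PosMat A).mat) = 0 :=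
      Stab.ofMat_zero (n := 0)
    refine Eq.trans ?_ (W.mk_single_zero ⟨0, by simp⟩)
    have key (x : Stab A) (hx : IsPosElem x) (h : x = 0) :
        W.mk (PosMat.single x hx) = W.mk (PosMat.single 0 ⟨0, by simp⟩) := by
      subst h
      rfl
    exact key _ (PosMat.isPosElem_of 0) h0
  map_add' x y := by
    induction x using W.ind with | h a
    induction y using W.ind with | h b
    exact PosMat.cuClass_add a b

theorem W.toCu_mk (a : PosMat A) : W.toCu (W.mk a) = a.cuClass := rfl

theorem W.toCu_le_toCu {x y : W A} : W.toCu x ≤ W.toCu y ↔ x ≤ y := by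
  induction x using W.ind with | h a
  induction y using W.ind with | h b
  exact PosMat.cuClass_le_iff

end Finite

/-! ### Classes of projections in `Cu(A)` -/

section Compact

variable {A : Type u} [CStarAlgebra A] [PartialOrder A] [StarOrderedRing A]

theorem Stab.isPosElem_unit (n : ℕ) : IsPosElem (unit A n) :=
  ⟨unit A n, by rw [star_unit, unit_mul_unit]⟩

theorem W.mk_single_unit (n : ℕ) : W.mk (PosMat.single (Stab.unit A n) (Stab.isPosElem_unit n)) =
    W.toCu (n • W.mk (PosMat.single (1 : A) isPosElem_one)) := by
  rw [W.nsmul_mk_single, W.toCu_mk]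
  rfl

/-- The class of a projection lies below a multiple of the class of the unit of `A`. -/
theorem exists_mk_le_toCu_of_isProjection (q : PosMat (Stab A)) (hqq : q.mat * q.mat = q.mat)
    (hqs : q.matᴴ = q.mat) :
    ∃ n : ℕ, W.mk q ≤ W.toCu (n • W.mk (PosMat.single (1 : A) isPosElem_one)) := by
  obtain ⟨n, z, hz⟩ := exists_conj_diagonal_eq_of_tendsto
    (Stab.tendsto_mul_unit (A := A)) hqq hqs
    (fun _ => Stab.star_unit)
  have h1 := W.mk_le_nsmul_mk_single (Stab.isPosElem_unit n) (z := z) hz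
  refine ⟨q.size * n, h1.trans_eq ?_⟩
  rw [W.mk_single_unit, ← map_nsmul, mul_nsmul']

/-- In the simple stably finite case, a projection absorbs no nonzero positive element. -/
theorem not_mk_add_mk_single_le_of_isProjection (hfin : IsStablyFinite A) (hA : IsSimple A)
    (q : PosMat (Stab A)) (hqq : q.mat * q.mat = q.mat) (hqs : q.matᴴ = q.mat) {x : Stab A}
    (hx : IsPosElem x) (hx0 : x ≠ 0) : ¬ W.mk q + W.mk (PosMat.single x hx) ≤ W.mk q := by
  intro h
  have := hA.nontrivial
  -- `q` would absorb all multiples of `x`, so a multiple of the class of `1` would absorb one more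
  have hj (j : ℕ) : W.mk q + j • W.mk (PosMat.single x hx) ≤ W.mk q := by
    induction j with
    | zero => rw [zero_nsmul, add_zero]
    | succ j ih =>
      rw [succ_nsmul, ← add_assoc]
      exact (add_le_add_left ih _).trans h
  obtain ⟨t, ht, ht0, htx⟩ := Stab.exists_subeqElem_ofMat_one hx hx0
  have htx' : W.toCu (W.mk (PosMat.single t ht)) ≤ W.mk (PosMat.single x hx) := htx
  obtain ⟨M, hM⟩ := hA.exists_mk_one_le_nsmul ht ht0
  obtain ⟨n, hn⟩ := exists_mk_le_toCu_of_isProjection q hqq hqs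
  refine hfin.not_succ_nsmul_le n (W.toCu_le_toCu.1 (le_trans ?_ hn))
  calc _ ≤ W.toCu ((n + 1) • M • W.mk (PosMat.single t ht)) :=
        W.toCu_le_toCu.2 (nsmul_le_nsmul_right hM _)
    _ = ((n + 1) * M) • W.toCu (W.mk (PosMat.single t ht)) := by
        rw [← mul_nsmul', map_nsmul]
    _ ≤ ((n + 1) * M) • W.mk (PosMat.single x hx) := nsmul_le_nsmul_right htx' _
    _ ≤ W.mk q + ((n + 1) * M) • W.mk (PosMat.single x hx) :=
        le_add_of_nonneg_left (W.zero_le _)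
    _ ≤ _ := hj _

end Compact

/-! ### Splitting of soft elements -/

section Soft

variable {D : Type u} [NonUnitalCStarAlgebra D]

theorem continuous_conj_fromBlocks {m : Type*} (z : Matrix m (Fin 1 ⊕ Fin 1) D) (b : D) :
    Continuous fun d : D => z * fromBlocks !![d] 0 0 !![b] * zᴴ := by
  have h : Continuous fun d : D => (fromBlocks !![d] 0 0 !![b] :
      Matrix (Fin 1 ⊕ Fin 1) (Fin 1 ⊕ Fin 1) D) := by
    refine Continuous.matrix_fromBlocks ?_ continuous_const continuous_const continuous_const
    refine continuous_pi fun i => continuous_pi fun j => ?_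
    fin_cases i
    fin_cases j
    exact continuous_id
  fun_prop

theorem cfcₙ_mul₃ {b : D} (hb : IsSelfAdjoint b) {f g : ℝ → ℝ} (hf : Continuous f)
    (hf0 : f 0 = 0) (hg : Continuous g) (hg0 : g 0 = 0) :
    cfcₙ f b * b * cfcₙ g b = cfcₙ (fun t => f t * t * g t) b := by
  rw [cfcₙ_mul (fun t => f t * t) g b (by fun_prop) (by simp) hg.continuousOn hg0,
    cfcₙ_mul f (fun t => t) b hf.continuousOn hf0 continuousOn_id rfl, cfcₙ_id' ℝ b]

theorem isPosElem_of_isStarProjection {e : D} (he : IsStarProjection e) : IsPosElem e :=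
  ⟨e, by rw [he.isSelfAdjoint.star_eq, he.isIdempotentElem]⟩

/-- A positive element whose spectrum has a gap above `0` has the class of a projection. -/
theorem exists_mk_eq_mk_of_gap {b : D} (hb : IsPosElem b) {δ : ℝ} (hδ : 0 < δ)
    (hgap : ∀ t ∈ quasispectrum ℝ b, t = 0 ∨ δ ≤ t) :
    ∃ (e : D) (he : IsStarProjection e), W.mk (PosMat.single b hb) =
      W.mk (PosMat.single e (isPosElem_of_isStarProjection he)) := by
  have hbs : IsSelfAdjoint b := by
    obtain ⟨y, rfl⟩ := hb
    exact .star_mul_self y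
  let χ : ℝ → ℝ := fun t => min 1 (max 0 t / δ)
  have hχc : Continuous χ := by fun_prop
  have hχ0 : χ 0 = 0 := by simp [χ]
  have hχ1 {t : ℝ} (h : δ ≤ t) : χ t = 1 := by
    refine min_eq_left ?_
    rw [max_eq_right (hδ.le.trans h), le_div_iff₀ hδ, one_mul]
    exact h
  let R : ℝ → ℝ := fun t => (√(max t δ))⁻¹ * χ t
  have hRc : Continuous R := by
    refine Continuous.mul (Continuous.inv₀ (by fun_prop) fun t => ?_) hχc
    exact (Real.sqrt_pos.2 (lt_max_of_lt_right hδ)).ne'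
  have hR0 : R 0 = 0 := by simp [R, hχ0]
  have he : IsStarProjection (cfcₙ χ b) := by
    refine ⟨?_, cfcₙ_predicate χ b⟩
    rw [IsIdempotentElem, ← cfcₙ_mul χ χ b hχc.continuousOn hχ0 hχc.continuousOn hχ0]
    refine cfcₙ_congr fun t ht => ?_
    rcases hgap t ht with rfl | h
    · simp [hχ0]
    · simp [hχ1 h]
  refine ⟨cfcₙ χ b, he, W.mk_eq_mk.2 ⟨?_, ?_⟩⟩
  · refine SubeqElem.of_eq (cfcₙ Real.sqrt b) ?_
    have hs : star (cfcₙ Real.sqrt b) = cfcₙ Real.sqrt b := (cfcₙ_predicate Real.sqrt b).star_eq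
    have hsc : ContinuousOn Real.sqrt (quasispectrum ℝ b) := Real.continuous_sqrt.continuousOn
    rw [hs, ← cfcₙ_mul Real.sqrt χ b hsc Real.sqrt_zero hχc.continuousOn hχ0,
      ← cfcₙ_mul (fun t => √t * χ t) Real.sqrt b (hsc.mul hχc.continuousOn) (by simp) hsc
        Real.sqrt_zero]
    conv_rhs => rw [← cfcₙ_id' ℝ b]
    refine cfcₙ_congr fun t ht => ?_
    rcases hgap t ht with rfl | h
    · simp
    · simp only [hχ1 h, mul_one]
      exact Real.mul_self_sqrt (hδ.le.trans h)
  · refine SubeqElem.of_eq (cfcₙ R b) ?_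
    have hs : star (cfcₙ R b) = cfcₙ R b := (cfcₙ_predicate R b).star_eq
    rw [hs, cfcₙ_mul₃ hbs hRc hR0 hRc hR0]
    refine cfcₙ_congr fun t ht => ?_
    rcases hgap t ht with rfl | h
    · simp [hχ0]
    · have ht0 : 0 < t := hδ.trans_le h
      simp only [R, hχ1 h, max_eq_left h, mul_one]
      have h1 : √t ≠ 0 := (Real.sqrt_pos.2 ht0).ne'
      nth_rw 2 [← Real.mul_self_sqrt ht0.le]
      field_simp

/-- A soft element `b` splits: up to a small error, there is room left below `b` for a nonzero
positive element. -/
theorem exists_mk_add_mk_le_of_mem_softPart {b : D} (hb : IsPosElem b) (hsoft : b ∈ softPart D)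
    {η : ℝ} (hη : 0 < η) : ∃ (d x : D) (hd : IsPosElem d) (hx : IsPosElem x), ‖d - b‖ < η ∧ x ≠ 0 ∧
      W.mk (PosMat.single d hd) + W.mk (PosMat.single x hx) ≤ W.mk (PosMat.single b hb) := by
  let : PartialOrder D := CStarAlgebra.spectralOrder D
  have : StarOrderedRing D := CStarAlgebra.spectralOrderedRing D
  have hbn : 0 ≤ b := isPosElem_iff_nonneg.1 hb
  have hbs : IsSelfAdjoint b := hbn.isSelfAdjoint
  have hspec (t : ℝ) (ht : t ∈ quasispectrum ℝ b) : 0 ≤ t :=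
    quasispectrum_nonneg_of_nonneg b hbn t ht
  obtain ⟨δ, hδ, hδη⟩ : ∃ δ : ℝ, 0 < δ ∧ 2 * δ < η := ⟨η / 3, by positivity, by linarith⟩
  -- `P` cuts off `(0, δ)`, and `Q` is supported there
  let P : ℝ → ℝ := fun t => min 1 (max 0 (t - δ) / δ)
  let Q : ℝ → ℝ := fun t => max 0 (min t (δ - t))
  have hPc : Continuous P := by fun_prop
  have hQc : Continuous Q := by fun_prop
  have hP0 : P 0 = 0 := by simp [P, hδ.le]
  have hQ0 : Q 0 = 0 := by simp [Q, hδ.le]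
  have hPQ (t : ℝ) : P t = 0 ∨ Q t = 0 := by
    rcases le_total t δ with h | h
    · left
      simp [P, h]
    · right
      simp only [Q]
      exact max_eq_left (min_le_of_right_le (by linarith))
  have hPs : star (cfcₙ P b) = cfcₙ P b := (cfcₙ_predicate P b).star_eq
  have hQs : star (cfcₙ Q b) = cfcₙ Q b := (cfcₙ_predicate Q b).star_eq
  have h1 : cfcₙ P b * b * star (cfcₙ Q b) = 0 := by
    rw [hQs, cfcₙ_mul₃ hbs hPc hP0 hQc hQ0, ← cfcₙ_const_zero ℝ b]
    refine cfcₙ_congr fun t _ => ?_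
    rcases hPQ t with h | h <;> simp [h]
  have h2 : cfcₙ Q b * b * star (cfcₙ P b) = 0 := by
    rw [hPs, cfcₙ_mul₃ hbs hQc hQ0 hPc hP0, ← cfcₙ_const_zero ℝ b]
    refine cfcₙ_congr fun t _ => ?_
    rcases hPQ t with h | h <;> simp [h]
  refine ⟨_, _, hb.conj (cfcₙ P b), hb.conj (cfcₙ Q b), ?_, ?_, ?_⟩
  · refine lt_of_le_of_lt ?_ hδη
    rw [hPs, cfcₙ_mul₃ hbs hPc hP0 hPc hP0]
    nth_rw 2 [← cfcₙ_id' ℝ b]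
    rw [← cfcₙ_sub (fun t => P t * t * P t) (fun t => t) b (by fun_prop) (by simp) (by fun_prop)
      rfl]
    refine norm_cfcₙ_le fun t ht => ?_
    have ht0 := hspec t ht
    have hP1 : P t ≤ 1 := min_le_left _ _
    have hPn : 0 ≤ P t := le_min zero_le_one (by positivity)
    rw [Real.norm_eq_abs, abs_le]
    rcases le_total t (2 * δ) with h | h
    · have h3 : P t * t * P t ≤ 1 * t * 1 := by gcongr
      have h4 : 0 ≤ P t * t * P t := by positivity
      constructor <;> linarith
    · have h3 : P t = 1 := by
        refine min_eq_left ?_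
        rw [le_div_iff₀ hδ]
        exact le_max_of_le_right (by linarith)
      rw [h3]
      constructor <;> linarith
  · intro h0
    rw [hQs, cfcₙ_mul₃ hbs hQc hQ0 hQc hQ0, ← cfcₙ_const_zero ℝ b] at h0
    have h3 := (cfcₙ_eq_cfcₙ_iff_eqOn (a := b) (f := fun t => Q t * t * Q t) (g := fun _ => 0)
      hbs (by fun_prop) (by simp) (by fun_prop) rfl).1 h0
    obtain ⟨e, he, heq⟩ := exists_mk_eq_mk_of_gap hb hδ fun t ht => by
      by_contra! hcon
      have ht0 : 0 < t := lt_of_le_of_ne (hspec t ht) hcon.1.symm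
      have h4 : 0 < Q t := lt_max_of_lt_right (lt_min ht0 (by linarith [hcon.2]))
      have h5 : Q t * t * Q t = 0 := h3 ht
      have : 0 < Q t * t * Q t := by positivity
      linarith
    refine hsoft.2 ⟨_, ?_, ?_, heq⟩
    · ext i j
      fin_cases i
      fin_cases j
      have h6 : (!![e] * !![e] : Matrix (Fin 1) (Fin 1) D) 0 0 = e := by
        simpa [Matrix.mul_apply] using he.isIdempotentElem.eq
      exact h6
    · ext i j
      fin_cases i
      fin_cases j
      simpa [PosMat.single] using he.isSelfAdjoint.star_eq
  · rw [W.add_le_mk_iff]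
    exact subeq_fromBlocks_of_mul_eq_zero h1 h2

end Soft

/-! ### Sums of soft classes -/

section SoftCu

variable {A : Type u} [CStarAlgebra A] [PartialOrder A] [StarOrderedRing A]

/-- In the simple stably finite case, soft elements absorb all classes under addition. -/
theorem add_mem_softCu (hfin : IsStablyFinite A) (hA : IsSimple A) {a b : Stab A}
    (ha : IsPosElem a) (hsoft : a ∈ softPart (Stab A)) (hb : IsPosElem b) :
    W.mk (PosMat.single a ha) + W.mk (PosMat.single b hb) ∈ softCu A := by
  obtain ⟨c, hc, hceq⟩ := Stab.exists_mk_single_eq_add ha hb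
  refine ⟨c, hc, ⟨hc, ?_⟩, hceq.symm⟩
  rintro ⟨q, hqq, hqs, hq⟩
  rw [hceq] at hq
  have has : star a = a := by
    obtain ⟨y, rfl⟩ := ha
    simp
  have hbs : star b = b := by
    obtain ⟨y, rfl⟩ := hb
    simp
  -- a projection below `diag(a, b)` already lies below `diag(d, b)` for some `d` that leaves room
  -- for a nonzero `x` below `a`, so it would absorb `x`
  obtain ⟨y, hy⟩ := W.mk_le_add_iff.1 hq.ge
  have hsa {d : Stab A} (hd : star d = d) :
      (fromBlocks !![d] 0 0 !![b] : Matrix (Fin 1 ⊕ Fin 1) (Fin 1 ⊕ Fin 1) (Stab A))ᴴ =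
        fromBlocks !![d] 0 0 !![b] := by
    rw [fromBlocks_conjTranspose, conjTranspose_zero]
    congr 1 <;>
    · ext i j
      fin_cases i
      fin_cases j
      simp [hd, hbs]
  obtain ⟨-, z, hz⟩ := exists_conj_eq_of_tendsto (b := fun _ => fromBlocks !![a] 0 0 !![b])
    hy hqq hqs fun _ => hsa has
  have hsplit (k : ℕ) := exists_mk_add_mk_le_of_mem_softPart ha hsoft
    (show (0 : ℝ) < 1 / ((k : ℝ) + 1) by positivity)
  choose d x hd hx hda hx0 hle using hsplit
  have hds (k : ℕ) : star (d k) = d k := by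
    obtain ⟨y, hy⟩ := hd k
    rw [hy]
    simp
  have hlim : Tendsto d atTop (𝓝 a) := by
    rw [tendsto_iff_norm_sub_tendsto_zero]
    exact squeeze_zero (fun _ => norm_nonneg _) (fun k => (hda k).le)
      tendsto_one_div_add_atTop_nhds_zero_nat
  have hcont : Continuous fun d : Stab A => z * fromBlocks !![d] 0 0 !![b] * zᴴ :=
    continuous_conj_fromBlocks z b
  have hlim' := (hcont.tendsto a).comp hlim
  obtain ⟨k, w, hw⟩ := exists_conj_eq_of_tendsto (q := q.mat) (y := fun _ => z)
    (b := fun k => fromBlocks !![d k] 0 0 !![b]) (hz ▸ hlim') hqq hqs fun k => hsa (hds k)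
  have hq1 : W.mk q ≤ W.mk (PosMat.single (d k) (hd k)) + W.mk (PosMat.single b hb) :=
    W.mk_le_add_iff.2 (Subeq.of_eq w hw)
  refine not_mk_add_mk_single_le_of_isProjection hfin hA q hqq hqs (hx k) (hx0 k) ?_
  calc _ ≤ W.mk (PosMat.single (d k) (hd k)) + W.mk (PosMat.single b hb) +
        W.mk (PosMat.single (x k) (hx k)) := add_le_add_left hq1 _
    _ = W.mk (PosMat.single (d k) (hd k)) + W.mk (PosMat.single (x k) (hx k)) +
        W.mk (PosMat.single b hb) := add_right_comm _ _ _
    _ ≤ W.mk (PosMat.single a ha) + W.mk (PosMat.single b hb) := add_le_add_left (hle k) _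
    _ = W.mk q := hq

end SoftCu

/-! ### Covariance relations up to powers of a commuting element -/

section Algebra

/-- If `C`, `S g` satisfy the exact form of the relations of an approximately inner action, then the
elements `C² ∑ g, Y g S g` multiply like `∑ g, Y g u_g` in the crossed product, up to powers
of `C`. -/
theorem sum_conj_eq {M G : Type*} [Ring M] [Group G] [Fintype G] {C B : M} {S Y Y' β : G → M}
    {γ : G → G → M} (hCS : ∀ g, Commute C (S g)) (hS1 : S 1 = C)
    (hSS : ∀ g h, S g * S h = C * S (g * h)) (hCB : Commute C B) (hCY : ∀ g, Commute C (Y g))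
    (hCβ : ∀ g, Commute C (β g)) (hCγ : ∀ k h, Commute C (γ k h))
    (hβ : ∀ g, C * β g * C = S g * B * S g⁻¹) (hγ : ∀ k h, C * γ k h * C = S k * Y' h * S k⁻¹) :
    (C ^ 2 * ∑ g, Y g * S g) * B * ((∑ h, S h⁻¹ * Y' h) * C ^ 2) =
      ∑ k, (∑ h, Y (k * h) * β (k * h) * γ k h) * (C ^ 5 * S k) := by
  have hmove {g : G} {X X' : M} (hX' : Commute C X') (h : C * X' * C = S g * X * S g⁻¹) :
      S g * X * C ^ 2 = X' * C ^ 2 * S g := by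
    calc S g * X * C ^ 2 = S g * X * (C * S (g⁻¹ * g)) := by
          rw [inv_mul_cancel, hS1, pow_two]
      _ = S g * X * S g⁻¹ * S g := by rw [← hSS]; noncomm_ring
      _ = C * X' * C * S g := by rw [h]
      _ = _ := by rw [hX'.eq]; noncomm_ring
  have hterm (k h : G) : C ^ 2 * (Y (k * h) * S (k * h)) * B * (S h⁻¹ * Y' h * C ^ 2) =
      Y (k * h) * β (k * h) * γ k h * (C ^ 5 * S k) := by
    calc C ^ 2 * (Y (k * h) * S (k * h)) * B * (S h⁻¹ * Y' h * C ^ 2)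
        = (C ^ 2 * Y (k * h)) * S (k * h) * B * S h⁻¹ * Y' h * C ^ 2 := by noncomm_ring
      _ = Y (k * h) * (C ^ 2 * S (k * h)) * B * S h⁻¹ * Y' h * C ^ 2 := by
          rw [((hCY (k * h)).pow_left 2).eq]; noncomm_ring
      _ = Y (k * h) * S (k * h) * (C ^ 2 * B) * S h⁻¹ * Y' h * C ^ 2 := by
          rw [((hCS (k * h)).pow_left 2).eq]; noncomm_ring
      _ = Y (k * h) * (S (k * h) * B * C ^ 2) * S h⁻¹ * Y' h * C ^ 2 := by
          rw [(hCB.pow_left 2).eq]; noncomm_ring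
      _ = Y (k * h) * β (k * h) * C ^ 2 * (S (k * h) * S h⁻¹) * Y' h * C ^ 2 := by
          rw [hmove (hCβ (k * h)) (hβ (k * h))]; noncomm_ring
      _ = Y (k * h) * β (k * h) * C ^ 3 * (S k * Y' h * C ^ 2) := by
          rw [hSS, mul_inv_cancel_right]; noncomm_ring
      _ = Y (k * h) * β (k * h) * (C ^ 3 * γ k h) * C ^ 2 * S k := by
          rw [hmove (hCγ k h) (hγ k h)]; noncomm_ring
      _ = _ := by rw [((hCγ k h).pow_left 3).eq]; noncomm_ring
  calc (C ^ 2 * ∑ g, Y g * S g) * B * ((∑ h, S h⁻¹ * Y' h) * C ^ 2)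
      = ∑ h, ∑ g, C ^ 2 * (Y g * S g) * B * (S h⁻¹ * Y' h * C ^ 2) := by
        simp only [Finset.mul_sum, Finset.sum_mul]
    _ = ∑ h, ∑ k, C ^ 2 * (Y (k * h) * S (k * h)) * B * (S h⁻¹ * Y' h * C ^ 2) := by
        refine Finset.sum_congr rfl fun h _ => ?_
        exact (Fintype.sum_equiv (Equiv.mulRight h) _ _ fun k => rfl).symm
    _ = ∑ k, (∑ h, Y (k * h) * β (k * h) * γ k h) * (C ^ 5 * S k) := by
        rw [Finset.sum_comm]
        simp only [hterm, Finset.sum_mul]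

end Algebra

/-! ### Bounded sequences modulo null sequences -/

section Sequences

variable (A : Type u) [NormedRing A]

/-- The ring of bounded sequences in `A`. -/
def boundedSeq : Subring (ℕ → A) where
  carrier := {u | ∃ C, ∀ n, ‖u n‖ ≤ C}
  zero_mem' := ⟨0, by simp⟩
  one_mem' := ⟨‖(1 : A)‖, fun _ => le_rfl⟩
  add_mem' := by
    rintro u v ⟨C, hC⟩ ⟨D, hD⟩
    exact ⟨C + D, fun n => (norm_add_le _ _).trans (add_le_add (hC n) (hD n))⟩
  neg_mem' := by
    rintro u ⟨C, hC⟩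
    exact ⟨C, fun n => by simpa using hC n⟩
  mul_mem' := by
    rintro u v ⟨C, hC⟩ ⟨D, hD⟩
    refine ⟨C * D, fun n => (norm_mul_le _ _).trans ?_⟩
    exact mul_le_mul (hC n) (hD n) (norm_nonneg _) ((norm_nonneg _).trans (hC n))

/-- The ideal of null sequences. -/
def nullSeq : TwoSidedIdeal (boundedSeq A) :=
  TwoSidedIdeal.mk' {u | Tendsto (fun n => (u : ℕ → A) n) atTop (𝓝 0)}
    tendsto_const_nhds (fun hx hy => by simpa using Tendsto.add hx hy)
    (fun hx => by simpa using Tendsto.neg hx)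
    (fun {x y} hy => by
      obtain ⟨C, hC⟩ := x.2
      refine squeeze_zero_norm (a := fun n => C * ‖(y : ℕ → A) n‖) (fun n => ?_) ?_
      · exact (norm_mul_le _ _).trans (mul_le_mul_of_nonneg_right (hC n) (norm_nonneg _))
      · simpa using (tendsto_zero_iff_norm_tendsto_zero.1 hy).const_mul C)
    (fun {x y} hx => by
      obtain ⟨C, hC⟩ := y.2
      refine squeeze_zero_norm (a := fun n => ‖(x : ℕ → A) n‖ * C) (fun n => ?_) ?_
      · exact (norm_mul_le _ _).trans (mul_le_mul_of_nonneg_left (hC n) (norm_nonneg _))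
      · simpa using (tendsto_zero_iff_norm_tendsto_zero.1 hx).mul_const C)

/-- The ring of bounded sequences modulo null sequences. -/
abbrev SeqQuotient : Type u := (nullSeq A).ringCon.Quotient

/-- The quotient map. -/
def seqMk : boundedSeq A →+* SeqQuotient A := (nullSeq A).ringCon.mk'

variable {A}

theorem seqMk_eq_iff {x y : boundedSeq A} :
    seqMk A x = seqMk A y ↔ Tendsto (fun n => (x : ℕ → A) n - (y : ℕ → A) n) atTop (𝓝 0) := by
  have h1 : seqMk A x = seqMk A y ↔ (nullSeq A).ringCon x y := (nullSeq A).ringCon.eq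
  rw [h1, TwoSidedIdeal.rel_iff, nullSeq, TwoSidedIdeal.mem_mk']
  rfl

/-- Constant sequences. -/
def constSeq : A →+* boundedSeq A where
  toFun a := ⟨fun _ => a, ‖a‖, fun _ => le_rfl⟩
  map_zero' := rfl
  map_one' := rfl
  map_add' _ _ := rfl
  map_mul' _ _ := rfl

/-- Evaluation of a bounded sequence. -/
def evalSeq (n : ℕ) : boundedSeq A →+* A :=
  (Pi.evalRingHom (fun _ : ℕ => A) n).comp (boundedSeq A).subtype

end Sequences

/-! ### The approximation property along sequences -/

section Approx

variable {A : Type u} [CStarAlgebra A] [PartialOrder A] [StarOrderedRing A] {G : Type v} [Group G]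

/-- For `0 ≤ c ≤ 1`, the element `1 - c⁶ = (1 - c)(1 + c + ⋯ + c⁵)` is approximately of the form
`r (1 - c - ε)₊ r⋆`. -/
theorem exists_norm_conj_cutDown_sub_le {c : A} (hc : 0 ≤ c) (hc1 : ‖c‖ ≤ 1) {ε : ℝ} (hε : 0 ≤ ε) :
    ∃ r : A, ‖r * cutDown (1 - c) ε * star r - (1 - c ^ 6)‖ ≤ 6 * ε := by
  have hsa : IsSelfAdjoint (1 - c) := (IsSelfAdjoint.one A).sub hc.isSelfAdjoint
  have hspec (t : ℝ) (ht : t ∈ spectrum ℝ (1 - c)) : 0 ≤ t ∧ t ≤ 1 := by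
    have h1 : 0 ≤ 1 - c := sub_nonneg.2 ((CStarAlgebra.norm_le_one_iff_of_nonneg c hc).1 hc1)
    have h2 : 1 - c ≤ algebraMap ℝ A 1 := by
      rw [map_one]
      exact sub_le_self _ hc
    exact ⟨spectrum_nonneg_of_nonneg h1 ht,
      (le_algebraMap_iff_spectrum_le (a := 1 - c) (r := (1 : ℝ)) hsa).1 h2 t ht⟩
  -- `f(1 - c) = 1 + c + ⋯ + c⁵`
  let f : ℝ → ℝ := fun t => ∑ i ∈ Finset.range 6, (1 - t) ^ i
  have hf (t : ℝ) (ht : t ∈ spectrum ℝ (1 - c)) : 0 ≤ f t ∧ f t ≤ 6 := by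
    obtain ⟨h0, h1⟩ := hspec t ht
    refine ⟨Finset.sum_nonneg fun i _ => pow_nonneg (by linarith) i, ?_⟩
    calc f t ≤ ∑ i ∈ Finset.range 6, (1 : ℝ) :=
          Finset.sum_le_sum fun i _ => pow_le_one₀ (by linarith) (by linarith)
      _ = 6 := by simp
  have hfc : Continuous f := by fun_prop
  have hr : Continuous fun t => √(f t) := by fun_prop
  have hcut : Continuous fun t : ℝ => max 0 (t - ε) := by fun_prop
  refine ⟨cfc (fun t => √(f t)) (1 - c), ?_⟩
  have hstar : star (cfc (fun t => √(f t)) (1 - c)) = cfc (fun t => √(f t)) (1 - c) :=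
    (cfc_predicate (fun t => √(f t)) (1 - c)).star_eq
  have hpow : 1 - c ^ 6 = cfc (fun t : ℝ => 1 - (1 - t) ^ 6) (1 - c) := by
    rw [cfc_sub (fun _ => 1) (fun t : ℝ => (1 - t) ^ 6) (1 - c) (by fun_prop) (by fun_prop),
      cfc_const_one ℝ (1 - c), cfc_pow (fun t : ℝ => 1 - t) 6 (1 - c) (by fun_prop),
      cfc_sub (fun _ => 1) (fun t : ℝ => t) (1 - c) (by fun_prop) (by fun_prop),
      cfc_const_one ℝ (1 - c), cfc_id' ℝ (1 - c), sub_sub_cancel]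
  rw [hstar, cutDown, hpow,
    ← cfc_mul (fun t => √(f t)) (fun t => max 0 (t - ε)) (1 - c) hr.continuousOn hcut.continuousOn,
    ← cfc_mul (fun t => √(f t) * max 0 (t - ε)) (fun t => √(f t)) (1 - c)
      (hr.mul hcut).continuousOn hr.continuousOn,
    ← cfc_sub (fun t => √(f t) * max 0 (t - ε) * √(f t)) (fun t => 1 - (1 - t) ^ 6) (1 - c)
      ((hr.mul hcut).mul hr).continuousOn (by fun_prop)]
  refine norm_cfc_le (by positivity) fun t ht => ?_
  obtain ⟨h0, h1⟩ := hspec t ht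
  obtain ⟨hf0, hf6⟩ := hf t ht
  have h2 : 1 - (1 - t) ^ 6 = t * f t := by
    simp only [f, Finset.sum_range_succ, Finset.sum_range_zero]
    ring
  have h3 : √(f t) * max 0 (t - ε) * √(f t) = max 0 (t - ε) * f t := by
    rw [mul_comm, ← mul_assoc, Real.mul_self_sqrt hf0, mul_comm]
  rw [h2, h3, ← sub_mul, norm_mul, Real.norm_eq_abs, Real.norm_eq_abs, abs_of_nonneg hf0, mul_comm]
  have h4 : |max 0 (t - ε) - t| ≤ ε := by
    rw [abs_le]
    constructor
    · linarith [le_max_right 0 (t - ε)]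
    · have : max 0 (t - ε) ≤ t := max_le h0 (by linarith)
      linarith
  exact mul_le_mul hf6 h4 (abs_nonneg _) (by norm_num)

/-- The sequential form of the approximation property of the action. -/
theorem IsWeaklyTraciallyStrictlyApproxInner.exists_seq {α : G →* (A ≃⋆ₐ[ℂ] A)}
    (hα : IsWeaklyTraciallyStrictlyApproxInner α) (F : Finset A) {x : A} (hx : 0 ≤ x)
    (hx1 : ‖x‖ = 1) : ∃ (c d r : ℕ → A) (s : G → ℕ → A),
      (∀ n, ‖c n‖ ≤ 1) ∧ (∀ g n, ‖s g n‖ ≤ 1) ∧ (∀ n, star (c n) = c n) ∧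
      (∀ n, SubeqElem (d n) x) ∧
      Tendsto (fun n => r n * d n * star (r n) - (1 - c n ^ 6)) atTop (𝓝 0) ∧
      Tendsto (fun n => s 1 n - c n) atTop (𝓝 0) ∧
      (∀ g, Tendsto (fun n => star (s g n) - s g⁻¹ n) atTop (𝓝 0)) ∧
      (∀ g h, Tendsto (fun n => s g n * s h n - c n * s (g * h) n) atTop (𝓝 0)) ∧
      (∀ a ∈ F, Tendsto (fun n => c n * a - a * c n) atTop (𝓝 0)) ∧
      (∀ g, Tendsto (fun n => c n * s g n - s g n * c n) atTop (𝓝 0)) ∧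
      ∀ a ∈ F, ∀ g,
        Tendsto (fun n => c n * α g a * c n - s g n * a * star (s g n)) atTop (𝓝 0) := by
  have hpos (n : ℕ) : (0 : ℝ) < 1 / ((n : ℝ) + 1) := by positivity
  choose c s hc hs h1 h2 h3 h4 h5 _ using fun n : ℕ => hα F _ (hpos n) x hx hx1
  choose r hr using fun n => exists_norm_conj_cutDown_sub_le (hc n).1 (hc n).2.2 (hpos n).le
  have hnull {u : ℕ → A} (h : ∀ n : ℕ, ‖u n‖ < 1 / ((n : ℝ) + 1)) : Tendsto u atTop (𝓝 0) :=
    squeeze_zero_norm (fun n => (h n).le) tendsto_one_div_add_atTop_nhds_zero_nat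
  refine ⟨c, fun n => cutDown (1 - c n) (1 / ((n : ℝ) + 1)), r, fun g n => s n g,
    fun n => (hc n).2.2, fun g n => (hs n g).2, fun n => (hc n).1.isSelfAdjoint.star_eq,
    h5, ?_, hnull fun n => (h1 n).1, fun g => hnull fun n => (h1 n).2 g,
    fun g h => hnull fun n => h2 n g h, fun a ha => hnull fun n => h3 n a (Or.inl ha),
    fun g => hnull fun n => h3 n _ (Or.inr ⟨g, rfl⟩), fun a ha g => hnull fun n => ?_⟩
  · refine squeeze_zero_norm hr ?_
    simpa using tendsto_one_div_add_atTop_nhds_zero_nat.const_mul (6 : ℝ)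
  · have := h4 n a ha g
    rwa [map_mul, map_mul, (hc n).2.1] at this

end Approx

/-! ### From compressions over the crossed product to compressions over `A` -/

section Core

variable {A : Type u} [CStarAlgebra A] [PartialOrder A] [StarOrderedRing A] {G : Type v} [Group G]
  [Fintype G] [DecidableEq G] {K : Type w} [Fintype K] [DecidableEq K]

/-- If `∑ g, Y g u_g` compresses `B` to `V V⋆` up to `ε` in the crossed product, then up to a
multiple of `ε` the matrix `V V⋆` is the sum of a compression of `B` over `A` itself and of a
matrix below a multiple of the given element `x`. -/
theorem IsWeaklyTraciallyStrictlyApproxInner.exists_conj_add_conj {α : G →* (A ≃⋆ₐ[ℂ] A)}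
    (hα : IsWeaklyTraciallyStrictlyApproxInner α) {x : A} (hx : 0 ≤ x) (hx1 : ‖x‖ = 1)
    (B V : Matrix K K A) (Y : G → Matrix K K A) {ε : ℝ} (hε : 0 < ε)
    (hcoeff : ∀ k i j, ‖((∑ h, Y (k * h) * B.map (α (k * h)) * (Y h)ᴴ.map (α k)) -
      if k = 1 then V * Vᴴ else 0 : Matrix K K A) i j‖ ≤ ε) :
    ∃ (Z W : Matrix K K A) (d : A), SubeqElem d x ∧ ∀ i j,
      ‖(Z * B * Zᴴ + W * (diagonal fun _ => d) * Wᴴ - V * Vᴴ : Matrix K K A) i j‖ ≤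
        (Fintype.card G + 1) * ε := by
  let β : G → Matrix K K A := fun g => B.map (α g)
  let γ : G → G → Matrix K K A := fun k h => (Y h)ᴴ.map (α k)
  -- the errors of the coefficients at `u_k`
  let N : G → Matrix K K A := fun k =>
    (∑ h, Y (k * h) * β (k * h) * γ k h) - if k = 1 then V * Vᴴ else 0
  -- all matrix entries that have to commute with `c` and to satisfy the covariance relation
  let F : Finset A := Set.Finite.toFinset
    (((Set.finite_range fun p : G × K × K => Y p.1 p.2.1 p.2.2).union
      (Set.finite_range fun p : G × K × K => β p.1 p.2.1 p.2.2)).union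
      ((Set.finite_range fun p : (G × G) × K × K => γ p.1.1 p.1.2 p.2.1 p.2.2).union
      (Set.finite_range fun p : K × K => Vᴴ p.1 p.2)))
  have hFY (g : G) (i j : K) : Y g i j ∈ F := by
    simp only [F, Set.Finite.mem_toFinset]
    exact Or.inl (Or.inl ⟨(g, i, j), rfl⟩)
  have hFβ (g : G) (i j : K) : β g i j ∈ F := by
    simp only [F, Set.Finite.mem_toFinset]
    exact Or.inl (Or.inr ⟨(g, i, j), rfl⟩)
  have hFγ (k h : G) (i j : K) : γ k h i j ∈ F := by
    simp only [F, Set.Finite.mem_toFinset]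
    exact Or.inr (Or.inl ⟨((k, h), i, j), rfl⟩)
  have hFV (i j : K) : Vᴴ i j ∈ F := by
    simp only [F, Set.Finite.mem_toFinset]
    exact Or.inr (Or.inr ⟨(i, j), rfl⟩)
  have hβ1 : β 1 = B := by
    ext i j
    exact CrossedProduct.act_one _
  have hγ1 (h : G) : γ 1 h = (Y h)ᴴ := by
    ext i j
    exact CrossedProduct.act_one _
  obtain ⟨c, d, r, s, hc1, hs1, hcs, hd, hr, hs, hss, hmul, hcF, hcS, hcov⟩ :=
    hα.exists_seq F hx hx1
  -- the sequences as elements of the ring of bounded sequences, and scalar matrices over it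
  let cb : boundedSeq A := ⟨c, 1, hc1⟩
  let sb : G → boundedSeq A := fun g => ⟨s g, 1, hs1 g⟩
  let tb : G → boundedSeq A := fun g => ⟨fun n => star (s g n), 1, fun n => by
    rw [norm_star]
    exact hs1 g n⟩
  let Cb : Matrix K K (boundedSeq A) := diagonal fun _ => cb
  let Sb : G → Matrix K K (boundedSeq A) := fun g => diagonal fun _ => sb g
  let Tb : G → Matrix K K (boundedSeq A) := fun g => diagonal fun _ => tb g
  let κb : Matrix K K A →+* Matrix K K (boundedSeq A) := (constSeq (A := A)).mapMatrix
  let φ : Matrix K K (boundedSeq A) →+* Matrix K K (SeqQuotient A) := (seqMk A).mapMatrix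
  let C := φ Cb
  let S : G → Matrix K K (SeqQuotient A) := fun g => φ (Sb g)
  let κ : Matrix K K A →+* Matrix K K (SeqQuotient A) := φ.comp κb
  have hCdef : C = diagonal fun _ => seqMk A cb := by
    simp only [C, φ, Cb, RingHom.mapMatrix_apply]
    rw [diagonal_map (map_zero _)]
  have hSdef (g : G) : S g = diagonal fun _ => seqMk A (sb g) := by
    simp only [S, φ, Sb, RingHom.mapMatrix_apply]
    rw [diagonal_map (map_zero _)]
  have hκ (X : Matrix K K A) (i j : K) : κ X i j = seqMk A (constSeq (X i j)) := rfl
  have htb (g : G) : seqMk A (tb g) = seqMk A (sb g⁻¹) := seqMk_eq_iff.2 (hss g)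
  have hT (g : G) : φ (Tb g) = S g⁻¹ := by
    rw [hSdef, ← htb]
    simp only [φ, Tb, RingHom.mapMatrix_apply]
    rw [diagonal_map (map_zero _)]
  have hCS (g : G) : Commute C (S g) := by
    have e : seqMk A (cb * sb g) = seqMk A (sb g * cb) := seqMk_eq_iff.2 (hcS g)
    rw [Commute, SemiconjBy, hCdef, hSdef, diagonal_mul_diagonal, diagonal_mul_diagonal,
      ← map_mul, ← map_mul, e]
  have hS1 : S 1 = C := by
    have e : seqMk A (sb 1) = seqMk A cb := seqMk_eq_iff.2 hs
    rw [hCdef, hSdef, e]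
  have hSS (g h : G) : S g * S h = C * S (g * h) := by
    have e : seqMk A (sb g * sb h) = seqMk A (cb * sb (g * h)) := seqMk_eq_iff.2 (hmul g h)
    rw [hCdef, hSdef, hSdef, hSdef, diagonal_mul_diagonal, diagonal_mul_diagonal,
      ← map_mul, ← map_mul, e]
  have hCκ (X : Matrix K K A) (hX : ∀ i j, X i j ∈ F) : Commute C (κ X) := by
    rw [Commute, SemiconjBy, hCdef]
    ext i j
    rw [diagonal_mul, mul_diagonal, hκ, ← map_mul, ← map_mul]
    exact seqMk_eq_iff.2 (hcF _ (hX i j))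
  have hcovκ (g : G) (X : Matrix K K A) (hX : ∀ i j, X i j ∈ F) :
      C * κ (X.map (α g)) * C = S g * κ X * S g⁻¹ := by
    rw [hCdef, hSdef, hSdef, ← htb]
    ext i j
    rw [mul_diagonal, diagonal_mul, mul_diagonal, diagonal_mul, hκ, hκ, ← map_mul, ← map_mul,
      ← map_mul, ← map_mul]
    exact seqMk_eq_iff.2 (hcov _ (hX i j) g)
  -- the error matrix over the bounded sequences, which vanishes modulo null sequences
  let Mb : Matrix K K (boundedSeq A) :=
    (Cb ^ 2 * ∑ g, κb (Y g) * Sb g) * κb B * ((∑ h, Tb h * κb (Y h)ᴴ) * Cb ^ 2) +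
      κb V * (1 - Cb ^ 6) * κb Vᴴ - κb (V * Vᴴ) - ∑ k, κb (N k) * (Cb ^ 5 * Sb k)
  have hMb : φ Mb = 0 := by
    have h1 : φ Mb = (C ^ 2 * ∑ g, κ (Y g) * S g) * κ B * ((∑ h, S h⁻¹ * κ (Y h)ᴴ) * C ^ 2) +
        κ V * (1 - C ^ 6) * κ Vᴴ - κ (V * Vᴴ) - ∑ k, κ (N k) * (C ^ 5 * S k) := by
      simp only [Mb, map_sub, map_add, map_mul φ, map_sum, map_pow, map_one, hT]
      rfl
    have h2 (k : G) : κ (N k) = (∑ h, κ (Y (k * h)) * κ (β (k * h)) * κ (γ k h)) -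
        if k = 1 then κ (V * Vᴴ) else 0 := by
      simp only [N, map_sub, map_sum, map_mul κ]
      split_ifs <;> simp
    have h3 := sum_conj_eq (C := C) (S := S) (B := κ B) (Y := fun g => κ (Y g))
      (Y' := fun h => κ (Y h)ᴴ) (β := fun g => κ (β g)) (γ := fun k h => κ (γ k h)) hCS hS1 hSS
      (hβ1 ▸ hCκ _ (hFβ 1)) (fun g => hCκ _ (hFY g)) (fun g => hCκ _ (hFβ g))
      (fun k h => hCκ _ (hFγ k h)) (fun g => hcovκ g B (hβ1 ▸ hFβ 1))
      (fun k h => hcovκ k _ (hγ1 h ▸ hFγ 1 h))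
    have h4 : κ V * (1 - C ^ 6) * κ Vᴴ = κ (V * Vᴴ) - κ (V * Vᴴ) * C ^ 6 := by
      have h5 := ((hCκ _ hFV).pow_left 6).eq
      rw [mul_sub, mul_one, sub_mul, mul_assoc _ _ (κ Vᴴ), h5, ← mul_assoc, ← map_mul]
    have h6 : C ^ 5 * S 1 = C ^ 6 := by rw [hS1, pow_succ C 5]
    rw [h1, h3, h4]
    simp only [h2, sub_mul, Finset.sum_sub_distrib, ite_mul, zero_mul, Finset.sum_ite_eq',
      Finset.mem_univ, if_true, h6]
    abel
  have hMnull (i j : K) : Tendsto (fun n => evalSeq n (Mb i j)) atTop (𝓝 0) := by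
    have h1 : seqMk A (Mb i j) = seqMk A 0 := by
      rw [map_zero]
      exact congrFun (congrFun hMb i) j
    exact (seqMk_eq_iff.1 h1).congr fun n => sub_zero _
  -- the terms of the sequence represented by `C² ∑ g, Y g S g`
  let Z : ℕ → Matrix K K A := fun n =>
    (diagonal fun _ => c n) ^ 2 * ∑ g, Y g * diagonal fun _ => s g n
  have hZ (n : ℕ) : (Z n)ᴴ = (∑ h, (diagonal fun _ => star (s h n)) * (Y h)ᴴ) *
      (diagonal fun _ => c n) ^ 2 := by
    have h1 : (diagonal fun _ : K => c n)ᴴ = diagonal fun _ => c n := by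
      rw [diagonal_conjTranspose]
      congr 1
      funext i
      exact hcs n
    have h2 (g : G) : (diagonal fun _ : K => s g n)ᴴ = diagonal fun _ => star (s g n) := by
      rw [diagonal_conjTranspose]
      rfl
    simp only [Z, conjTranspose_mul, conjTranspose_sum, h1, h2, conjTranspose_pow]
  have hMeval (n : ℕ) : (evalSeq n).mapMatrix Mb = Z n * B * (Z n)ᴴ +
      V * (1 - (diagonal fun _ => c n) ^ 6) * Vᴴ - V * Vᴴ -
      ∑ k, N k * ((diagonal fun _ => c n) ^ 5 * diagonal fun _ => s k n) := by
    have hev (X : Matrix K K A) : (evalSeq n).mapMatrix (κb X) = X := rfl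
    have hevd (u : boundedSeq A) : (evalSeq n).mapMatrix (diagonal fun _ : K => u) =
        diagonal fun _ : K => (u : ℕ → A) n := by
      rw [RingHom.mapMatrix_apply, diagonal_map (map_zero _)]
      rfl
    rw [hZ]
    simp only [Mb, map_sub, map_add, map_mul (evalSeq n).mapMatrix, map_sum, map_pow, map_one, hev,
      Cb, Sb, Tb, hevd, cb, sb, tb, Z]
  have hEnull : Tendsto (fun n => V * (diagonal fun _ => r n * d n * star (r n) - (1 - c n ^ 6)) *
      Vᴴ) atTop (𝓝 0) := by
    have hcont : Continuous fun a : A => V * (diagonal fun _ => a) * Vᴴ := by fun_prop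
    have := (hcont.tendsto 0).comp hr
    simpa [Function.comp_def] using this
  have hev1 : ∀ᶠ n in atTop, ∀ p : K × K, ‖evalSeq n (Mb p.1 p.2)‖ < ε / 2 :=
    eventually_all.2 fun p => ((tendsto_zero_iff_norm_tendsto_zero.1
      (hMnull p.1 p.2)).eventually_lt_const (by positivity))
  have hev2 : ∀ᶠ n in atTop, ∀ p : K × K, ‖(V * (diagonal fun _ => r n * d n * star (r n) -
      (1 - c n ^ 6)) * Vᴴ : Matrix K K A) p.1 p.2‖ < ε / 2 :=
    eventually_all.2 fun p => ((tendsto_zero_iff_norm_tendsto_zero.1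
      (tendsto_pi_nhds.1 (tendsto_pi_nhds.1 hEnull p.1) p.2)).eventually_lt_const (by positivity))
  obtain ⟨n, hn1, hn2⟩ := (hev1.and hev2).exists
  refine ⟨Z n, V * diagonal fun _ => r n, d n, hd n, fun i j => ?_⟩
  have hpow : (1 : Matrix K K A) - (diagonal fun _ => c n) ^ 6 = diagonal fun _ => 1 - c n ^ 6 := by
    rw [diagonal_pow, ← diagonal_one, diagonal_sub]
    rfl
  have hW : (V * diagonal fun _ => r n) * (diagonal fun _ => d n) * (V * diagonal fun _ => r n)ᴴ =
      V * (diagonal fun _ => r n * d n * star (r n)) * Vᴴ := by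
    rw [conjTranspose_mul, diagonal_conjTranspose, ← Matrix.mul_assoc, Matrix.mul_assoc V,
      diagonal_mul_diagonal, Matrix.mul_assoc V, diagonal_mul_diagonal]
    rfl
  have hsplit : Z n * B * (Z n)ᴴ +
      (V * diagonal fun _ => r n) * (diagonal fun _ => d n) * (V * diagonal fun _ => r n)ᴴ -
      V * Vᴴ = (evalSeq n).mapMatrix Mb +
      V * (diagonal fun _ => r n * d n * star (r n) - (1 - c n ^ 6)) * Vᴴ +
      ∑ k, N k * ((diagonal fun _ => c n) ^ 5 * diagonal fun _ => s k n) := by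
    have : (diagonal fun _ : K => r n * d n * star (r n) - (1 - c n ^ 6)) =
        (diagonal fun _ : K => r n * d n * star (r n)) - diagonal fun _ : K => 1 - c n ^ 6 := by
      rw [diagonal_sub]
    rw [hMeval, hW, hpow, this, Matrix.mul_sub, Matrix.sub_mul]
    abel
  have hterm (k : G) :
      ‖(N k * ((diagonal fun _ => c n) ^ 5 * diagonal fun _ => s k n) : Matrix K K A) i j‖ ≤ ε := by
    rw [diagonal_pow, diagonal_mul_diagonal, mul_diagonal]
    calc _ ≤ ‖N k i j‖ * (‖c n‖ ^ 5 * ‖s k n‖) := by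
          refine (norm_mul_le _ _).trans (mul_le_mul_of_nonneg_left ?_ (norm_nonneg _))
          exact (norm_mul_le _ _).trans (mul_le_mul_of_nonneg_right
            (norm_pow_le' _ (by norm_num)) (norm_nonneg _))
      _ ≤ ε * (1 ^ 5 * 1) := by
          gcongr
          · exact hcoeff k i j
          · exact hc1 n
          · exact hs1 k n
      _ = ε := by ring
  rw [hsplit, Matrix.add_apply, Matrix.add_apply, Matrix.sum_apply]
  have h1 :
      ‖∑ k, (N k * ((diagonal fun _ => c n) ^ 5 * diagonal fun _ => s k n) : Matrix K K A) i j‖ ≤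
      Fintype.card G * ε := by
    refine (norm_sum_le _ _).trans ?_
    calc _ ≤ ∑ k : G, ε := Finset.sum_le_sum fun k _ => hterm k
      _ = _ := by simp
  have h2 : ‖(evalSeq n).mapMatrix Mb i j‖ < ε / 2 := hn1 (i, j)
  have h3 := hn2 (i, j)
  calc _ ≤ ‖(evalSeq n).mapMatrix Mb i j‖ + ‖(V * (diagonal fun _ => r n * d n * star (r n) -
        (1 - c n ^ 6)) * Vᴴ : Matrix K K A) i j‖ +
        ‖∑ k, (N k * ((diagonal fun _ => c n) ^ 5 * diagonal fun _ => s k n) : Matrix K K A) i j‖ :=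
        norm_add₃_le
    _ ≤ _ := by simp only at h3; linarith

end Core

/-! ### Coefficients in the crossed product -/

section CrossedProduct

namespace CrossedProduct

variable {A : Type u} [CStarAlgebra A] {G : Type v} [Group G] {α : G →* (A ≃⋆ₐ[ℂ] A)}

theorem coeff_sum {ι : Type*} (s : Finset ι) (f : ι → CrossedProduct α) (g : G) :
    (∑ i ∈ s, f i).coeff g = ∑ i ∈ s, (f i).coeff g :=
  map_sum (⟨⟨fun x => x.coeff g, rfl⟩, fun _ _ => rfl⟩ : CrossedProduct α →+ A) f s

variable [Fintype G] [DecidableEq G]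

theorem coeff_incl (a : A) (g : G) : (incl α a).coeff g = if g = 1 then a else 0 := rfl

theorem incl_injective : Function.Injective (incl α) := fun a b h => by
  simpa [coeff_incl] using congrArg (fun x => coeff x 1) h

theorem coeff_mul_incl (x : CrossedProduct α) (b : A) (g : G) :
    (x * incl α b).coeff g = x.coeff g * α g b := by
  rw [coeff_mul, Finset.sum_eq_single g]
  · rw [inv_mul_cancel, coeff_incl, if_pos rfl]
  · intro k _ hk
    rw [coeff_incl, if_neg (by rwa [inv_mul_eq_one]), map_zero, mul_zero]
  · simp

/-- The coefficients of a compression of a matrix over `A` by a matrix over the crossed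
product. -/
theorem coeff_mul_map_incl_mul_conjTranspose {K : Type*} [Fintype K]
    (z : Matrix K K (CrossedProduct α)) (B : Matrix K K A) (k : G) (i j : K) :
    ((z * B.map (incl α) * zᴴ) i j).coeff k =
      (∑ h, (z.map fun x => x.coeff (k * h)) * B.map (α (k * h)) *
        (z.map fun x => x.coeff h)ᴴ.map (α k) : Matrix K K A) i j := by
  have h1 (x y : CrossedProduct α) (b : A) : (x * incl α b * star y).coeff k =
      ∑ h, x.coeff (k * h) * α (k * h) b * α k (star (y.coeff h)) := by
    rw [coeff_mul]
    refine (Fintype.sum_equiv (Equiv.mulLeft k) _ _ fun h => ?_).symm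
    rw [Equiv.coe_mulLeft, coeff_mul_incl, coeff_star, act_act]
    simp
  simp only [Matrix.mul_apply, Matrix.sum_apply, Finset.sum_mul, coeff_sum, Matrix.map_apply,
    conjTranspose_apply, h1]
  rw [Finset.sum_comm]
  conv_rhs => rw [Finset.sum_comm]
  refine Eq.trans ?_ (Finset.sum_congr rfl fun q _ => Finset.sum_comm)
  rw [Finset.sum_comm]

variable [PartialOrder A] [StarOrderedRing A]

omit [DecidableEq G] in
theorem norm_coeff_le (f : CrossedProduct α) (g : G) : ‖f.coeff g‖ ≤ ‖f‖ := by
  rw [coeff_eq_regRep, norm_def]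
  exact CStarMatrix.norm_entry_le_norm

end CrossedProduct

end CrossedProduct

/-! ### Reflection of subequivalence -/

section Reflection

variable {A : Type u} [CStarAlgebra A] [PartialOrder A] [StarOrderedRing A]

/-- Below every nonzero positive element of `K ⊗ A` there are arbitrarily many orthogonal copies of
some element of `A`. -/
theorem IsSimple.exists_subeqElem_ofMat_diagonal (hA : IsSimple A) (htypeI : ¬ IsTypeI A)
    {x : Stab A} (hx : IsPosElem x) (hx0 : x ≠ 0) (K : ℕ) :
    ∃ t : A, 0 ≤ t ∧ ‖t‖ = 1 ∧ SubeqElem (Stab.ofMat K (diagonal fun _ => t)) x := by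
  obtain ⟨t, ht, ht0, htx⟩ := Stab.exists_subeqElem_ofMat_one hx hx0
  obtain ⟨s, hs, hs0, hst⟩ := hA.exists_nsmul_le htypeI ht ht0 K
  rw [W.nsmul_mk_single] at hst
  have h1 : Subeq (diagonal fun _ : Fin K => s) !![t] := hst
  have hs' : 0 < ‖s‖ := norm_pos_iff.2 hs0
  refine ⟨((‖s‖⁻¹ : ℝ) : ℂ) • s, ?_, ?_, ?_⟩
  · have := smul_nonneg (inv_nonneg.2 hs'.le) (isPosElem_iff_nonneg.1 hs)
    rwa [← Complex.coe_smul] at this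
  · rw [norm_smul, Complex.norm_real, norm_inv, norm_norm, inv_mul_cancel₀ hs'.ne']
  · have h2 : SubeqElem (((‖s‖⁻¹ : ℝ) : ℂ) • s) s := by
      have := (Subeq.refl !![s]).real_smul (inv_nonneg.2 hs'.le)
      have e : ((‖s‖⁻¹ : ℝ) : ℂ) • !![s] = !![((‖s‖⁻¹ : ℝ) : ℂ) • s] := by
        ext i j
        fin_cases i
        fin_cases j
        rfl
      rwa [e] at this
    exact (Stab.subeqElem_ofMat_of_subeq ((h2.diagonal K).trans h1)).trans htx

variable {G : Type v} [Group G] [Fintype G] [DecidableEq G] {α : G →* (A ≃⋆ₐ[ℂ] A)}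

open CrossedProduct

/-- If the image of a matrix `w⋆ w` in the crossed product lies below that of a soft element `b`,
then `w⋆ w` is approximated by matrices over `A` that lie below `b`: the part of `b` split off by
softness accommodates the defect of the approximation of the action. -/
theorem IsWeaklyTraciallyStrictlyApproxInner.exists_near_subeqElem
    (hα : IsWeaklyTraciallyStrictlyApproxInner α) (hA : IsSimple A) (htypeI : ¬ IsTypeI A)
    {N : ℕ} (w : Matrix (Fin N) (Fin N) A) {b : Stab A} (hb : IsPosElem b)
    (hsoft : b ∈ softPart (Stab A))
    (h : SubeqElem (Stab.map (incl α) (Stab.ofMat N (wᴴ * w))) (Stab.map (incl α) b))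
    {ε : ℝ} (hε : 0 < ε) :
    ∃ m : Matrix (Fin N) (Fin N) A, SubeqElem (Stab.ofMat N m) b ∧
      ∀ i j, ‖m i j - (wᴴ * w) i j‖ ≤ (Fintype.card G + 1) * ε := by
  obtain ⟨y, hy⟩ := subeqElem_iff_exists_seq.1 h
  obtain ⟨l, hl⟩ := ((tendsto_iff_norm_sub_tendsto_zero.1 hy).eventually_lt_const hε).exists
  have hopen : IsOpen {e : Stab A | ‖y l * Stab.map (incl α) e * star (y l) -
      Stab.map (incl α) (Stab.ofMat N (wᴴ * w))‖ < ε} := by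
    have := continuous_starHom (Stab.map (incl α))
    exact isOpen_lt (by fun_prop) continuous_const
  obtain ⟨η, hη, hball⟩ := Metric.isOpen_iff.1 hopen b hl
  obtain ⟨d, x, hd, hx, hdb, hx0, hle⟩ := exists_mk_add_mk_le_of_mem_softPart hb hsoft hη
  have hdU := hball (show d ∈ Metric.ball b η by rwa [mem_ball_iff_norm])
  -- `b` may be replaced by a corner `b'` of `d`, since compressing by `y l` is continuous
  obtain ⟨M, hM⟩ :=
    ((Stab.tendsto_unit_mul_mul_unit d).eventually (hopen.mem_nhds hdU)).exists
  obtain ⟨b', hb'⟩ := Stab.exists_unit_mul_mul_unit_eq d M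
  have hb'd : SubeqElem (Stab.ofMat M b') d :=
    SubeqElem.of_eq (Stab.unit A M) (by rw [Stab.star_unit, hb'])
  rw [hb'] at hM
  let K := max N M
  have hNK : N ≤ K := le_max_left _ _
  have hMK : M ≤ K := le_max_right _ _
  let B : Matrix (Fin K) (Fin K) A := Stab.padMat K b'
  let V : Matrix (Fin K) (Fin K) A := Stab.padMat K wᴴ
  have hV : V * Vᴴ = Stab.padMat K (wᴴ * w) := by
    rw [Stab.padMat_conjTranspose, Stab.padMat_mul hNK, conjTranspose_conjTranspose]
  obtain ⟨z, hz⟩ := Stab.exists_matrix_of_norm_sub_lt (a := (V * Vᴴ).map (incl α))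
    (b := B.map (incl α)) (y l) (ε := ε) (by
      rw [← Stab.map_ofMat, ← Stab.map_ofMat, hV, Stab.ofMat_padMat hMK, Stab.ofMat_padMat hNK]
      exact hM)
  -- the defect is a compression of `diag(r, …, r)` with `r ≼ t`, and `K` copies of `t` lie
  -- below `x`
  obtain ⟨t, ht, ht1, htx⟩ := hA.exists_subeqElem_ofMat_diagonal htypeI hx hx0 K
  obtain ⟨Z, Y, r, hr, hZ⟩ := hα.exists_conj_add_conj ht ht1 B V
    (fun g => z.map fun c => c.coeff g) hε fun k i j => by
      have h1 := (norm_coeff_le _ k).trans (hz i j).le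
      have h2 : ((z * B.map (incl α) * zᴴ) i j - ((V * Vᴴ).map (incl α)) i j).coeff k =
          ((z * B.map (incl α) * zᴴ) i j).coeff k - (incl α ((V * Vᴴ) i j)).coeff k := rfl
      rw [h2, coeff_mul_map_incl_mul_conjTranspose, coeff_incl] at h1
      rw [Matrix.sub_apply]
      have h3 : (if k = 1 then V * Vᴴ else 0 : Matrix (Fin K) (Fin K) A) i j =
          if k = 1 then (V * Vᴴ) i j else 0 := by split_ifs <;> rfl
      rw [h3]
      exact h1
  let D : Matrix (Fin K) (Fin K) A := diagonal fun _ => r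
  let m : Matrix (Fin K) (Fin K) A := Z * B * Zᴴ + Y * D * Yᴴ
  have hm : SubeqElem (Stab.ofMat K m) b := by
    have h1 : Stab.ofMat K m = Stab.ofMat K Z * Stab.ofMat K B * star (Stab.ofMat K Z) +
        Stab.ofMat K Y * Stab.ofMat K D * star (Stab.ofMat K Y) := by
      simp only [m, Stab.ofMat_add, Stab.ofMat_mul, Stab.ofMat_conjTranspose]
    have h2 : SubeqElem (Stab.ofMat K B) d := by
      rw [Stab.ofMat_padMat hMK]
      exact hb'd
    have h3 : SubeqElem (Stab.ofMat K D) x :=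
      (Stab.subeqElem_ofMat_of_subeq (hr.diagonal K)).trans htx
    rw [SubeqElem, h1]
    exact ((subeq_add_fromBlocks _ _ _ _).trans (h2.fromBlocks h3)).trans (W.add_le_mk_iff.1 hle)
  refine ⟨m.submatrix (Fin.castLE hNK) (Fin.castLE hNK),
    (Stab.subeqElem_ofMat_of_subeq (Subeq.submatrix m _)).trans hm, fun i j => ?_⟩
  have := hZ (Fin.castLE hNK i) (Fin.castLE hNK j)
  have hpad : Stab.padMat K (wᴴ * w) (Fin.castLE hNK i) (Fin.castLE hNK j) = (wᴴ * w) i j := by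
    simp [Stab.padMat]
  rw [hV, Matrix.sub_apply, hpad] at this
  exact this

/-- The inclusion of `A` in the crossed product reflects subequivalence to a soft element. -/
theorem IsWeaklyTraciallyStrictlyApproxInner.subeqElem_of_map_incl
    (hα : IsWeaklyTraciallyStrictlyApproxInner α) (hA : IsSimple A) (htypeI : ¬ IsTypeI A)
    {a b : Stab A} (ha : IsPosElem a) (hb : IsPosElem b) (hsoft : b ∈ softPart (Stab A))
    (h : SubeqElem (Stab.map (incl α) a) (Stab.map (incl α) b)) : SubeqElem a b := by
  refine (isClosed_setOf_subeqElem b).mem_of_tendsto (Stab.tendsto_unit_mul_mul_unit a)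
    (Eventually.of_forall fun N => ?_)
  obtain ⟨a', ha'⟩ := Stab.exists_unit_mul_mul_unit_eq a N
  obtain ⟨w, hw⟩ : IsPosElem (CStarMatrix.ofMatrix a') := by
    refine IsPosElem.of_map (Stab.of N) Stab.isometry_of.injective ?_
    have := ha.conj (Stab.unit A N)
    rw [Stab.star_unit, ha'] at this
    exact this
  let w' : Matrix (Fin N) (Fin N) A := CStarMatrix.ofMatrix.symm w
  have hw' : a' = w'ᴴ * w' := congrArg CStarMatrix.ofMatrix.symm hw
  have hmap : SubeqElem (Stab.map (incl α) (Stab.ofMat N (w'ᴴ * w'))) (Stab.map (incl α) b) := by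
    refine Subeq.trans (SubeqElem.of_eq (Stab.map (incl α) (Stab.unit A N)) ?_) h
    rw [← map_star, ← map_mul, ← map_mul, Stab.star_unit, ha', hw']
  have hpos (n : ℕ) : (0 : ℝ) < 1 / ((n : ℝ) + 1) := by positivity
  choose m hm hlim using fun n : ℕ =>
    hα.exists_near_subeqElem hA htypeI w' hb hsoft hmap (hpos n)
  rw [Set.mem_ofPred_eq, ha', hw']
  refine (isClosed_setOf_subeqElem b).mem_of_tendsto
    ((Stab.continuous_ofMat.tendsto (w'ᴴ * w')).comp (f := m) (x := atTop)
      (tendsto_pi_nhds.2 fun i => tendsto_pi_nhds.2 fun j => ?_)) (Eventually.of_forall hm)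
  rw [tendsto_iff_norm_sub_tendsto_zero]
  refine squeeze_zero (fun _ => norm_nonneg _) (fun n => hlim n i j) ?_
  simpa using tendsto_one_div_add_atTop_nhds_zero_nat.const_mul ((Fintype.card G : ℝ) + 1)

end Reflection

/-! ### Ordered semigroup isomorphisms onto the image -/

section OrderIso

variable {M : Type u} {N : Type v} [AddCommMonoid M] [PartialOrder M] [AddCommMonoid N]
  [PartialOrder N]

/-- A monotone additive map that reflects the order on `S ∪ {0}`, where `S` is closed under
addition, restricts to an isomorphism of ordered semigroups from `S ∪ {0}` onto its image. -/
theorem inducesOrderedSemigroupIso_of_le (φ : M →+ N) (hφ : Monotone φ) {S : Set M}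
    (hS : ∀ x ∈ S, ∀ y ∈ S, x + y ∈ S)
    (hle : ∀ x ∈ S ∪ {0}, ∀ y ∈ S ∪ {0}, φ x ≤ φ y → x ≤ y) :
    InducesOrderedSemigroupIso φ (S ∪ {0}) := by
  let T : AddSubmonoid M :=
    { carrier := S ∪ {0}
      zero_mem' := Or.inr rfl
      add_mem' := by
        rintro x y (hx | rfl) (hy | rfl)
        · exact Or.inl (hS x hx y hy)
        · rw [add_zero]
          exact Or.inl hx
        · rw [zero_add]
          exact Or.inl hy
        · rw [add_zero]
          exact Or.inr rfl }
  have hT (x y : T) : φ (x : M) ≤ φ (y : M) ↔ x ≤ y := ⟨hle x x.2 y y.2, fun h => hφ h⟩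
  let f : T →+ T.map φ :=
    { toFun := fun x => ⟨φ (x : M), x, x.2, rfl⟩
      map_zero' := Subtype.ext (map_zero φ)
      map_add' := fun x y => Subtype.ext (map_add φ (x : M) (y : M)) }
  have hf : Function.Bijective f := by
    constructor
    · intro x y hxy
      have h : φ (x : M) = φ (y : M) := congrArg Subtype.val hxy
      exact le_antisymm ((hT x y).1 h.le) ((hT y x).1 h.ge)
    · rintro ⟨_, x, hx, rfl⟩
      exact ⟨⟨x, hx⟩, rfl⟩
  exact ⟨T, rfl, { AddEquiv.ofBijective f hf with map_le_map_iff' := fun {x y} => hT x y },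
    fun _ => rfl⟩

end OrderIso

/-! ### Reflection of the order of `Cu₊(A)` and of `W₊(A)` -/

section Main

variable {A : Type u} [CStarAlgebra A] [PartialOrder A] [StarOrderedRing A]

theorem W.monotone_map {A : Type u} {B : Type v} [NonUnitalCStarAlgebra A]
    [NonUnitalCStarAlgebra B] (θ : A →⋆ₙₐ[ℂ] B) : Monotone (W.map θ) := by
  intro x y h
  induction x using W.ind with | h a
  induction y using W.ind with | h b
  exact Subeq.map θ h

theorem W.map_mk_single_le_iff {A : Type u} {B : Type v} [NonUnitalCStarAlgebra A]
    [NonUnitalCStarAlgebra B] (θ : A →⋆ₙₐ[ℂ] B) {a b : A} (ha : IsPosElem a) (hb : IsPosElem b) :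
    W.map θ (W.mk (PosMat.single a ha)) ≤ W.map θ (W.mk (PosMat.single b hb)) ↔
      SubeqElem (θ a) (θ b) := by
  have h (c : A) : !![c].map θ = !![θ c] := by
    ext i j
    fin_cases i
    fin_cases j
    rfl
  have h1 : W.map θ (W.mk (PosMat.single a ha)) ≤ W.map θ (W.mk (PosMat.single b hb)) ↔
      Subeq (!![a].map θ) (!![b].map θ) := Iff.rfl
  rw [h1, h, h]

theorem mem_softW_iff {x : W A} : x ∈ softW A ↔ W.toCu x ∈ softCu A := by
  constructor
  · rintro ⟨a, rfl, h⟩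
    exact h
  · induction x using W.ind with | h a
    exact fun h => ⟨a, rfl, h⟩

variable {G : Type v} [Group G] [Fintype G] [DecidableEq G] {α : G →* (A ≃⋆ₐ[ℂ] A)}

open CrossedProduct

theorem eq_zero_of_map_incl_subeqElem_zero {a : Stab A}
    (h : SubeqElem (Stab.map (incl α) a) 0) : a = 0 := by
  obtain ⟨y, hy⟩ := subeqElem_iff_exists_seq.1 h
  simp only [mul_zero, zero_mul] at hy
  have h0 : Stab.map (incl α) a = 0 := tendsto_nhds_unique hy tendsto_const_nhds
  refine tendsto_nhds_unique (Stab.tendsto_unit_mul_mul_unit a)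
    (tendsto_const_nhds.congr fun N => ?_)
  obtain ⟨m, hm⟩ := Stab.exists_unit_mul_mul_unit_eq a N
  have h1 : Stab.ofMat N (m.map (incl α)) = Stab.ofMat N 0 := by
    rw [← Stab.map_ofMat, ← hm, map_mul, map_mul, h0, mul_zero, zero_mul, Stab.ofMat_zero]
  have h2 : m = 0 := by
    ext i j
    have := congrFun (congrFun (Stab.ofMat_injective h1) i) j
    exact incl_injective (this.trans (map_zero (incl α)).symm)
  rw [hm, h2, Stab.ofMat_zero]

/-- `Cu(ι)` reflects the order on `Cu₊(A) ∪ {0}`. -/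
theorem IsWeaklyTraciallyStrictlyApproxInner.le_of_cuMap_incl_le
    (hα : IsWeaklyTraciallyStrictlyApproxInner α) (hA : IsSimple A) (htypeI : ¬ IsTypeI A)
    {x y : Cu A} (hx : x ∈ softCu A ∪ {0}) (hy : y ∈ softCu A ∪ {0})
    (h : Cu.map (incl α) x ≤ Cu.map (incl α) y) : x ≤ y := by
  obtain ⟨a, ha, -, rfl⟩ | rfl := hx
  · obtain ⟨b, hb, hsoft, rfl⟩ | rfl := hy
    · exact hα.subeqElem_of_map_incl hA htypeI ha hb hsoft ((W.map_mk_single_le_iff _ ha hb).1 h)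
    · have h0 : IsPosElem (0 : Stab A) := ⟨0, by simp⟩
      rw [← W.mk_single_zero h0] at h ⊢
      have h1 := (W.map_mk_single_le_iff _ ha h0).1 h
      rw [map_zero] at h1
      have h2 := eq_zero_of_map_incl_subeqElem_zero h1
      subst h2
      exact le_rfl
  · exact W.zero_le y

/-- `W(ι)` and `Cu(ι)` are compatible with the inclusions `W(A) → Cu(A)` and
`W(C*(G, A, α)) → Cu(C*(G, A, α))`. -/
theorem cuMap_toCu_le_cuMap_toCu {x y : W A} (h : W.map (incl α) x ≤ W.map (incl α) y) :
    Cu.map (incl α) (W.toCu x) ≤ Cu.map (incl α) (W.toCu y) := by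
  induction x using W.ind with | h a
  induction y using W.ind with | h b
  refine (W.map_mk_single_le_iff _ a.isPosElem_of b.isPosElem_of).2 ?_
  have := Stab.subeqElem_ofMat_of_subeq
    (show Subeq (a.mat.map (incl α)) (b.mat.map (incl α)) from h)
  rw [← Stab.map_ofMat, ← Stab.map_ofMat] at this
  exact this

end Main

end CuntzSemigroup

theorem mainTheorem3 {A : Type*} {G : Type*} [CStarAlgebra A] [PartialOrder A] [StarOrderedRing A]
    [Group G] [Fintype G] [DecidableEq G] (α : G →* (A ≃⋆ₐ[ℂ] A))
    (hfin : CuntzSemigroup.IsStablyFinite A) (hsimple : CuntzSemigroup.IsSimple A)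
    (htypeI : ¬ CuntzSemigroup.IsTypeI A)
    (hα : CuntzSemigroup.IsWeaklyTraciallyStrictlyApproxInner α) :
    CuntzSemigroup.InducesOrderedSemigroupIso
      (CuntzSemigroup.W.map (CuntzSemigroup.CrossedProduct.incl α))
      (CuntzSemigroup.softW A ∪ {0}) ∧
    CuntzSemigroup.InducesOrderedSemigroupIso
      (CuntzSemigroup.Cu.map (CuntzSemigroup.CrossedProduct.incl α))
      (CuntzSemigroup.softCu A ∪ {0}) := by
  open CuntzSemigroup in
  have hadd (x : Cu A) (hx : x ∈ softCu A) (y : Cu A) (hy : y ∈ softCu A) :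
      x + y ∈ softCu A := by
    obtain ⟨a, ha, hsoft, rfl⟩ := hx
    obtain ⟨b, hb, -, rfl⟩ := hy
    exact add_mem_softCu hfin hsimple ha hsoft hb
  have hcu (x : W A) (hx : x ∈ softW A ∪ {0}) : W.toCu x ∈ softCu A ∪ {0} := by
    obtain hx | rfl := hx
    · exact Or.inl (mem_softW_iff.1 hx)
    · exact Or.inr (map_zero _)
  refine ⟨inducesOrderedSemigroupIso_of_le _ (W.monotone_map _) (fun x hx y hy => ?_)
      fun x hx y hy h => ?_,
    inducesOrderedSemigroupIso_of_le _ (W.monotone_map _) hadd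
      fun x hx y hy h => hα.le_of_cuMap_incl_le hsimple htypeI hx hy h⟩
  · rw [mem_softW_iff, map_add]
    exact hadd _ (mem_softW_iff.1 hx) _ (mem_softW_iff.1 hy)
  · exact W.toCu_le_toCu.1 (hα.le_of_cuMap_incl_le hsimple htypeI (hcu x hx) (hcu y hy)
      (cuMap_toCu_le_cuMap_toCu h))
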